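/- There is a deterministic algorithm (one fixed word-RAM program, which gets only the adjacency matrix of the graph as input) and a constant $C$ such that the following holds for all integers $n\ge 1$ and $k\ge 0$. If $G$ is a simple undirected graph on $n$ vertices, at least $n-k$ of which have degree at least $n/2$, then on input $G$ the algorithm decides correctly whether $G$ is Hamiltonian (contains a cycle through all its vertices), in at most $C\,(8^k k^2+n^3)$ steps. In other words, Hamiltonian Cycle on these graphs can be solved in deterministic time $O(8^k\cdot k^2+n^3)$. Here the word RAM has random-access memory and registers, performs one arithmetic operation (addition, truncated subtraction, multiplication, integer division), comparison, load or store per step, and uses words of $O(k+\log n)$ bits, i.e. all numbers and addresses that occur in the run are less than $2^{C(k+\log_2 n+1)}$, with $\log_2 n$ rounded down. The value of $k$ is not part of the input. A graph with one vertex counts as Hamiltonian, one with two vertices does not. -/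

import Mathlib

/-! ## A deterministic word RAM

The machine has registers (a program mentions only finitely many of them) and a random-access memory
of words. Programs are structured: straight-line three-address instructions, sequencing,
branching and while-loops. Every executed instruction and every evaluated test costs one step. Words are
`w` bits long: a run in which a computed value does not fit into `w` bits is not a valid run. -/

namespace WordRAM

/-- Contents of the registers and of the memory. -/
structure State where
  reg : ℕ → ℕ
  mem : ℕ → ℕ

/-- An operand is a constant written in the program, or the content of a register. -/
inductive Operand where
  | lit (c : ℕ)
  | reg (r : ℕ)

def Operand.val (s : State) : Operand → ℕ
  | .lit c => c
  | .reg r => s.reg r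

/-- Arithmetic of natural numbers: addition, truncated subtraction, multiplication, and integer
division rounded down (with value `0` if the divisor is `0`). -/
inductive Op where
  | add
  | sub
  | mul
  | div

def Op.apply : Op → ℕ → ℕ → ℕ
  | .add, a, b => a + b
  | .sub, a, b => a - b
  | .mul, a, b => a * b
  | .div, a, b => a / b

/-- The tests that branches and loops may use. -/
inductive Test where
  | lt (a b : Operand)
  | eq (a b : Operand)

def Test.holds (s : State) : Test → Prop
  | .lt a b => a.val s < b.val s
  | .eq a b => a.val s = b.val s

/-- Programs. `set r a` puts the operand `a` into register `r`; `arith r o a b` puts the result of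
the operation `o` on the operands `a`, `b` into register `r`; `load r a` puts the memory cell with
address `a` into register `r`; `store a b` puts the operand `b` into the memory cell with
address `a`. -/
inductive Prog where
  | skip
  | set (r : ℕ) (a : Operand)
  | arith (r : ℕ) (o : Op) (a b : Operand)
  | load (r : ℕ) (a : Operand)
  | store (a b : Operand)
  | seq (p q : Prog)
  | ite (c : Test) (p q : Prog)
  | while (c : Test) (p : Prog)

def State.setReg (s : State) (r v : ℕ) : State :=
  { s with reg := Function.update s.reg r v }

def State.setMem (s : State) (a v : ℕ) : State :=
  { s with mem := Function.update s.mem a v }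

/-- `Exec w p s t s'`: with words of `w` bits, the program `p` started in the state `s` halts in
the state `s'` after exactly `t` steps. Every value written and every address used is required to be
less than `2 ^ w`. -/
inductive Exec (w : ℕ) : Prog → State → ℕ → State → Prop
  | skip (s : State) : Exec w .skip s 1 s
  | set (s : State) (r : ℕ) (a : Operand) (h : a.val s < 2 ^ w) :
      Exec w (.set r a) s 1 (s.setReg r (a.val s))
  | arith (s : State) (r : ℕ) (o : Op) (a b : Operand)
      (h : o.apply (a.val s) (b.val s) < 2 ^ w) :
      Exec w (.arith r o a b) s 1 (s.setReg r (o.apply (a.val s) (b.val s)))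
  | load (s : State) (r : ℕ) (a : Operand) (ha : a.val s < 2 ^ w)
      (h : s.mem (a.val s) < 2 ^ w) :
      Exec w (.load r a) s 1 (s.setReg r (s.mem (a.val s)))
  | store (s : State) (a b : Operand) (ha : a.val s < 2 ^ w) (h : b.val s < 2 ^ w) :
      Exec w (.store a b) s 1 (s.setMem (a.val s) (b.val s))
  | seq (p q : Prog) (s s₁ s₂ : State) (t₁ t₂ : ℕ) (hp : Exec w p s t₁ s₁)
      (hq : Exec w q s₁ t₂ s₂) : Exec w (.seq p q) s (t₁ + t₂) s₂
  | iteTrue (c : Test) (p q : Prog) (s s₁ : State) (t : ℕ) (hc : c.holds s)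
      (hp : Exec w p s t s₁) : Exec w (.ite c p q) s (1 + t) s₁
  | iteFalse (c : Test) (p q : Prog) (s s₁ : State) (t : ℕ) (hc : ¬ c.holds s)
      (hq : Exec w q s t s₁) : Exec w (.ite c p q) s (1 + t) s₁
  | whileFalse (c : Test) (p : Prog) (s : State) (hc : ¬ c.holds s) :
      Exec w (.while c p) s 1 s
  | whileTrue (c : Test) (p : Prog) (s s₁ s₂ : State) (t₁ t₂ : ℕ) (hc : c.holds s)
      (hp : Exec w p s t₁ s₁) (hw : Exec w (.while c p) s₁ t₂ s₂) :
      Exec w (.while c p) s (1 + t₁ + t₂) s₂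

/-- The machine is deterministic: the program and the initial state determine the number of steps
and the final state (and these do not depend on the word length, as long as the words suffice). -/
theorem Exec.deterministic {w w' : ℕ} {p : Prog} {s s₁ s₂ : State} {t₁ t₂ : ℕ}
    (h₁ : Exec w p s t₁ s₁) (h₂ : Exec w' p s t₂ s₂) : t₁ = t₂ ∧ s₁ = s₂ := by
  induction h₁ generalizing t₂ s₂ with
  | skip | set | arith | load | store => cases h₂; exact ⟨rfl, rfl⟩
  | seq p q s a b t u _ _ ihp ihq =>
    cases h₂ with
    | seq _ _ _ _ _ _ _ hp hq =>
      obtain ⟨rfl, rfl⟩ := ihp hp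
      obtain ⟨rfl, rfl⟩ := ihq hq
      exact ⟨rfl, rfl⟩
  | iteTrue c p q s a t hc _ ih =>
    cases h₂ with
    | iteTrue _ _ _ _ _ _ _ hp => obtain ⟨rfl, rfl⟩ := ih hp; exact ⟨rfl, rfl⟩
    | iteFalse _ _ _ _ _ _ hc' _ => exact absurd hc hc'
  | iteFalse c p q s a t hc _ ih =>
    cases h₂ with
    | iteTrue _ _ _ _ _ _ hc' _ => exact absurd hc' hc
    | iteFalse _ _ _ _ _ _ _ hp => obtain ⟨rfl, rfl⟩ := ih hp; exact ⟨rfl, rfl⟩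
  | whileFalse c p s hc =>
    cases h₂ with
    | whileFalse => exact ⟨rfl, rfl⟩
    | whileTrue _ _ _ _ _ _ _ hc' => exact absurd hc' hc
  | whileTrue c p s a b t u hc _ _ ihp ihw =>
    cases h₂ with
    | whileFalse _ _ _ hc' => exact absurd hc hc'
    | whileTrue _ _ _ _ _ _ _ _ hp hw =>
      obtain ⟨rfl, rfl⟩ := ihp hp
      obtain ⟨rfl, rfl⟩ := ihw hw
      exact ⟨rfl, rfl⟩

/-- The initial state for the input graph `G` on the vertices `0, …, n - 1`: register `0` holds
`n`, the memory cell `i * n + j` (for `i, j < n`) holds the entry `(i, j)` of the adjacency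
matrix, and everything else is `0`. -/
def graphInput {n : ℕ} (G : SimpleGraph (Fin n)) [DecidableRel G.Adj] : State where
  reg r := if r = 0 then n else 0
  mem a :=
    if h : a < n * n then
      if G.Adj ⟨a / n, Nat.div_lt_of_lt_mul h⟩
          ⟨a % n, Nat.mod_lt a (Nat.pos_of_ne_zero fun h0 => by simp [h0] at h)⟩ then 1 else 0
    else 0

end WordRAM

/-! ### Hamiltonian cycles as cyclic lists -/

/-! Call a vertex high if its degree is at least `n / 2` and low otherwise, and let `S` be the set
of low vertices, at most `k` in number. By the crossing argument of Ore (`hamOn_of_path`,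
`HamOn.remove_edge`), joining two high vertices does not create Hamiltonicity, so by
`HamOn.of_closure` the high vertices may be taken to form a clique. It remains to shrink this clique
to `O(k)` vertices.

The shrinking is a matching argument. A set `Y` of high vertices is grown greedily under the
condition that, for each `T ⊆ S`, at most `2|T|` vertices of `Y` have all their low neighbours in
`T`. This is Hall's condition for matching `Y` into two copies of `S`; with `T = S` it gives `|Y| ≤
2k`. When nothing can be added, every remaining high vertex has all its low neighbours in some tight
`T`, one with equality. Tight sets are closed under union (`exists_tight`), so a single tight `T`
serves all remaining vertices, and by Hall's theorem (`exists_private`) each vertex of `T` owns two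
private neighbours in `Y`, none of which has a low neighbour outside `T`.

A Hamiltonian cycle of the whole graph can then be rerouted into the chosen vertices
(`HamOn.restrict`): wherever the cycle passes between a vertex of `T` and the clique, a private
neighbour is put in between, after which the unchosen vertices have only clique vertices beside them
and can be dropped. Conversely, if clique vertices form a strict majority, a cycle on the chosen
vertices runs through a clique edge, into which all missing vertices can be inserted
(`HamOn.extend`). For this majority the choice is padded to `3k + 3` vertices, or to all vertices if
there are fewer; `hamOn_chosen_iff` combines both directions.

The small instance is solved by dynamic programming over vertex sets and end vertices (`pathOn_iff`,
`hamOn_range_iff`) in time `O(2^(3k+3) (3k+3)^2) = O(8^k k^2)` for `k > 0`. The greedy choice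
inspects all `2^k` sets `T` for each vertex, at cost `O((k + 1)^2)` per set; the total is absorbed
by `8^k k^2 + n^3` (`mul_two_pow_le`). The running times come from two compositional judgements,
`Ev` for expressions and `Cm` for commands, which carry values, step bounds and word-length
conditions together. -/

/-- The relation `r` has a cycle through exactly the elements of `A`, each visited once. -/
def HamOn {α : Type*} (r : α → α → Prop) (A : Finset α) : Prop :=
  ∃ l : List α, l.Nodup ∧ (∀ x, x ∈ l ↔ x ∈ A) ∧ Cycle.Chain r (l : Cycle α)

section HamOn

variable {α : Type*} {r : α → α → Prop} {A B : Finset α}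

/-- A rotation lets the cycle start at any prescribed vertex; repeating that vertex at the end turns
the cyclic condition into a condition on an ordinary list. -/
theorem HamOn.exists_cons (h : HamOn r A) {a : α} (ha : a ∈ A) :
    ∃ t : List α, (a :: t).Nodup ∧ (∀ x, x ∈ a :: t ↔ x ∈ A) ∧ List.IsChain r (a :: (t ++ [a])) := by
  obtain ⟨l, hn, hm, hc⟩ := h
  obtain ⟨s, t, rfl⟩ := List.append_of_mem ((hm a).2 ha)
  have hrot : (s ++ a :: t) ~r (a :: t ++ s) := List.isRotated_append
  refine ⟨t ++ s, ?_, ?_, ?_⟩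
  · simpa using hrot.nodup_iff.1 hn
  · intro x
    rw [← hm x, hrot.mem_iff]
    simp
  · rw [Cycle.coe_eq_coe.2 hrot] at hc
    simpa [Cycle.chain_coe_cons] using hc

theorem HamOn.of_cons {a : α} {t : List α} (hn : (a :: t).Nodup) (hm : ∀ x, x ∈ a :: t ↔ x ∈ A)
    (hc : List.IsChain r (a :: (t ++ [a]))) : HamOn r A :=
  ⟨a :: t, hn, hm, by rwa [Cycle.chain_coe_cons]⟩

/-- Consecutive elements of a cycle of length at least two are different. -/
theorem HamOn.imp_of_ne {r' : α → α → Prop} (h : HamOn r A) (hA : 2 ≤ A.card)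
    (hr : ∀ x ∈ A, ∀ y ∈ A, x ≠ y → r x y → r' x y) : HamOn r' A := by
  classical
  obtain ⟨a, ha⟩ : A.Nonempty := Finset.card_pos.1 (by omega)
  obtain ⟨t, hn, hm, hc⟩ := h.exists_cons ha
  refine HamOn.of_cons hn hm ?_
  have ht : t ≠ [] := by
    rintro rfl
    have : A = {a} := by ext x; simpa using (hm x).symm
    simp [this] at hA
  -- Distinctness inside the list is `Nodup`; the closing pair is distinct only because `t` is
  -- nonempty.
  have hne : List.IsChain (· ≠ ·) (a :: (t ++ [a])) := by
    rw [← List.cons_append, List.isChain_append]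
    refine ⟨hn.isChain, List.isChain_singleton _, ?_⟩
    intro x hx y hy
    have hx' : x ∈ t := by
      rw [List.getLast?_cons_of_ne_nil ht] at hx
      exact List.mem_of_mem_getLast? hx
    simp only [List.head?_cons, Option.mem_def, Option.some.injEq] at hy
    subst hy
    rintro rfl
    exact (List.nodup_cons.1 hn).1 hx'
  have hmem : ∀ x ∈ a :: (t ++ [a]), x ∈ A := by
    intro x hx
    rw [← hm x]
    simp only [List.mem_cons, List.mem_append, List.not_mem_nil, or_false] at hx ⊢
    tauto
  rw [List.isChain_iff_getElem] at hc hne ⊢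
  intro i hi
  exact hr _ (hmem _ (List.getElem_mem _)) _ (hmem _ (List.getElem_mem _)) (hne i hi) (hc i hi)

/-! ### The Bondy–Chvátal closure step -/

open Classical in
-- The degree condition forces a crossing: an index `i` with `u` adjacent to `p[i + 1]` and `v`
-- adjacent to `p[i]`. Then `p[0], …, p[i]`, followed by the rest of the path backwards from `v` to
-- `p[i + 1]`, closes up to a cycle.
theorem hamOn_of_path (hs : ∀ x y, r x y → r y x) {p : List α} {u v : α} (hn : p.Nodup)
    (hm : ∀ x, x ∈ p ↔ x ∈ A) (hc : List.IsChain r p) (hu : p.head? = some u)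
    (hv : p.getLast? = some v) (hir : ¬ r u u) (hirv : ¬ r v v)
    (hdeg : A.card ≤ (A.filter (r u)).card + (A.filter (r v)).card) : HamOn r A := by
  have hcard : A.card = p.length := by
    rw [← List.toFinset_card_of_nodup hn]
    congr 1; ext x; simp [hm]
  have hp : 0 < p.length := by
    cases p with
    | nil => simp at hu
    | cons => simp
  have hu' : p[0] = u := by
    rw [List.head?_eq_getElem?, List.getElem?_eq_getElem hp] at hu
    simpa using hu
  have hv' : p[p.length - 1] = v := by
    rw [List.getLast?_eq_getElem?, List.getElem?_eq_getElem (by omega)] at hv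
    simpa using hv
  let g : ℕ → α := fun i => p.getD i u
  have hg : ∀ i (hi : i < p.length), g i = p[i] := fun i hi => by simp [g, hi]
  set X := (Finset.range (p.length - 1)).filter fun i => r u (g (i + 1)) with hX
  set Y := (Finset.range (p.length - 1)).filter fun i => r v (g i) with hY
  have h1 : (A.filter (r u)).card ≤ X.card := by
    refine (Finset.card_le_card ?_).trans (Finset.card_image_le (f := fun i => g (i + 1)))
    intro x hx
    obtain ⟨hxA, hxr⟩ := Finset.mem_filter.1 hx
    obtain ⟨i, hi, rfl⟩ := List.getElem_of_mem ((hm x).2 hxA)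
    rcases i with _ | i
    · rw [hu'] at hxr; exact absurd hxr hir
    · refine Finset.mem_image.2 ⟨i, ?_, hg _ hi⟩
      simp only [hX, Finset.mem_filter, Finset.mem_range]
      exact ⟨by omega, by rwa [hg _ hi]⟩
  have h2 : (A.filter (r v)).card ≤ Y.card := by
    refine (Finset.card_le_card ?_).trans (Finset.card_image_le (f := g))
    intro x hx
    obtain ⟨hxA, hxr⟩ := Finset.mem_filter.1 hx
    obtain ⟨i, hi, rfl⟩ := List.getElem_of_mem ((hm x).2 hxA)
    refine Finset.mem_image.2 ⟨i, ?_, hg _ hi⟩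
    simp only [hY, Finset.mem_filter, Finset.mem_range]
    refine ⟨?_, by rwa [hg _ hi]⟩
    by_contra hlt
    obtain rfl : i = p.length - 1 := by omega
    rw [hv'] at hxr
    exact hirv hxr
  -- Pigeonhole: both index sets lie among `p.length - 1` positions, while their sizes add up to at
  -- least `p.length`.
  have hXY : (X ∩ Y).Nonempty := by
    rw [← Finset.card_pos]
    have h3 := Finset.card_union_add_card_inter X Y
    have h4 : (X ∪ Y).card ≤ p.length - 1 := by
      refine (Finset.card_le_card (t := Finset.range (p.length - 1)) ?_).trans (by simp)
      exact Finset.union_subset (Finset.filter_subset _ _) (Finset.filter_subset _ _)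
    omega
  obtain ⟨i, hi⟩ := hXY
  simp only [hX, hY, Finset.mem_inter, Finset.mem_filter, Finset.mem_range] at hi
  obtain ⟨⟨hi1, hui⟩, -, hvi⟩ := hi
  rw [hg _ (by omega)] at hui hvi
  have hperm : (p.take (i + 1) ++ (p.drop (i + 1)).reverse).Perm p := by
    conv_rhs => rw [← List.take_append_drop (i + 1) p]
    exact List.Perm.append_left _ (List.reverse_perm _)
  refine ⟨p.take (i + 1) ++ (p.drop (i + 1)).reverse, hperm.nodup_iff.2 hn,
    fun x => by rw [hperm.mem_iff, hm], ?_⟩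
  obtain ⟨q, rfl⟩ : ∃ q, p = u :: q := by
    cases p with
    | nil => simp at hu
    | cons b q => simp at hu; exact ⟨q, by rw [hu]⟩
  rw [List.take_succ_cons, List.cons_append, Cycle.chain_coe_cons, ← List.cons_append,
    ← List.cons_append, ← List.take_succ_cons]
  have hc1 := hc.take (i + 1)
  have hc2 : List.IsChain r ((u :: q).drop (i + 1)).reverse := by
    rw [List.isChain_reverse]
    exact (hc.drop (i + 1)).imp fun a b => hs a b
  have hlast : ((u :: q).take (i + 1)).getLast? = some (u :: q)[i] := by
    rw [List.getLast?_eq_getElem?, List.getElem?_take]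
    have : i ≤ q.length := by simp at hi1; omega
    simp [this, Nat.lt_succ_of_le this]
  have hdl : ((u :: q).drop (i + 1)).getLast? = some v := by
    rw [List.getLast?_drop]
    simp only [List.length_cons] at hi1 ⊢
    rw [if_neg (by omega), hv]
  have hdh : ((u :: q).drop (i + 1)).head? = some ((u :: q)[i + 1]'(by omega)) := by
    rw [List.head?_drop, List.getElem?_eq_getElem]
  rw [List.isChain_append, List.isChain_append]
  refine ⟨⟨hc1, hc2, ?_⟩, List.isChain_singleton _, ?_⟩
  · intro x hx y hy
    rw [hlast] at hx
    rw [List.head?_reverse, hdl] at hy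
    simp only [Option.mem_def, Option.some.injEq] at hx hy
    subst hx hy
    exact hs _ _ hvi
  · intro x hx y hy
    rw [List.getLast?_append, List.getLast?_reverse, hdh] at hx
    simp only [List.head?_cons, Option.mem_def, Option.some.injEq, Option.some_or] at hx hy
    subst hx hy
    exact hs _ _ hui

open Classical in
/-- Ore's lemma: an edge between two vertices of large degree sum is not needed. -/
theorem HamOn.remove_edge (hs : ∀ x y, r x y → r y x) {u v : α} (huv : u ≠ v)
    (hu : u ∈ A) (hv : v ∈ A) (hir : ¬ r u u) (hirv : ¬ r v v)
    (hdeg : A.card ≤ (A.filter (r u)).card + (A.filter (r v)).card)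
    (h : HamOn (fun x y => r x y ∨ (x = u ∧ y = v) ∨ (x = v ∧ y = u)) A) : HamOn r A := by
  by_cases hruv : r u v
  · obtain ⟨l, h1, h2, h3⟩ := h
    refine ⟨l, h1, h2, h3.imp ?_⟩
    rintro a b (h | ⟨rfl, rfl⟩ | ⟨rfl, rfl⟩)
    exacts [h, hruv, hs _ _ hruv]
  obtain ⟨t, hn, hm, hc⟩ := h.exists_cons hu
  have hvt : v ∈ t := by
    have := (hm v).2 hv
    simpa [huv.symm] using this
  -- the case that the new edge closes the cycle
  have key : ∀ t : List α, (u :: t).Nodup → (∀ x, x ∈ u :: t ↔ x ∈ A) →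
      List.IsChain (fun x y => r x y ∨ (x = u ∧ y = v) ∨ (x = v ∧ y = u)) (u :: t) →
      t.getLast? = some v → HamOn r A := by
    intro t hn hm hc hl
    have hut := (List.nodup_cons.1 hn).1
    rcases t with _ | ⟨b, t⟩
    · simp at hl
    -- After the first step the list avoids `u`, so the new edge cannot occur there.
    have hct : List.IsChain r (b :: t) := by
      refine hc.of_cons.imp_of_mem_imp ?_
      rintro x y hx hy (h | ⟨rfl, rfl⟩ | ⟨rfl, rfl⟩)
      exacts [h, absurd hx hut, absurd hy hut]
    -- If the first step already leads to `v`, then `A` is just `{u, b}`. Without an `r`-edge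
    -- between them both degrees vanish, against the degree condition.
    by_cases hb : b = v
    · have ht : t = [] := by
        rcases List.eq_nil_or_concat t with rfl | ⟨t', c, rfl⟩
        · rfl
        · rw [List.concat_eq_append, ← List.cons_append, List.getLast?_concat,
            Option.some.injEq] at hl
          subst hl hb
          simp at hn
      subst ht hb
      have hA : ∀ x ∈ A, x = u ∨ x = b := fun x hx => by simpa using (hm x).2 hx
      have e1 : A.filter (r u) = ∅ := by
        ext x
        simp only [Finset.mem_filter, Finset.notMem_empty, iff_false, not_and]
        intro hx
        rcases hA x hx with rfl | rfl <;> assumption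
      have e2 : A.filter (r b) = ∅ := by
        ext x
        simp only [Finset.mem_filter, Finset.notMem_empty, iff_false, not_and]
        intro hx
        rcases hA x hx with rfl | rfl
        · exact fun h => hruv (hs _ _ h)
        · assumption
      rw [e1, e2] at hdeg
      have : A = ∅ := by simpa using hdeg
      simp [this] at hu
    · refine hamOn_of_path hs hn hm (List.IsChain.cons_cons ?_ hct) rfl ?_ hir hirv hdeg
      · have := hc.rel
        rcases this with h | ⟨-, h⟩ | ⟨h, -⟩
        exacts [h, absurd h hb, absurd h huv]
      · simpa [List.getLast?_cons] using hl
  have hut := (List.nodup_cons.1 hn).1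
  by_cases hl : t.getLast? = some v
  · exact key t hn hm (by rw [← List.cons_append] at hc; exact hc.left_of_append) hl
  -- The new edge is the first step of the cycle; reversing the orientation makes it the closing
  -- one.
  by_cases hh : t.head? = some v
  · refine key t.reverse ?_ ?_ ?_ (by simpa using hh)
    · simpa using hn
    · simpa using hm
    · have h2 : List.IsChain (fun x y => r x y ∨ (x = u ∧ y = v) ∨ (x = v ∧ y = u))
          (u :: (t ++ [u])).reverse := by
        rw [List.isChain_reverse]
        refine hc.imp ?_
        rintro a b (h | h | h)
        exacts [Or.inl (hs _ _ h), Or.inr (Or.inr h.symm), Or.inr (Or.inl h.symm)]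
      rw [List.reverse_cons, List.reverse_append] at h2
      exact (by simpa using h2.left_of_append)
  -- Here `v` is not next to `u` on the cycle, so the cycle does not use the new edge at all.
  refine HamOn.of_cons hn hm ?_
  rcases t with _ | ⟨b, t⟩
  · simp at hvt
  have hct : List.IsChain r (b :: t) := by
    rw [List.isChain_cons, List.isChain_append] at hc
    refine hc.2.1.imp_of_mem_imp ?_
    rintro x y hx hy (h | ⟨rfl, rfl⟩ | ⟨rfl, rfl⟩)
    exacts [h, absurd hx hut, absurd hy hut]
  rw [List.isChain_cons, List.isChain_append] at hc ⊢
  refine ⟨?_, hct, List.isChain_singleton _, ?_⟩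
  · intro y hy
    rcases hc.1 y hy with h | ⟨-, h⟩ | ⟨h, -⟩
    · exact h
    · simp at hy hh; exact absurd (hy.trans h) hh
    · exact absurd h huv
  · intro x hx y hy
    rcases hc.2.2.2 x hx y hy with h | ⟨rfl, h⟩ | ⟨rfl, h⟩
    · exact h
    · exact absurd (List.mem_of_mem_getLast? hx) hut
    · exact absurd hx hl

open Classical in
/-- Joining all vertices of degree at least half the order does not create Hamiltonicity. -/
theorem HamOn.of_closure (hs : ∀ x y, r x y → r y x) (hir : ∀ x, ¬ r x x) (hi : α → Prop)
    (hdeg : ∀ x ∈ A, hi x → A.card ≤ 2 * (A.filter (r x)).card) (hA : 2 ≤ A.card)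
    (h : HamOn (fun x y => r x y ∨ (hi x ∧ hi y)) A) : HamOn r A := by
  -- The edges are removed one at a time. The edges still present can only increase the degrees, so
  -- the degree condition for `r` suffices at every stage.
  have key : ∀ E : Finset (α × α), (∀ e ∈ E, e.1 ∈ A ∧ e.2 ∈ A ∧ hi e.1 ∧ hi e.2 ∧ e.1 ≠ e.2) →
      HamOn (fun x y => r x y ∨ (x, y) ∈ E ∨ (y, x) ∈ E) A → HamOn r A := by
    intro E
    induction E using Finset.induction_on with
    | empty => intro _ h; simpa using h
    | insert e E he ih =>
      intro hE h
      refine ih (fun e' he' => hE e' (Finset.mem_insert_of_mem he')) ?_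
      obtain ⟨h1, h2, h3, h4, h5⟩ := hE e (Finset.mem_insert_self _ _)
      have hir' : ∀ x, ¬ (r x x ∨ (x, x) ∈ E ∨ (x, x) ∈ E) := by
        rintro x (h | h | h)
        · exact hir x h
        all_goals exact (hE _ (Finset.mem_insert_of_mem h)).2.2.2.2 rfl
      refine HamOn.remove_edge (u := e.1) (v := e.2) ?_ h5 h1 h2 (hir' _) (hir' _) ?_ ?_
      · rintro x y (h | h | h)
        exacts [Or.inl (hs _ _ h), Or.inr (Or.inr h), Or.inr (Or.inl h)]
      · refine le_trans ?_ (Nat.add_le_add (Finset.card_le_card (s := A.filter (r e.1)) ?_)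
          (Finset.card_le_card (s := A.filter (r e.2)) ?_))
        · have := hdeg _ h1 h3
          have := hdeg _ h2 h4
          omega
        all_goals
          intro y hy
          simp only [Finset.mem_filter] at hy ⊢
          exact ⟨hy.1, Or.inl hy.2⟩
      · obtain ⟨l, g1, g2, g3⟩ := h
        refine ⟨l, g1, g2, g3.imp ?_⟩
        intro x y hxy
        simp only [Finset.mem_insert, Prod.ext_iff] at hxy
        tauto
  refine key ((A ×ˢ A).filter fun e => hi e.1 ∧ hi e.2 ∧ e.1 ≠ e.2) ?_ ?_
  · intro e he
    simp only [Finset.mem_filter, Finset.mem_product] at he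
    tauto
  · refine h.imp_of_ne hA ?_
    rintro x hx y hy hxy (h | h)
    · exact Or.inl h
    · refine Or.inr (Or.inl ?_)
      simp only [Finset.mem_filter, Finset.mem_product]
      exact ⟨⟨hx, hy⟩, h.1, h.2, hxy⟩

end HamOn

/-! ### Removing and inserting clique vertices -/

section Kernel

variable {α : Type*} {r : α → α → Prop} {A B : Finset α}

/-- Charge each element satisfying `p` to its predecessor, which fails `p`. The last element is
nobody's predecessor, whence `dropLast`. -/
theorem List.IsChain.countP_le {R : α → α → Prop} (p : α → Bool)
    (hp : ∀ a b, R a b → p a = true → p b = false) (l : List α) (x : α)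
    (h : List.IsChain R (x :: l)) :
    l.countP p ≤ (x :: l).dropLast.countP fun a => !p a := by
  induction l generalizing x with
  | nil => simp
  | cons y l ih =>
    have h1 := ih y h.of_cons
    have h2 := hp x y h.rel
    rw [List.dropLast_cons_cons, List.countP_cons, List.countP_cons]
    cases hx : p x <;> cases hy : p y <;> simp [hx, hy] at h1 h2 ⊢ <;> omega

open Classical in
/-- A cycle in which the vertices of a clique form a majority runs through an edge of the clique, and
can be extended by any further vertices of the clique. -/
theorem HamOn.extend (hi : α → Prop) (hK : ∀ x y, hi x → hi y → r x y)
    (hBA : B ⊆ A) (hAB : ∀ x ∈ A, x ∉ B → hi x)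
    (hcard : (B.filter fun x => ¬ hi x).card < (B.filter hi).card) (h : HamOn r B) : HamOn r A := by
  obtain ⟨b, hb⟩ : (B.filter hi).Nonempty := Finset.card_pos.1 (by omega)
  obtain ⟨t, hn, hm, hc⟩ := h.exists_cons (Finset.mem_filter.1 hb).1
  have hcount : ∀ (p : α → Prop) [DecidablePred p], (b :: t).countP (fun x => decide (p x)) = (B.filter p).card := by
    intro p _
    rw [List.countP_eq_length_filter, ← List.toFinset_card_of_nodup (hn.filter _)]
    congr 1
    ext x
    simp only [List.mem_toFinset, List.mem_filter, hm, decide_eq_true_eq, Finset.mem_filter]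
  -- If no two consecutive vertices were in the clique, counting predecessors around the cycle would
  -- bound the clique vertices by the others.
  obtain ⟨i, hi1, hi2, hi3⟩ : ∃ (i : ℕ) (h : i + 1 < (b :: (t ++ [b])).length),
      hi ((b :: (t ++ [b]))[i]) ∧ hi ((b :: (t ++ [b]))[i + 1]) := by
    by_contra hcon
    push Not at hcon
    have hch : List.IsChain (fun x y => hi x → ¬ hi y) (b :: (t ++ [b])) := by
      rw [List.isChain_iff_getElem]
      exact hcon
    have h1 := List.IsChain.countP_le (fun x => decide (hi x)) (by simp) _ _ hch
    rw [← List.cons_append, List.dropLast_concat] at h1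
    have h2 := hcount fun x => ¬ hi x
    have h3 := hcount hi
    simp only [decide_not] at h2
    rw [h2, List.countP_append] at h1
    rw [List.countP_cons] at h3
    simp only [List.countP_cons, List.countP_nil] at h1
    omega
  -- rotate the cycle so that this edge closes it
  obtain ⟨l, hln, hlm, hlc, hlh, hll⟩ : ∃ l : List α, l.Nodup ∧ (∀ x, x ∈ l ↔ x ∈ B) ∧
      List.IsChain r l ∧ (∀ x ∈ l.head?, hi x) ∧ (∀ x ∈ l.getLast?, hi x) := by
    have hlen : i < (b :: t).length := by simp at hi1 ⊢; omega
    have e1 : (b :: (t ++ [b]))[i] = (b :: t)[i] := by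
      simp only [← List.cons_append]
      rw [List.getElem_append_left]
    rw [e1] at hi2
    have hc' : List.IsChain r (b :: t) := by
      rw [← List.cons_append] at hc
      exact hc.left_of_append
    -- If the clique edge is not already the closing one, cutting the list behind position `i` and
    -- swapping the two pieces makes it so.
    by_cases hlen' : i + 1 < (b :: t).length
    · have e2 : (b :: (t ++ [b]))[i + 1] = (b :: t)[i + 1] := by
        simp only [← List.cons_append]
        rw [List.getElem_append_left]
      rw [e2] at hi3
      have hperm : ((b :: t).drop (i + 1) ++ (b :: t).take (i + 1)).Perm (b :: t) := by
        conv_rhs => rw [← List.take_append_drop (i + 1) (b :: t)]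
        exact List.perm_append_comm
      refine ⟨_, hperm.nodup_iff.2 hn, fun x => by rw [hperm.mem_iff, hm], ?_, ?_, ?_⟩
      · rw [List.isChain_append]
        refine ⟨hc'.drop _, hc'.take _, ?_⟩
        intro x hx y hy
        rw [List.getLast?_drop, if_neg (by omega)] at hx
        rw [List.take_succ_cons] at hy
        simp only [List.head?_cons, Option.mem_def, Option.some.injEq] at hy
        subst hy
        rw [← List.cons_append, List.isChain_append] at hc
        exact hc.2.2 x hx b rfl
      · intro x hx
        rw [List.head?_append, List.head?_drop, List.getElem?_eq_getElem hlen'] at hx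
        simp only [Option.some_or, Option.mem_def, Option.some.injEq] at hx
        exact hx ▸ hi3
      · intro x hx
        rw [List.getLast?_append, List.getLast?_eq_getElem? (l := List.take _ _),
          List.getElem?_take] at hx
        have e3 : ((b :: t).take (i + 1)).length - 1 = i := by
          rw [List.length_take]; omega
        rw [e3, if_pos (by omega), List.getElem?_eq_getElem hlen] at hx
        simp only [Option.some_or, Option.mem_def, Option.some.injEq] at hx
        exact hx ▸ hi2
    · refine ⟨b :: t, hn, hm, hc', ?_, ?_⟩
      · intro x hx
        simp only [List.head?_cons, Option.mem_def, Option.some.injEq] at hx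
        exact hx ▸ (Finset.mem_filter.1 hb).2
      · intro x hx
        rw [List.getLast?_eq_getElem?, (by omega : (b :: t).length - 1 = i),
          List.getElem?_eq_getElem hlen] at hx
        simp only [Option.mem_def, Option.some.injEq] at hx
        exact hx ▸ hi2
  rcases l with _ | ⟨a, l⟩
  · have := (hlm b).2 (Finset.mem_filter.1 hb).1
    simp at this
  have hW : ∀ x ∈ (A \ B).toList, hi x := by
    intro x hx
    rw [Finset.mem_toList, Finset.mem_sdiff] at hx
    exact hAB x hx.1 hx.2
  have ha : hi a := hlh a rfl
  -- The missing vertices go between the last and the first vertex of the rotated list; all vertices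
  -- involved there lie in the clique, so their order does not matter.
  refine HamOn.of_cons (a := a) (t := l ++ (A \ B).toList) ?_ ?_ ?_
  · rw [← List.cons_append, List.nodup_append]
    refine ⟨hln, Finset.nodup_toList _, ?_⟩
    rintro x hx y hy rfl
    rw [Finset.mem_toList, Finset.mem_sdiff] at hy
    exact hy.2 ((hlm x).1 hx)
  · intro x
    rw [← List.cons_append, List.mem_append, hlm, Finset.mem_toList, Finset.mem_sdiff]
    have := @hBA x
    tauto
  · rw [List.append_assoc, ← List.cons_append, List.isChain_append]
    refine ⟨hlc, ?_, ?_⟩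
    · have hall : ∀ x ∈ (A \ B).toList ++ [a], hi x := by
        intro x hx
        rcases List.mem_append.1 hx with hx | hx
        · exact hW x hx
        · simp only [List.mem_singleton] at hx
          exact hx ▸ ha
      rw [List.isChain_iff_getElem]
      intro i hi
      exact hK _ _ (hall _ (List.getElem_mem _)) (hall _ (List.getElem_mem _))
    · intro x hx y hy
      refine hK _ _ (hll x hx) ?_
      have := List.mem_of_mem_head? hy
      rcases List.mem_append.1 this with hx | hx
      · exact hW _ hx
      · simp only [List.mem_singleton] at hx
        exact hx ▸ ha

/-- Deleting a run of rejected elements contracts its steps one after the other, which is what `hR`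
permits. The two ends are never tested by `p`. -/
theorem List.IsChain.filter_of_skip {R : α → α → Prop} (p : α → Bool)
    (hR : ∀ a x b, p x = false → R a x → R x b → R a b) (l : List α) (a b : α)
    (h : List.IsChain R (a :: (l ++ [b]))) : List.IsChain R (a :: (l.filter p ++ [b])) := by
  induction l generalizing a with
  | nil => simpa using h
  | cons c l ih =>
    have h1 := ih c h.of_cons
    have h2 : R a c := h.rel
    cases hc : p c
    · rw [List.filter_cons_of_neg (by simp [hc])]
      exact h1.imp_head fun {z} hz => hR _ _ _ hc h2 hz
    · rw [List.filter_cons_of_pos hc]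
      exact List.IsChain.cons_cons h2 h1

/-- The private neighbours of `T` that are inserted between two consecutive vertices of a cycle. -/
def insertion (hi : α → Bool) (T : α → Bool) (a b : α) : List (α ⊕ α × Bool) :=
  if hi a && T b then [.inr (b, false)] else if T a && hi b then [.inr (a, true)] else []

/-- The list `l` with private neighbours of `T` inserted, also next to the vertices `a` and `b`
before and after `l`. -/
def insertAll (hi : α → Bool) (T : α → Bool) (a : α) : List α → α → List (α ⊕ α × Bool)
  | [], b => insertion hi T a b
  | c :: l, b => insertion hi T a c ++ .inl c :: insertAll hi T c l b

variable {hi T : α → Bool}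

theorem mem_insertion {a b : α} {z : α ⊕ α × Bool} (h : z ∈ insertion hi T a b) :
    (z = .inr (b, false) ∧ T b = true) ∨ (z = .inr (a, true) ∧ T a = true) := by
  unfold insertion at h
  split_ifs at h with h1 h2 <;> simp_all

theorem inl_mem_insertAll {a b x : α} {l : List α} :
    (.inl x : α ⊕ α × Bool) ∈ insertAll hi T a l b ↔ x ∈ l := by
  have h0 : ∀ a b, (.inl x : α ⊕ α × Bool) ∉ insertion hi T a b := by
    intro a b h
    rcases mem_insertion h with h | h <;> simp at h
  induction l generalizing a with
  | nil => simp [insertAll, h0]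
  | cons c l ih => simp [insertAll, h0, ih]

/-- The tag records the side of the insertion: `false` stands immediately before `s`, `true`
immediately after it. Hence the end `b` counts for the first case and the start `a` for the second.
-/
theorem inr_mem_insertAll {a b s : α} {l : List α} :
    ((.inr (s, false) : α ⊕ α × Bool) ∈ insertAll hi T a l b → T s = true ∧ s ∈ l ++ [b]) ∧
    ((.inr (s, true) : α ⊕ α × Bool) ∈ insertAll hi T a l b → T s = true ∧ s ∈ a :: l) := by
  induction l generalizing a with
  | nil =>
    constructor
    all_goals
      intro h
      rcases mem_insertion h with ⟨h, h'⟩ | ⟨h, h'⟩ <;> simp_all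
  | cons c l ih =>
    constructor
    · intro h
      simp only [insertAll, List.mem_append, List.mem_cons, reduceCtorEq, false_or] at h
      rcases h with h | h
      · rcases mem_insertion h with ⟨h, h'⟩ | ⟨h, h'⟩ <;> simp_all
      · have := (ih (a := c)).1 h
        exact ⟨this.1, List.mem_cons_of_mem _ this.2⟩
    · intro h
      simp only [insertAll, List.mem_append, List.mem_cons, reduceCtorEq, false_or] at h
      rcases h with h | h
      · rcases mem_insertion h with ⟨h, h'⟩ | ⟨h, h'⟩ <;> simp_all
      · have := (ih (a := c)).2 h
        exact ⟨this.1, List.mem_cons_of_mem _ this.2⟩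

theorem nodup_insertion (a b : α) : (insertion hi T a b).Nodup := by
  unfold insertion
  split_ifs <;> simp

/-- A repeated insertion with the same tag would force a repeated vertex on the corresponding side.
The two hypotheses are separate because the ends coincide when the list comes from a cycle. -/
theorem nodup_insertAll {a b : α} {l : List α} (h1 : (a :: l).Nodup) (h2 : (l ++ [b]).Nodup) :
    (insertAll hi T a l b).Nodup := by
  induction l generalizing a with
  | nil => exact nodup_insertion _ _
  | cons c l ih =>
    rw [insertAll, List.nodup_append]
    refine ⟨nodup_insertion _ _, ?_, ?_⟩
    · rw [List.nodup_cons, inl_mem_insertAll]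
      exact ⟨(List.nodup_cons.1 h1.of_cons).1, ih h1.of_cons h2.of_cons⟩
    · rintro z hz w hw rfl
      rw [List.mem_cons] at hw
      rcases mem_insertion hz with ⟨rfl, -⟩ | ⟨rfl, -⟩
      · rcases hw with hw | hw
        · simp at hw
        · exact (List.nodup_cons.1 h2).1 (inr_mem_insertAll.1 hw).2
      · rcases hw with hw | hw
        · simp at hw
        · exact (List.nodup_cons.1 h1).1 (inr_mem_insertAll.2 hw).2

theorem isChain_insertAll {R : α ⊕ α × Bool → α ⊕ α × Bool → Prop} {P : α → α → Prop} {a b : α}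
    {l : List α}
    (hR : ∀ x y, P x y → List.IsChain R (.inl x :: (insertion hi T x y ++ [.inl y])))
    (h : List.IsChain P (a :: (l ++ [b]))) :
    List.IsChain R (.inl a :: (insertAll hi T a l b ++ [.inl b])) := by
  induction l generalizing a with
  | nil => exact hR _ _ h.rel
  | cons c l ih =>
    have h1 := hR _ _ h.rel
    have h2 := ih h.of_cons
    rw [insertAll, List.append_assoc, ← List.cons_append]
    rw [← List.cons_append, List.isChain_append] at h1
    rw [List.isChain_append]
    exact ⟨h1.1, h2, fun x hx y hy => h1.2.2 x hx y (by simpa using hy)⟩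

open Classical in
/-- All vertices of `T` have two private neighbours in the clique part of `B`, and the clique
vertices outside `B` have all their other neighbours in `T`. Then these vertices are not needed. -/
theorem HamOn.restrict (hs : ∀ x y, r x y → r y x) (hi : α → Prop)
    (hK : ∀ x y, hi x → hi y → r x y) (hBA : B ⊆ A) (hAB : ∀ x ∈ A, x ∉ B → hi x)
    (T : Finset α) (hT : ∀ s ∈ T, ¬ hi s) (f : α → Bool → α)
    (hfB : ∀ s ∈ T, ∀ b, f s b ∈ B ∧ hi (f s b) ∧ r s (f s b) ∧
      ∀ s' ∈ A, s' ∉ T → ¬ hi s' → ¬ r s' (f s b))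
    (hfi : ∀ s ∈ T, ∀ s' ∈ T, ∀ b b', f s b = f s' b' → s = s' ∧ b = b')
    (hout : ∀ x ∈ A, x ∉ B → ∀ s ∈ A, ¬ hi s → s ∉ T → ¬ r s x)
    (h : HamOn r A) : HamOn r B := by
  by_cases hAB' : A ⊆ B
  · rwa [Finset.Subset.antisymm hAB' hBA] at h
  obtain ⟨x₀, hx₀A, hx₀B⟩ := Finset.not_subset.1 hAB'
  have hx₀ := hAB _ hx₀A hx₀B
  obtain ⟨t, hn, hm, hc⟩ := h.exists_cons hx₀A
  have htA : ∀ x ∈ t, x ∈ A := fun x hx => (hm x).1 (List.mem_cons_of_mem _ hx)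
  let φ : α ⊕ α × Bool → α := fun z => Sum.elim id (fun p => f p.1 p.2) z
  -- A clique vertex is kept in place only if it has a low neighbour outside `T`. Such a vertex lies
  -- in `B` by `hout`, and it is nobody's private neighbour.
  let good : α ⊕ α × Bool → Prop := fun z =>
    Sum.elim (fun x => hi x → ∃ s ∈ A, s ∉ T ∧ ¬ hi s ∧ r s x) (fun _ => True) z
  -- This strengthening of `r` says that every step at a vertex that is not good stays within the
  -- clique; hence such vertices can be skipped.
  let R : α ⊕ α × Bool → α ⊕ α × Bool → Prop := fun z w =>
    (hi (φ z) ∧ hi (φ w)) ∨ (good z ∧ good w ∧ r (φ z) (φ w))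
  have hRr : ∀ z w, R z w → r (φ z) (φ w) := by
    rintro z w (h | h)
    exacts [hK _ _ h.1 h.2, h.2.2]
  have hbad : ¬ good (.inl x₀) := by
    intro hg
    obtain ⟨s, hsA, hsT, hsh, hr⟩ := hg hx₀
    exact hout _ hx₀A hx₀B s hsA hsh hsT hr
  set hb : α → Bool := fun x => decide (hi x) with hhb
  set Tb : α → Bool := fun x => decide (x ∈ T) with hTb
  -- A step between the clique and `T` is routed through a private neighbour. A step between the
  -- clique and a low vertex outside `T` witnesses that its clique end is good.
  have hstep : ∀ x y, (x ∈ A ∧ y ∈ A ∧ r x y) →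
      List.IsChain R (.inl x :: (insertion hb Tb x y ++ [.inl y])) := by
    rintro x y ⟨hxA, hyA, hxy⟩
    unfold insertion
    by_cases hx : hi x <;> by_cases hy : hi y
    · have h1 : x ∉ T := fun h => hT _ h hx
      have h2 : y ∉ T := fun h => hT _ h hy
      simp only [hhb, hTb, hx, hy, h1, h2, decide_true, decide_false, Bool.true_and, Bool.false_and,
        Bool.false_eq_true, if_false, List.nil_append, List.isChain_pair]
      exact Or.inl ⟨hx, hy⟩
    · have h1 : x ∉ T := fun h => hT _ h hx
      by_cases h2 : y ∈ T
      · simp only [hhb, hTb, hx, h2, decide_true, Bool.true_and, if_true, List.cons_append,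
          List.nil_append, List.isChain_cons_cons, List.isChain_singleton, and_true]
        obtain ⟨-, g2, g3, -⟩ := hfB y h2 false
        exact ⟨Or.inl ⟨hx, g2⟩, Or.inr ⟨trivial, fun h => absurd h hy, hs _ _ g3⟩⟩
      · simp only [hhb, hTb, hx, hy, h1, h2, decide_true, decide_false, Bool.true_and,
          Bool.false_and, Bool.false_eq_true, if_false, List.nil_append, List.isChain_pair]
        exact Or.inr ⟨fun _ => ⟨y, hyA, h2, hy, hs _ _ hxy⟩, fun h => absurd h hy, hxy⟩
    · have h2 : y ∉ T := fun h => hT _ h hy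
      by_cases h1 : x ∈ T
      · simp only [hhb, hTb, hx, hy, h1, decide_true, decide_false, Bool.true_and, Bool.false_and,
          Bool.false_eq_true, if_false, if_true, List.cons_append, List.nil_append,
          List.isChain_cons_cons, List.isChain_singleton, and_true]
        obtain ⟨-, g2, g3, -⟩ := hfB x h1 true
        exact ⟨Or.inr ⟨fun h => absurd h hx, trivial, g3⟩, Or.inl ⟨g2, hy⟩⟩
      · simp only [hhb, hTb, hx, hy, h1, h2, decide_true, decide_false,
          Bool.false_and, Bool.false_eq_true, if_false, List.nil_append, List.isChain_pair]
        exact Or.inr ⟨fun h => absurd h hx, fun _ => ⟨x, hxA, h1, hx, hxy⟩, hxy⟩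
    · simp only [hhb, hTb, hx, hy, decide_false, Bool.and_false,
          Bool.false_and, Bool.false_eq_true, if_false, List.nil_append, List.isChain_pair]
      exact Or.inr ⟨fun h => absurd h hx, fun h => absurd h hy, hxy⟩
  have hc' : List.IsChain (fun x y => x ∈ A ∧ y ∈ A ∧ r x y) (x₀ :: (t ++ [x₀])) := by
    have hmem : ∀ x ∈ x₀ :: (t ++ [x₀]), x ∈ A := by
      intro x hx
      rw [← hm x]
      simp only [List.mem_cons, List.mem_append, List.not_mem_nil, or_false] at hx ⊢
      tauto
    exact hc.imp_of_mem_imp fun x y hx hy h => ⟨hmem x hx, hmem y hy, h⟩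
  have hN := isChain_insertAll hstep hc'
  set l := insertAll hb Tb x₀ t x₀ with hl
  have hln : l.Nodup := by
    refine nodup_insertAll hn ?_
    rw [List.nodup_append_comm]
    exact hn
  -- Both neighbours of a vertex that is not good are in the clique, so they are joined to each
  -- other after its deletion.
  have hF : List.IsChain R (.inl x₀ :: (l.filter (fun z => decide (good z)) ++ [.inl x₀])) := by
    refine List.IsChain.filter_of_skip _ ?_ _ _ _ hN
    intro a x b hx hax hxb
    simp only [decide_eq_false_iff_not] at hx
    rcases hax with h1 | h1
    · rcases hxb with h2 | h2
      · exact Or.inl ⟨h1.1, h2.2⟩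
      · exact absurd h2.1 hx
    · exact absurd h1.2.1 hx
  set N := l.filter (fun z => decide (good z)) with hNdef
  have hgN : ∀ z ∈ N, z ∈ l ∧ good z := fun z hz => by simpa [hNdef] using hz
  have hinr : ∀ s b, (.inr (s, b) : α ⊕ α × Bool) ∈ N → s ∈ T := by
    intro s b hz
    have := (hgN _ hz).1
    cases b
    · simpa [hTb] using (inr_mem_insertAll.1 this).1
    · simpa [hTb] using (inr_mem_insertAll.2 this).1
  have hinl : ∀ x, (.inl x : α ⊕ α × Bool) ∈ N → x ∈ A ∧ x ∈ B := by
    intro x hz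
    obtain ⟨h1, h2⟩ := hgN _ hz
    have hxA := htA x (inl_mem_insertAll.1 h1)
    refine ⟨hxA, ?_⟩
    by_contra hxB
    obtain ⟨s, hsA, hsT, hsh, hr⟩ := h2 (hAB _ hxA hxB)
    exact hout _ hxA hxB s hsA hsh hsT hr
  set M := N.map φ with hM
  have hMB : ∀ x ∈ M, x ∈ B := by
    intro x hx
    obtain ⟨z, hz, rfl⟩ := List.mem_map.1 hx
    rcases z with x | ⟨s, b⟩
    · exact (hinl x hz).2
    · exact (hfB s (hinr s b hz) b).1
  -- A kept vertex of the old cycle differs from the inserted ones: if it is in the clique it has a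
  -- low neighbour outside `T`, and private neighbours have none.
  have hpriv : ∀ x s b, (.inl x : α ⊕ α × Bool) ∈ N → (.inr (s, b) : α ⊕ α × Bool) ∈ N →
      x ≠ f s b := by
    rintro x s b h1 h2 rfl
    obtain ⟨-, g2, -, g4⟩ := hfB s (hinr s b h2) b
    obtain ⟨s', hsA, hsT, hsh, hr⟩ := (hgN _ h1).2 g2
    exact g4 s' hsA hsT hsh hr
  have hMn : M.Nodup := by
    refine List.Nodup.map_on ?_ (hln.filter _)
    rintro (x | ⟨s, b⟩) hz (y | ⟨s', b'⟩) hw heq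
    · simpa [φ] using heq
    · exact absurd heq (hpriv _ _ _ hz hw)
    · exact absurd heq.symm (hpriv _ _ _ hw hz)
    · obtain ⟨rfl, rfl⟩ := hfi s (hinr _ _ hz) s' (hinr _ _ hw) b b' heq
      rfl
  have hSM : ∀ x ∈ A, ¬ hi x → x ∈ M := by
    intro x hxA hx
    have hxt : x ∈ t := by
      have := (hm x).2 hxA
      rw [List.mem_cons] at this
      rcases this with rfl | h
      exacts [absurd hx₀ hx, h]
    refine List.mem_map.2 ⟨.inl x, ?_, rfl⟩
    rw [hNdef, List.mem_filter, decide_eq_true_eq]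
    exact ⟨inl_mem_insertAll.2 hxt, fun h => absurd h hx⟩
  have hWhi : ∀ x ∈ (B \ M.toFinset).toList, hi x := by
    intro x hx
    rw [Finset.mem_toList, Finset.mem_sdiff, List.mem_toFinset] at hx
    by_contra hxh
    exact hx.2 (hSM x (hBA hx.1) hxh)
  rw [List.isChain_cons, List.isChain_append] at hF
  have hMc : List.IsChain r M := by
    rw [hM, List.isChain_map]
    exact hF.2.1.imp fun z w => hRr z w
  have hRx : ∀ z, R z (.inl x₀) → hi (φ z) := by
    rintro z (h | h)
    exacts [h.1, absurd h.2.1 hbad]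
  have hMl : ∀ x ∈ M.getLast?, hi x := by
    intro x hx
    rw [hM, List.getLast?_map] at hx
    obtain ⟨z, hz, rfl⟩ := Option.map_eq_some_iff.1 hx
    exact hRx z (hF.2.2.2 z hz _ rfl)
  have hMh : ∀ x ∈ M.head?, hi x := by
    intro x hx
    rw [hM, List.head?_map] at hx
    obtain ⟨z, hz, rfl⟩ := Option.map_eq_some_iff.1 hx
    have : R (.inl x₀) z := hF.1 z (by rw [List.head?_append, hz]; rfl)
    rcases this with h | h
    exacts [h.2, absurd h.1 hbad]
  -- The vertices of `B` not yet used take the place of the dropped `x₀`. They are in the clique,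
  -- and so are both ends of `M`, since `x₀` itself is not good.
  set W := (B \ M.toFinset).toList with hW
  have hWc : List.IsChain r W := by
    rw [List.isChain_iff_getElem]
    intro i hi
    exact hK _ _ (hWhi _ (List.getElem_mem _)) (hWhi _ (List.getElem_mem _))
  have hall : List.IsChain r (W ++ M) := by
    rw [List.isChain_append]
    exact ⟨hWc, hMc, fun x hx y hy => hK _ _ (hWhi _ (List.mem_of_mem_getLast? hx)) (hMh y hy)⟩
  refine ⟨W ++ M, ?_, ?_, ?_⟩
  · rw [List.nodup_append]
    refine ⟨Finset.nodup_toList _, hMn, ?_⟩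
    rintro x hx y hy rfl
    rw [hW, Finset.mem_toList, Finset.mem_sdiff, List.mem_toFinset] at hx
    exact hx.2 hy
  · intro x
    rw [List.mem_append, hW, Finset.mem_toList, Finset.mem_sdiff, List.mem_toFinset]
    have := hMB x
    tauto
  · have hlast : ∀ x ∈ (W ++ M).getLast?, hi x := by
      intro x hx
      rw [List.getLast?_append] at hx
      rcases hMg : M.getLast? with _ | y
      · rw [hMg] at hx
        exact hWhi _ (List.mem_of_mem_getLast? hx)
      · rw [hMg] at hx
        simp only [Option.some_or, Option.mem_def, Option.some.injEq] at hx
        exact hMl x (by rw [hMg, hx]; rfl)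
    have hhead : ∀ x ∈ (W ++ M).head?, hi x := by
      intro x hx
      rw [List.head?_append] at hx
      rcases hWg : W.head? with _ | y
      · rw [hWg] at hx
        exact hMh _ hx
      · rw [hWg] at hx
        simp only [Option.some_or, Option.mem_def, Option.some.injEq] at hx
        exact hWhi x (List.mem_of_mem_head? (by rw [hWg, hx]; rfl))
    rcases hWM : W ++ M with _ | ⟨a, q⟩
    · exact Cycle.Chain.nil r
    · rw [hWM] at hall hlast hhead
      rw [Cycle.chain_coe_cons, ← List.cons_append, List.isChain_append]
      refine ⟨hall, List.isChain_singleton _, ?_⟩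
      intro x hx y hy
      simp only [List.head?_cons, Option.mem_def, Option.some.injEq] at hy
      exact hK _ _ (hlast x hx) (hy ▸ hhead a rfl)

/-! ### Tight sets and private neighbours -/

open Classical in
/-- The elements of `Y` all of whose `r`-neighbours in `S` belong to `T`. -/
noncomputable def confined (r : α → α → Prop) (S Y T : Finset α) : Finset α :=
  Y.filter fun y => ∀ s ∈ S, r s y → s ∈ T

theorem mem_confined {S Y T : Finset α} {y : α} :
    y ∈ confined r S Y T ↔ y ∈ Y ∧ ∀ s ∈ S, r s y → s ∈ T := by
  simp [confined]

open Classical in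
-- Tight sets are closed under union. The confined sets of `T` and `U` have their union confined to
-- `T ∪ U` and their intersection confined to `T ∩ U`, so `2|T| + 2|U|` is at most the sum of the
-- two confined cardinalities, each of which `hind` bounds; as `|T ∪ U| + |T ∩ U| = |T| + |U|`,
-- equality holds throughout. The empty set starts the induction.
theorem exists_tight {S Y : Finset α} (hind : ∀ T ⊆ S, (confined r S Y T).card ≤ 2 * T.card)
    (X : Finset α) (hX : ∀ x ∈ X, ∃ T ⊆ S, (confined r S Y T).card = 2 * T.card ∧
      ∀ s ∈ S, r s x → s ∈ T) :
    ∃ T ⊆ S, (confined r S Y T).card = 2 * T.card ∧ ∀ x ∈ X, ∀ s ∈ S, r s x → s ∈ T := by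
  induction X using Finset.induction_on with
  | empty =>
    refine ⟨∅, Finset.empty_subset _, ?_, by simp⟩
    have := hind ∅ (Finset.empty_subset _)
    simpa using this
  | insert x X hx ih =>
    obtain ⟨T, hTS, hT, hTX⟩ := ih fun y hy => hX y (Finset.mem_insert_of_mem hy)
    obtain ⟨U, hUS, hU, hUx⟩ := hX x (Finset.mem_insert_self _ _)
    refine ⟨T ∪ U, Finset.union_subset hTS hUS, ?_, ?_⟩
    · have h1 := hind (T ∪ U) (Finset.union_subset hTS hUS)
      have h2 := hind (T ∩ U) (Finset.inter_subset_left.trans hTS)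
      have h3 := Finset.card_union_add_card_inter T U
      have h4 := Finset.card_union_add_card_inter (confined r S Y T) (confined r S Y U)
      have h5 : confined r S Y T ∪ confined r S Y U ⊆ confined r S Y (T ∪ U) := by
        intro y hy
        simp only [Finset.mem_union, mem_confined] at hy ⊢
        rcases hy with hy | hy
        · exact ⟨hy.1, fun s hs hr => Or.inl (hy.2 s hs hr)⟩
        · exact ⟨hy.1, fun s hs hr => Or.inr (hy.2 s hs hr)⟩
      have h6 : confined r S Y T ∩ confined r S Y U ⊆ confined r S Y (T ∩ U) := by
        intro y hy
        simp only [Finset.mem_inter, mem_confined] at hy ⊢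
        exact ⟨hy.1.1, fun s hs hr => ⟨hy.1.2 s hs hr, hy.2.2 s hs hr⟩⟩
      have h7 := Finset.card_le_card h5
      have h8 := Finset.card_le_card h6
      omega
    · intro y hy s hs hr
      rcases Finset.mem_insert.1 hy with rfl | hy
      · exact Finset.mem_union_right _ (hUx s hs hr)
      · exact Finset.mem_union_left _ (hTX y hy s hs hr)

open Classical in
-- Hall's theorem matches the vertices confined to `T` into two copies of `S`, and their partners
-- lie in `T`. Since `T` is tight, the matching is a bijection onto two copies of `T`, and its
-- inverse is `f`.
theorem exists_private {S Y T : Finset α} (hind : ∀ T ⊆ S, (confined r S Y T).card ≤ 2 * T.card)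
    (htight : (confined r S Y T).card = 2 * T.card) :
    ∃ f : α → Bool → α, (∀ s ∈ T, ∀ b, f s b ∈ confined r S Y T ∧ r s (f s b)) ∧
      ∀ s ∈ T, ∀ s' ∈ T, ∀ b b', f s b = f s' b' → s = s' ∧ b = b' := by
  let F := confined r S Y T
  let N : F → Finset (α × Bool) := fun y => (S.filter fun s => r s y) ×ˢ Finset.univ
  -- All of `Z` is confined to its own neighbourhood `U`, so `hind U` is Hall's condition; the
  -- factor 2 is the size of `Bool`.
  have hall : ∀ Z : Finset F, Z.card ≤ (Z.biUnion N).card := by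
    intro Z
    let U := Z.biUnion fun y => S.filter fun s => r s y
    have hU : U ⊆ S := Finset.biUnion_subset.2 fun y _ => Finset.filter_subset _ _
    have h1 : Z.biUnion N = U ×ˢ Finset.univ := by
      ext ⟨s, b⟩
      simp [N, U]
    rw [h1, Finset.card_product, Finset.card_univ, Fintype.card_bool, mul_comm]
    refine le_trans ?_ (hind U hU)
    rw [← Finset.card_map (Function.Embedding.subtype (· ∈ F))]
    refine Finset.card_le_card ?_
    intro y hy
    obtain ⟨⟨z, hz⟩, hzZ, rfl⟩ := Finset.mem_map.1 hy
    rw [mem_confined]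
    refine ⟨(mem_confined.1 hz).1, fun s hs hr => Finset.mem_biUnion.2 ⟨⟨z, hz⟩, hzZ, ?_⟩⟩
    exact Finset.mem_filter.2 ⟨hs, hr⟩
  obtain ⟨g, hgi, hgN⟩ := (Finset.all_card_le_biUnion_card_iff_exists_injective N).1 hall
  have hg : ∀ y, (g y).1 ∈ T ∧ r (g y).1 y := by
    intro y
    have h1 := hgN y
    simp only [N, Finset.mem_product, Finset.mem_filter, Finset.mem_univ, and_true] at h1
    exact ⟨(mem_confined.1 y.2).2 _ h1.1 h1.2, h1.2⟩
  have himg : Finset.univ.image g = T ×ˢ (Finset.univ : Finset Bool) := by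
    refine Finset.eq_of_subset_of_card_le ?_ ?_
    · intro p hp
      obtain ⟨y, -, rfl⟩ := Finset.mem_image.1 hp
      simp [(hg y).1]
    · rw [Finset.card_image_of_injective _ hgi, Finset.card_product, Finset.card_univ,
        Finset.card_univ, Fintype.card_bool, Fintype.card_coe]
      change _ ≤ (confined r S Y T).card
      omega
  have hsurj : ∀ s ∈ T, ∀ b, ∃ y, g y = (s, b) := by
    intro s hs b
    have : (s, b) ∈ Finset.univ.image g := by rw [himg]; simp [hs]
    obtain ⟨y, -, hy⟩ := Finset.mem_image.1 this
    exact ⟨y, hy⟩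
  let f : α → Bool → α := fun s b => if h : ∃ y, g y = (s, b) then (h.choose : α) else s
  have hf : ∀ s ∈ T, ∀ b, ∃ y : F, g y = (s, b) ∧ f s b = y := by
    intro s hs b
    have h := hsurj s hs b
    exact ⟨h.choose, h.choose_spec, by simp only [f, dif_pos h]⟩
  refine ⟨f, ?_, ?_⟩
  · intro s hs b
    obtain ⟨y, h1, h2⟩ := hf s hs b
    rw [h2]
    have := (hg y).2
    rw [h1] at this
    exact ⟨y.2, this⟩
  · intro s hs s' hs' b b' heq
    obtain ⟨y, h1, h2⟩ := hf s hs b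
    obtain ⟨y', h1', h2'⟩ := hf s' hs' b'
    have : y = y' := Subtype.ext (by rw [← h2, ← h2', heq])
    subst this
    rw [h1] at h1'
    exact ⟨congrArg Prod.fst h1', congrArg Prod.snd h1'⟩

end Kernel

/-! ### Expressions and commands over the word RAM

Even registers hold variables, odd registers hold intermediate results. -/

namespace WordRAM

/-- The variables of a state. -/
def State.vars (s : State) : ℕ → ℕ := fun r => s.reg (2 * r)

theorem State.reg_setReg (s : State) (r x q : ℕ) :
    (s.setReg r x).reg q = if q = r then x else s.reg q := by
  simp [State.setReg, Function.update_apply]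

@[simp] theorem State.mem_setReg (s : State) (r x : ℕ) : (s.setReg r x).mem = s.mem := rfl

@[simp] theorem State.mem_setMem (s : State) (a x : ℕ) :
    (s.setMem a x).mem = Function.update s.mem a x := rfl

@[simp] theorem State.vars_setMem (s : State) (a x : ℕ) : (s.setMem a x).vars = s.vars := rfl

@[simp] theorem State.vars_setReg_odd (s : State) (d x : ℕ) :
    (s.setReg (2 * d + 1) x).vars = s.vars := by
  funext q
  simp only [State.vars, State.reg_setReg]
  rw [if_neg (by omega)]

@[simp] theorem State.vars_setReg_even (s : State) (r x : ℕ) :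
    (s.setReg (2 * r) x).vars = Function.update s.vars r x := by
  funext q
  simp only [State.vars, State.reg_setReg, Function.update_apply]
  congr 1
  simp

theorem State.reg_even (s : State) (r : ℕ) : s.reg (2 * r) = s.vars r := rfl

/-- With words of `w` bits, variables `v` and memory `M`, the code `e` evaluates to `x` within `T`
steps: `e d` puts `x` into the odd register number `d`, and changes no variables, no memory
and no odd registers with smaller numbers. -/
def Ev (w : ℕ) (v M : ℕ → ℕ) (e : ℕ → Prog) (x T : ℕ) : Prop :=
  x < 2 ^ w ∧ ∀ (d : ℕ) (s : State), s.vars = v → s.mem = M → ∃ t s', Exec w (e d) s t s' ∧ t ≤ T ∧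
    s'.mem = M ∧ s'.vars = v ∧ (∀ i < d, s'.reg (2 * i + 1) = s.reg (2 * i + 1)) ∧
    s'.reg (2 * d + 1) = x

def eLit (c d : ℕ) : Prog := .set (2 * d + 1) (.lit c)

def eVar (r d : ℕ) : Prog := .set (2 * d + 1) (.reg (2 * r))

def eLoad (e : ℕ → Prog) (d : ℕ) : Prog :=
  .seq (e d) (.load (2 * d + 1) (.reg (2 * d + 1)))

def eOp (o : Op) (a b : ℕ → Prog) (d : ℕ) : Prog :=
  .seq (a d) (.seq (b (d + 1))
    (.arith (2 * d + 1) o (.reg (2 * d + 1)) (.reg (2 * (d + 1) + 1))))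

def eEq (a b : ℕ → Prog) (d : ℕ) : Prog :=
  .seq (a d) (.seq (b (d + 1)) (.ite (.eq (.reg (2 * d + 1)) (.reg (2 * (d + 1) + 1)))
    (.set (2 * d + 1) (.lit 1)) (.set (2 * d + 1) (.lit 0))))

def eLt (a b : ℕ → Prog) (d : ℕ) : Prog :=
  .seq (a d) (.seq (b (d + 1)) (.ite (.lt (.reg (2 * d + 1)) (.reg (2 * (d + 1) + 1)))
    (.set (2 * d + 1) (.lit 1)) (.set (2 * d + 1) (.lit 0))))

/-- The loop of `eSum`. -/
def eSumLoop (r : ℕ) (b : ℕ → Prog) (d : ℕ) : Prog :=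
  .while (.lt (.reg (2 * r)) (.reg (2 * d + 1)))
    (.seq (b (d + 3)) (.seq
      (.arith (2 * (d + 2) + 1) .add (.reg (2 * (d + 2) + 1)) (.reg (2 * (d + 3) + 1)))
      (.arith (2 * r) .add (.reg (2 * r)) (.lit 1))))

/-- The sum of the values of `b` where the variable `r` runs over the numbers less than the value of
`N`. -/
def eSum (r : ℕ) (N b : ℕ → Prog) (d : ℕ) : Prog :=
  .seq (N d) (.seq (.set (2 * (d + 1) + 1) (.reg (2 * r)))
    (.seq (.set (2 * (d + 2) + 1) (.lit 0)) (.seq (.set (2 * r) (.lit 0))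
      (.seq (eSumLoop r b d) (.seq (.set (2 * r) (.reg (2 * (d + 1) + 1)))
        (.set (2 * d + 1) (.reg (2 * (d + 2) + 1))))))))

variable {w : ℕ} {v M : ℕ → ℕ} {e a b N : ℕ → Prog} {x y n T T' T₁ T₂ Tb TN : ℕ}

theorem Ev.congr (h : Ev w v M e x T) (hx : x = y) (hT : T ≤ T') : Ev w v M e y T' := by
  subst hx
  refine ⟨h.1, fun d s hv hM => ?_⟩
  obtain ⟨t, s', h1, h2, h3⟩ := h.2 d s hv hM
  exact ⟨t, s', h1, h2.trans hT, h3⟩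

theorem Ev.lit {c : ℕ} (h : c < 2 ^ w) : Ev w v M (eLit c) c 1 := by
  refine ⟨h, fun d s hv hM => ⟨1, _, .set _ _ _ h, le_rfl, hM, ?_, ?_, ?_⟩⟩
  · simpa using hv
  · intro i hi
    rw [State.reg_setReg, if_neg (by omega)]
  · rw [State.reg_setReg, if_pos rfl]
    rfl

theorem Ev.var {r : ℕ} (hx : v r = x) (h : x < 2 ^ w) : Ev w v M (eVar r) x 1 := by
  refine ⟨h, fun d s hv hM => ?_⟩
  have hval : Operand.val s (.reg (2 * r)) = x := by
    rw [← hx, ← hv]; rfl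
  refine ⟨1, _, .set _ _ _ (by rw [hval]; exact h), le_rfl, hM, ?_, ?_, ?_⟩
  · simpa using hv
  · intro i hi
    rw [State.reg_setReg, if_neg (by omega)]
  · rw [State.reg_setReg, if_pos rfl, hval]

theorem Ev.load (h : Ev w v M e x T) (hy : M x = y) (hyw : y < 2 ^ w) :
    Ev w v M (eLoad e) y (T + 1) := by
  refine ⟨hyw, fun d s hv hM => ?_⟩
  obtain ⟨t, s', h1, h2, h3, h4, h5, h6⟩ := h.2 d s hv hM
  have hval : Operand.val s' (.reg (2 * d + 1)) = x := h6
  have hval' : s'.mem (Operand.val s' (.reg (2 * d + 1))) = y := by rw [hval, h3, hy]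
  refine ⟨_, _, .seq _ _ _ _ _ _ _ h1 (.load _ _ _ (by rw [hval]; exact h.1)
    (by rw [hval']; exact hyw)), by omega, h3, ?_, ?_, ?_⟩
  · simpa using h4
  · intro i hi
    rw [State.reg_setReg, if_neg (by omega), h5 i hi]
  · rw [State.reg_setReg, if_pos rfl, hval']

/-- Evaluation of two expressions, one after the other. -/
theorem Ev.pair (ha : Ev w v M a x T₁) (hb : Ev w v M b y T₂) (d : ℕ) (s : State)
    (hv : s.vars = v) (hM : s.mem = M) : ∃ t₁ s₁ t₂ s₂, Exec w (a d) s t₁ s₁ ∧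
      Exec w (b (d + 1)) s₁ t₂ s₂ ∧ t₁ + t₂ ≤ T₁ + T₂ ∧ s₂.mem = M ∧ s₂.vars = v ∧
      (∀ i < d, s₂.reg (2 * i + 1) = s.reg (2 * i + 1)) ∧ s₂.reg (2 * d + 1) = x ∧
      s₂.reg (2 * (d + 1) + 1) = y := by
  obtain ⟨t, s', h1, h2, h3, h4, h5, h6⟩ := ha.2 d s hv hM
  obtain ⟨u, s'', g1, g2, g3, g4, g5, g6⟩ := hb.2 (d + 1) s' h4 h3
  refine ⟨t, s', u, s'', h1, g1, by omega, g3, g4, ?_, ?_, g6⟩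
  · intro i hi
    rw [g5 i (by omega), h5 i hi]
  · rw [g5 d (by omega), h6]

theorem Ev.op {o : Op} (ha : Ev w v M a x T₁) (hb : Ev w v M b y T₂)
    (h : o.apply x y < 2 ^ w) : Ev w v M (eOp o a b) (o.apply x y) (T₁ + T₂ + 1) := by
  refine ⟨h, fun d s hv hM => ?_⟩
  obtain ⟨t, s', u, s'', h1, h2, h3, h4, h5, h6, h7, h8⟩ := Ev.pair ha hb d s hv hM
  have hval : o.apply (Operand.val s'' (.reg (2 * d + 1)))
      (Operand.val s'' (.reg (2 * (d + 1) + 1))) = o.apply x y := by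
    simp only [Operand.val, h7, h8]
  refine ⟨_, _, .seq _ _ _ _ _ _ _ h1 (.seq _ _ _ _ _ _ _ h2 (.arith _ _ _ _ _
    (by rw [hval]; exact h))), by omega, h4, ?_, ?_, ?_⟩
  · simpa using h5
  · intro i hi
    rw [State.reg_setReg, if_neg (by omega), h6 i hi]
  · rw [State.reg_setReg, if_pos rfl, hval]

theorem Ev.add (ha : Ev w v M a x T₁) (hb : Ev w v M b y T₂) (h : x + y < 2 ^ w) :
    Ev w v M (eOp .add a b) (x + y) (T₁ + T₂ + 1) := Ev.op (o := .add) ha hb h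

theorem Ev.mul (ha : Ev w v M a x T₁) (hb : Ev w v M b y T₂) (h : x * y < 2 ^ w) :
    Ev w v M (eOp .mul a b) (x * y) (T₁ + T₂ + 1) := Ev.op (o := .mul) ha hb h

theorem Ev.sub (ha : Ev w v M a x T₁) (hb : Ev w v M b y T₂) :
    Ev w v M (eOp .sub a b) (x - y) (T₁ + T₂ + 1) :=
  Ev.op (o := .sub) ha hb ((Nat.sub_le _ _).trans_lt ha.1)

theorem Ev.div (ha : Ev w v M a x T₁) (hb : Ev w v M b y T₂) :
    Ev w v M (eOp .div a b) (x / y) (T₁ + T₂ + 1) :=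
  Ev.op (o := .div) ha hb ((Nat.div_le_self _ _).trans_lt ha.1)

/-- A branch that puts a truth value into an odd register. -/
theorem exec_truth {c : Test} {s : State} {d : ℕ} {p : Prop} [Decidable p] (hw : 0 < w)
    (hc : c.holds s ↔ p) :
    Exec w (.ite c (.set (2 * d + 1) (.lit 1)) (.set (2 * d + 1) (.lit 0))) s (1 + 1)
      (s.setReg (2 * d + 1) (if p then 1 else 0)) := by
  have h1 : 1 < 2 ^ w := Nat.one_lt_two_pow (by omega)
  split_ifs with hp
  · exact .iteTrue _ _ _ _ _ _ (hc.2 hp) (.set _ _ _ h1)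
  · exact .iteFalse _ _ _ _ _ _ (fun h => hp (hc.1 h)) (.set _ _ _ (by simp [Operand.val]))

theorem truth_lt {p : Prop} [Decidable p] (hw : 0 < w) : (if p then 1 else 0) < 2 ^ w := by
  have h1 : 1 < 2 ^ w := Nat.one_lt_two_pow (by omega)
  split_ifs <;> omega

theorem Ev.eq (hw : 0 < w) (ha : Ev w v M a x T₁) (hb : Ev w v M b y T₂) :
    Ev w v M (eEq a b) (if x = y then 1 else 0) (T₁ + T₂ + 2) := by
  refine ⟨truth_lt hw, fun d s hv hM => ?_⟩
  obtain ⟨t, s', u, s'', h1, h2, h3, h4, h5, h6, h7, h8⟩ := Ev.pair ha hb d s hv hM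
  refine ⟨_, _, .seq _ _ _ _ _ _ _ h1 (.seq _ _ _ _ _ _ _ h2 (exec_truth (p := x = y) hw ?_)),
    by omega, h4, ?_, ?_, ?_⟩
  · simp only [Test.holds, Operand.val, h7, h8]
  · simpa using h5
  · intro i hi
    rw [State.reg_setReg, if_neg (by omega), h6 i hi]
  · rw [State.reg_setReg, if_pos rfl]

theorem Ev.lt (hw : 0 < w) (ha : Ev w v M a x T₁) (hb : Ev w v M b y T₂) :
    Ev w v M (eLt a b) (if x < y then 1 else 0) (T₁ + T₂ + 2) := by
  refine ⟨truth_lt hw, fun d s hv hM => ?_⟩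
  obtain ⟨t, s', u, s'', h1, h2, h3, h4, h5, h6, h7, h8⟩ := Ev.pair ha hb d s hv hM
  refine ⟨_, _, .seq _ _ _ _ _ _ _ h1 (.seq _ _ _ _ _ _ _ h2 (exec_truth (p := x < y) hw ?_)),
    by omega, h4, ?_, ?_, ?_⟩
  · simp only [Test.holds, Operand.val, h7, h8]
  · simpa using h5
  · intro i hi
    rw [State.reg_setReg, if_neg (by omega), h6 i hi]
  · rw [State.reg_setReg, if_pos rfl]

/-- Layout of the odd registers: `d` holds the bound, `d + 1` the saved value of the variable, `d +
2` the running sum, and the body works from `d + 3` on. The induction is on the number `j` of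
remaining rounds. -/
theorem exec_eSumLoop {r : ℕ} {g : ℕ → ℕ} (hn : n < 2 ^ w)
    (hb : ∀ i < n, Ev w (Function.update v r i) M b (g i) Tb)
    (hg : ∑ i ∈ Finset.range n, g i < 2 ^ w) (d j : ℕ) (i : ℕ) (hij : i + j = n) (s : State)
    (hv : s.vars = Function.update v r i) (hM : s.mem = M) (hN : s.reg (2 * d + 1) = n)
    (hacc : s.reg (2 * (d + 2) + 1) = ∑ l ∈ Finset.range i, g l) :
    ∃ t s', Exec w (eSumLoop r b d) s t s' ∧ t ≤ j * (Tb + 3) + 1 ∧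
      s'.mem = M ∧ s'.vars = Function.update v r n ∧
      (∀ l < d + 2, s'.reg (2 * l + 1) = s.reg (2 * l + 1)) ∧
      s'.reg (2 * (d + 2) + 1) = ∑ l ∈ Finset.range n, g l := by
  have hr : s.reg (2 * r) = i := by rw [s.reg_even, hv, Function.update_self]
  induction j generalizing i s with
  | zero =>
    obtain rfl : i = n := by omega
    refine ⟨1, s, .whileFalse _ _ _ ?_, by omega, hM, hv, fun _ _ => rfl, hacc⟩
    simp [Test.holds, Operand.val, hr, hN]
  | succ j ih =>
    have hi : i < n := by omega
    obtain ⟨t, s₁, h1, h2, h3, h4, h5, h6⟩ := (hb i hi).2 (d + 3) s hv hM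
    have hsum : ∑ l ∈ Finset.range (i + 1), g l ≤ ∑ l ∈ Finset.range n, g l :=
      Finset.sum_le_sum_of_subset (Finset.range_mono hi)
    have hr1 : s₁.reg (2 * r) = i := by rw [s₁.reg_even, h4, Function.update_self]
    have hv1 : Op.apply .add (Operand.val s₁ (.reg (2 * (d + 2) + 1)))
        (Operand.val s₁ (.reg (2 * (d + 3) + 1))) = ∑ l ∈ Finset.range (i + 1), g l := by
      simp only [Op.apply, Operand.val]
      rw [h5 _ (by omega), hacc, h6, Finset.sum_range_succ]
    set s₂ := s₁.setReg (2 * (d + 2) + 1) (∑ l ∈ Finset.range (i + 1), g l) with hs₂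
    have hv2 : Op.apply .add (Operand.val s₂ (.reg (2 * r))) (Operand.val s₂ (.lit 1)) = i + 1 := by
      simp only [Op.apply, Operand.val]
      rw [hs₂, State.reg_setReg, if_neg (by omega), hr1]
    set s₃ := s₂.setReg (2 * r) (i + 1) with hs₃
    have hreg : ∀ l < d + 2, s₃.reg (2 * l + 1) = s.reg (2 * l + 1) := by
      intro l hl
      rw [hs₃, State.reg_setReg, if_neg (by omega), hs₂, State.reg_setReg, if_neg (by omega),
        h5 l (by omega)]
    have hv3 : s₃.vars = Function.update v r (i + 1) := by
      rw [hs₃, State.vars_setReg_even, hs₂, State.vars_setReg_odd, h4, Function.update_idem]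
    obtain ⟨u, s₄, g1, g2, g3, g4, g5, g6⟩ := ih (i + 1) (by omega) s₃ hv3 h3
      (by rw [hreg d (by omega), hN])
      (by rw [hs₃, State.reg_setReg, if_neg (by omega), hs₂, State.reg_setReg, if_pos rfl])
      (by rw [hs₃, State.reg_setReg, if_pos rfl])
    refine ⟨_, s₄, .whileTrue _ _ _ s₃ _ _ _ ?_ (.seq _ _ _ _ _ _ _ h1 (.seq _ _ _ s₂ _ 1 1
      ?_ ?_)) g1, ?_, g3, g4, fun l hl => by rw [g5 l hl, hreg l hl], g6⟩
    · simp [Test.holds, Operand.val, hr, hN, hi]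
    · rw [hs₂, ← hv1]
      exact .arith _ _ _ _ _ (by rw [hv1]; omega)
    · rw [hs₃, ← hv2]
      exact .arith _ _ _ _ _ (by rw [hv2]; omega)
    · have : (j + 1) * (Tb + 3) = j * (Tb + 3) + (Tb + 3) := by ring
      omega

/-- The loop variable is saved and restored, so a sum is free of side effects like any other
expression, and sums may be nested. -/
theorem Ev.sum {r : ℕ} {g : ℕ → ℕ} (hN : Ev w v M N n TN) (hr : v r < 2 ^ w)
    (hb : ∀ i < n, Ev w (Function.update v r i) M b (g i) Tb)
    (hg : ∑ i ∈ Finset.range n, g i < 2 ^ w) :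
    Ev w v M (eSum r N b) (∑ i ∈ Finset.range n, g i) (TN + n * (Tb + 3) + 6) := by
  refine ⟨hg, fun d s hv hM => ?_⟩
  obtain ⟨t, s₁, h1, h2, h3, h4, h5, h6⟩ := hN.2 d s hv hM
  have h0 : 0 < 2 ^ w := by positivity
  have hval : Operand.val s₁ (.reg (2 * r)) = v r := by
    simp only [Operand.val]
    rw [State.reg_even, h4]
  set s₂ := s₁.setReg (2 * (d + 1) + 1) (v r) with hs₂
  set s₃ := s₂.setReg (2 * (d + 2) + 1) 0 with hs₃
  set s₄ := s₃.setReg (2 * r) 0 with hs₄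
  have hv4 : s₄.vars = Function.update v r 0 := by
    rw [hs₄, State.vars_setReg_even, hs₃, State.vars_setReg_odd, hs₂, State.vars_setReg_odd, h4]
  have hreg : ∀ l ≤ d, s₄.reg (2 * l + 1) = s₁.reg (2 * l + 1) := by
    intro l hl
    rw [hs₄, State.reg_setReg, if_neg (by omega), hs₃, State.reg_setReg, if_neg (by omega), hs₂,
      State.reg_setReg, if_neg (by omega)]
  obtain ⟨u, s₅, g1, g2, g3, g4, g5, g6⟩ := exec_eSumLoop hN.1 hb hg d n 0 (by omega) s₄ hv4 h3
    (by rw [hreg d le_rfl, h6])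
    (by rw [hs₄, State.reg_setReg, if_neg (by omega), hs₃, State.reg_setReg, if_pos rfl]; simp)
  have hval5 : Operand.val s₅ (.reg (2 * (d + 1) + 1)) = v r := by
    simp only [Operand.val]
    rw [g5 _ (by omega), hs₄, State.reg_setReg, if_neg (by omega), hs₃, State.reg_setReg,
      if_neg (by omega), hs₂, State.reg_setReg, if_pos rfl]
  set s₆ := s₅.setReg (2 * r) (v r) with hs₆
  have hval6 : Operand.val s₆ (.reg (2 * (d + 2) + 1)) = ∑ i ∈ Finset.range n, g i := by
    simp only [Operand.val]
    rw [hs₆, State.reg_setReg, if_neg (by omega), g6]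
  refine ⟨_, s₆.setReg (2 * d + 1) (∑ i ∈ Finset.range n, g i),
    .seq _ _ _ _ _ _ _ h1 (.seq _ _ _ s₂ _ 1 _ ?_ (.seq _ _ _ s₃ _ 1 _ ?_
    (.seq _ _ _ s₄ _ 1 _ ?_ (.seq _ _ _ _ _ _ _ g1 (.seq _ _ _ s₆ _ 1 1 ?_ ?_))))),
    by omega, g3, ?_, ?_, ?_⟩
  · rw [hs₂, ← hval]; exact .set _ _ _ (by rw [hval]; exact hr)
  · exact .set _ _ (.lit 0) h0
  · exact .set _ _ (.lit 0) h0
  · rw [hs₆, ← hval5]; exact .set _ _ _ (by rw [hval5]; exact hr)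
  · rw [← hval6]; exact .set _ _ _ (by rw [hval6]; exact hg)
  · rw [State.vars_setReg_odd, hs₆, State.vars_setReg_even, g4, Function.update_idem,
      Function.update_eq_self]
  · intro l hl
    rw [State.reg_setReg, if_neg (by omega), hs₆, State.reg_setReg, if_neg (by omega),
      g5 l (by omega), hreg l hl.le, h5 l hl]
  · rw [State.reg_setReg, if_pos rfl]

/-! ### Commands -/

/-- With words of `w` bits, variables `v` and memory `M`, the program `p` halts within `T` steps, with
variables and memory that satisfy `Q`. -/
def Cm (w : ℕ) (p : Prog) (T : ℕ) (v M : ℕ → ℕ) (Q : (ℕ → ℕ) → (ℕ → ℕ) → Prop) : Prop :=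
  ∀ s : State, s.vars = v → s.mem = M → ∃ t s', Exec w p s t s' ∧ t ≤ T ∧ Q s'.vars s'.mem

def assign (r : ℕ) (e : ℕ → Prog) : Prog := .seq (e 0) (.set (2 * r) (.reg (2 * 0 + 1)))

def write (a e : ℕ → Prog) : Prog :=
  .seq (a 0) (.seq (e (0 + 1)) (.store (.reg (2 * 0 + 1)) (.reg (2 * (0 + 1) + 1))))

/-- The loop of `forLoop`. -/
def forWhile (r rN : ℕ) (p : Prog) : Prog :=
  .while (.lt (.reg (2 * r)) (.reg (2 * rN)))
    (.seq p (.arith (2 * r) .add (.reg (2 * r)) (.lit 1)))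

/-- Repeat `p` with the variable `r` running over the numbers less than the variable `rN`. -/
def forLoop (r rN : ℕ) (p : Prog) : Prog :=
  .seq (.set (2 * r) (.lit 0)) (forWhile r rN p)

variable {p q : Prog} {Q Q' : (ℕ → ℕ) → (ℕ → ℕ) → Prop}

theorem Cm.mono (h : Cm w p T v M Q) (hT : T ≤ T') (hQ : ∀ v' M', Q v' M' → Q' v' M') :
    Cm w p T' v M Q' := by
  intro s hv hM
  obtain ⟨t, s', h1, h2, h3⟩ := h s hv hM
  exact ⟨t, s', h1, h2.trans hT, hQ _ _ h3⟩

theorem Cm.seq (h : Cm w p T₁ v M Q) (h' : ∀ v' M', Q v' M' → Cm w q T₂ v' M' Q') :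
    Cm w (.seq p q) (T₁ + T₂) v M Q' := by
  intro s hv hM
  obtain ⟨t, s', h1, h2, h3⟩ := h s hv hM
  obtain ⟨u, s'', g1, g2, g3⟩ := h' _ _ h3 s' rfl rfl
  exact ⟨_, _, .seq _ _ _ _ _ _ _ h1 g1, by omega, g3⟩

theorem Cm.of_assign {r : ℕ} (h : Ev w v M e x T) (hQ : Q (Function.update v r x) M) :
    Cm w (assign r e) (T + 1) v M Q := by
  intro s hv hM
  obtain ⟨t, s', h1, h2, h3, h4, -, h6⟩ := h.2 0 s hv hM
  have hval : Operand.val s' (.reg (2 * 0 + 1)) = x := h6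
  refine ⟨_, s'.setReg (2 * r) x, .seq _ _ _ _ _ _ 1 h1 ?_, by omega, ?_⟩
  · rw [← hval]; exact .set _ _ _ (by rw [hval]; exact h.1)
  · rw [State.vars_setReg_even, h4, State.mem_setReg, h3]; exact hQ

theorem Cm.of_write (ha : Ev w v M a x T₁) (hb : Ev w v M b y T₂)
    (hQ : Q v (Function.update M x y)) : Cm w (write a b) (T₁ + T₂ + 1) v M Q := by
  intro s hv hM
  obtain ⟨t, s', u, s'', h1, h2, h3, h4, h5, h6, h7, h8⟩ := Ev.pair ha hb 0 s hv hM
  have hx : Operand.val s'' (.reg (2 * 0 + 1)) = x := h7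
  have hy : Operand.val s'' (.reg (2 * (0 + 1) + 1)) = y := h8
  refine ⟨_, s''.setMem x y, .seq _ _ _ _ _ _ _ h1 (.seq _ _ _ _ _ _ 1 h2 ?_), by omega, ?_⟩
  · rw [show s''.setMem x y = s''.setMem (Operand.val s'' (.reg (2 * 0 + 1)))
      (Operand.val s'' (.reg (2 * (0 + 1) + 1))) by rw [hx, hy]]
    exact .store _ _ _ (by rw [hx]; exact ha.1) (by rw [hy]; exact hb.1)
  · rw [State.vars_setMem, h5, State.mem_setMem, h4]; exact hQ

/-- The invariant fixes both the counter and the bound, so there are exactly `n` rounds and the loop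
halts. The body must leave the counter at `i`; its increment belongs to the loop. -/
theorem Cm.of_forLoop {r rN : ℕ} {I : ℕ → (ℕ → ℕ) → (ℕ → ℕ) → Prop} (hn : n < 2 ^ w)
    (hr : ∀ i v' M', I i v' M' → v' r = i ∧ v' rN = n)
    (h0 : I 0 (Function.update v r 0) M)
    (hp : ∀ i < n, ∀ v' M', I i v' M' → Cm w p T v' M' fun v'' M'' =>
      v'' r = i ∧ I (i + 1) (Function.update v'' r (i + 1)) M'') :
    Cm w (forLoop r rN p) (n * (T + 2) + 2) v M (I n) := by
  have key : ∀ j i, i + j = n → ∀ s : State, I i s.vars s.mem →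
      ∃ t s', Exec w (forWhile r rN p) s t s' ∧ t ≤ j * (T + 2) + 1 ∧ I n s'.vars s'.mem := by
    intro j
    induction j with
    | zero =>
      intro i hi s hs
      obtain rfl : i = n := by omega
      refine ⟨1, s, .whileFalse _ _ _ ?_, by omega, hs⟩
      have := hr _ _ _ hs
      simp [Test.holds, Operand.val, State.reg_even, this.1, this.2]
    | succ j ih =>
      intro i hi s hs
      obtain ⟨t, s₁, h1, h2, h3, h4⟩ := hp i (by omega) _ _ hs s rfl rfl
      have hval : Op.apply .add (Operand.val s₁ (.reg (2 * r))) (Operand.val s₁ (.lit 1)) =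
          i + 1 := by
        simp only [Op.apply, Operand.val]
        rw [State.reg_even, h3]
      obtain ⟨u, s₂, g1, g2, g3⟩ := ih (i + 1) (by omega) (s₁.setReg (2 * r) (i + 1))
        (by rw [State.vars_setReg_even]; exact h4)
      refine ⟨_, s₂, .whileTrue _ _ _ _ _ _ _ ?_ (.seq _ _ _ _ _ _ 1 h1 ?_) g1, ?_, g3⟩
      · have := hr _ _ _ hs
        simp only [Test.holds, Operand.val, State.reg_even, this.1, this.2]
        omega
      · rw [← hval]
        exact .arith _ _ _ _ _ (by rw [hval]; omega)
      · have : (j + 1) * (T + 2) = j * (T + 2) + (T + 2) := by ring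
        omega
  intro s hv hM
  obtain ⟨t, s', h1, h2, h3⟩ := key n 0 (by omega) (s.setReg (2 * r) 0)
    (by rw [State.vars_setReg_even, hv, State.mem_setReg, hM]; exact h0)
  exact ⟨_, s', .seq _ _ _ _ _ 1 _ (.set _ _ (.lit 0) (by simp [Operand.val])) h1, by omega, h3⟩

end WordRAM

/-! ### The expressions of the program

Variable `0` holds the number `n` of vertices, variable `1` the length of the list of chosen vertices
(stored from address `n * n` on), variable `2` the number `k` of vertices of low degree (they are first in
the list), variable `5` the address of a table of powers of two, and variable `6` the number `2 ^ k`. -/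

namespace WordRAM

open Classical in
/-- The truth value of a proposition as a number. -/
noncomputable def tv (p : Prop) : ℕ := if p then 1 else 0

theorem tv_true {p : Prop} (h : p) : tv p = 1 := if_pos h

theorem tv_false {p : Prop} (h : ¬ p) : tv p = 0 := if_neg h

theorem tv_le (p : Prop) : tv p ≤ 1 := by unfold tv; split_ifs <;> simp

theorem tv_eq_ite (p : Prop) [Decidable p] : tv p = if p then 1 else 0 := by
  unfold tv; split_ifs <;> rfl

theorem tv_mul (p q : Prop) : tv p * tv q = tv (p ∧ q) := by
  unfold tv; split_ifs <;> simp_all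

theorem tv_eq_zero {p : Prop} : tv p = 0 ↔ ¬ p := by unfold tv; split_ifs <;> simp_all

theorem one_sub_tv (p : Prop) : 1 - tv p = tv (¬ p) := by unfold tv; split_ifs <;> simp_all

theorem tv_congr {p q : Prop} (h : p ↔ q) : tv p = tv q := by rw [propext h]

theorem sum_tv_eq_zero {n : ℕ} {p : ℕ → Prop} :
    ∑ i ∈ Finset.range n, tv (p i) = 0 ↔ ∀ i < n, ¬ p i := by
  simp [tv_eq_zero]

theorem sum_tv_le {n : ℕ} {p : ℕ → Prop} : ∑ i ∈ Finset.range n, tv (p i) ≤ n := by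
  refine (Finset.sum_le_card_nsmul _ _ 1 fun i _ => tv_le _).trans ?_
  simp

variable {w : ℕ} {v M : ℕ → ℕ} {e a b N : ℕ → Prog} {x y n T T' T₁ T₂ Tb TN Tx : ℕ}

theorem tv_lt (hw : 0 < w) (p : Prop) : tv p < 2 ^ w :=
  (tv_le p).trans_lt (Nat.one_lt_two_pow (by omega))

theorem Ev.eqTv (hw : 0 < w) (ha : Ev w v M a x T₁) (hb : Ev w v M b y T₂) :
    Ev w v M (eEq a b) (tv (x = y)) (T₁ + T₂ + 2) := by
  rw [tv_eq_ite]; exact Ev.eq hw ha hb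

theorem Ev.ltTv (hw : 0 < w) (ha : Ev w v M a x T₁) (hb : Ev w v M b y T₂) :
    Ev w v M (eLt a b) (tv (x < y)) (T₁ + T₂ + 2) := by
  rw [tv_eq_ite]; exact Ev.lt hw ha hb

theorem Ev.mulTv {p q : Prop} (hw : 0 < w) (ha : Ev w v M a (tv p) T₁) (hb : Ev w v M b (tv q) T₂) :
    Ev w v M (eOp .mul a b) (tv (p ∧ q)) (T₁ + T₂ + 1) := by
  rw [← tv_mul]
  exact Ev.mul ha hb (by rw [tv_mul]; exact tv_lt hw _)

/-- The test that a sum of truth values is zero. -/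
theorem Ev.noneTv {r : ℕ} {p : ℕ → Prop} (hw : 0 < w) (hN : Ev w v M N n TN) (hr : v r < 2 ^ w)
    (hb : ∀ i < n, Ev w (Function.update v r i) M b (tv (p i)) Tb) :
    Ev w v M (eEq (eSum r N b) (eLit 0)) (tv (∀ i < n, ¬ p i)) (TN + n * (Tb + 3) + 9) := by
  refine (Ev.eqTv hw (Ev.sum hN hr hb (sum_tv_le.trans_lt hN.1))
    (Ev.lit (by positivity))).congr (tv_congr sum_tv_eq_zero) (by omega)

/-- The values of the variables. -/
structure Vars (n c k p : ℕ) (v : ℕ → ℕ) : Prop where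
  hn : v 0 = n
  hc : v 1 = c
  hk : v 2 = k
  hp : v 5 = p
  hq : v 6 = 2 ^ k
  scratch : ∀ r, 10 ≤ r → v r ≤ n * n + 2 ^ (3 * k + 3)

/-- Even a meaningless old value of a loop variable is copied when a sum saves it, so it has to fit
into a word. The bound leaves room for vertices, list indices and bit masks. -/
theorem Vars.update {n c k p r x : ℕ} {v : ℕ → ℕ} (h : Vars n c k p v) (hr : 10 ≤ r)
    (hx : x ≤ n * n + 2 ^ (3 * k + 3)) : Vars n c k p (Function.update v r x) where
  hn := by rw [Function.update_of_ne (by omega), h.hn]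
  hc := by rw [Function.update_of_ne (by omega), h.hc]
  hk := by rw [Function.update_of_ne (by omega), h.hk]
  hp := by rw [Function.update_of_ne (by omega), h.hp]
  hq := by rw [Function.update_of_ne (by omega), h.hq]
  scratch := by
    intro s hs
    rw [Function.update_apply]
    split_ifs
    exacts [hx, h.scratch s hs]

/-- The contents of the memory: a matrix, a list of vertices and a table of powers of two. -/
structure Tables (n k p : ℕ) (adj : ℕ → ℕ → Prop) (L : List ℕ) (M : ℕ → ℕ) : Prop where
  edge : ∀ i < n, ∀ j < n, M (i * n + j) = tv (adj i j)
  list : ∀ i < L.length, M (n * n + i) = L.getD i 0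
  pow : ∀ i ≤ 3 * k + 3, M (p + i) = 2 ^ i

/-- The words are long enough for the addresses and for sets of vertices. -/
structure Room (w n k p : ℕ) : Prop where
  addr : n * n + n + 1 < 2 ^ w
  pow : p + (3 * k + 3) < 2 ^ w
  set : n * n + 2 ^ (3 * k + 3) < 2 ^ w

theorem Room.pos {w n k p : ℕ} (h : Room w n k p) : 0 < w := by
  rcases Nat.eq_zero_or_pos w with rfl | h'
  · have := h.addr; simp at this
  · exact h'

def eAdj (a b : ℕ → Prog) : ℕ → Prog := eLoad (eOp .add (eOp .mul a (eVar 0)) b)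

def eEntry (a : ℕ → Prog) : ℕ → Prog := eLoad (eOp .add (eOp .mul (eVar 0) (eVar 0)) a)

/-- Powers of two are looked up, so that testing a bit costs a constant number of steps on a machine
without shifts. -/
def ePow (a : ℕ → Prog) : ℕ → Prog := eLoad (eOp .add (eVar 5) a)

/-- The bit number `a` of the value of `b`. -/
def eBit (a b : ℕ → Prog) : ℕ → Prog :=
  eOp .sub (eOp .div b (ePow a)) (eOp .mul (eLit 2) (eOp .div (eOp .div b (ePow a)) (eLit 2)))

variable {c k p : ℕ} {adj : ℕ → ℕ → Prop} {L : List ℕ}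

theorem mul_add_lt_mul_self {x y n : ℕ} (hx : x < n) (hy : y < n) : x * n + y < n * n := by
  have : (x + 1) * n ≤ n * n := Nat.mul_le_mul_right n hx
  rw [Nat.succ_mul] at this
  omega

theorem Ev.edge (hadj : ∀ i < n, ∀ j < n, M (i * n + j) = tv (adj i j)) (hn : n * n < 2 ^ w)
    (hw : 0 < w) (hv : v 0 = n) (ha : Ev w v M a x T₁) (hb : Ev w v M b y T₂) (hx : x < n)
    (hy : y < n) : Ev w v M (eAdj a b) (tv (adj x y)) (T₁ + T₂ + 4) := by
  have h1 := mul_add_lt_mul_self hx hy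
  have h2 : n ≤ n * n := Nat.le_mul_self n
  exact (Ev.load (Ev.add (Ev.mul ha (Ev.var hv (by omega)) (by omega)) hb (by omega))
    (hadj x hx y hy) (tv_lt hw _)).congr rfl (by omega)

theorem Ev.entry (hlist : ∀ i < L.length, M (n * n + i) = L.getD i 0) (hL : ∀ x ∈ L, x < n)
    (hLn : L.length ≤ n) (hn : n * n + n + 1 < 2 ^ w) (hv : v 0 = n) (ha : Ev w v M a x T)
    (hx : x < L.length) : Ev w v M (eEntry a) (L.getD x 0) (T + 5) := by
  have h1 : n ≤ n * n := Nat.le_mul_self n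
  have h2 : L.getD x 0 < n := hL _ (by
    rw [List.getD_eq_getElem _ _ hx]; exact List.getElem_mem _)
  exact (Ev.load (Ev.add (Ev.mul (Ev.var hv (by omega)) (Ev.var hv (by omega)) (by omega)) ha
    (by omega)) (hlist x hx) (by omega)).congr rfl (by omega)

theorem Ev.pow (hv : Vars n c k p v) (hM : Tables n k p adj L M) (hw : Room w n k p)
    (ha : Ev w v M a x T) (hx : x ≤ 3 * k + 3) : Ev w v M (ePow a) (2 ^ x) (T + 3) := by
  have h1 := hw.pow
  have h2 : 2 ^ x ≤ 2 ^ (3 * k + 3) := Nat.pow_le_pow_right (by norm_num) hx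
  have h3 := hw.set
  exact (Ev.load (Ev.add (Ev.var hv.hp (by omega)) ha (by omega)) (hM.pow x hx) (by omega)).congr
    rfl (by omega)

/-- With `q = y / 2 ^ x`, the bit is the remainder `q - 2 * (q / 2)`. -/
theorem Ev.bit (hv : Vars n c k p v) (hM : Tables n k p adj L M) (hw : Room w n k p)
    (ha : Ev w v M a x T₁) (hb : Ev w v M b y T₂) (hx : x ≤ 3 * k + 3) :
    Ev w v M (eBit a b) (tv (y.testBit x = true)) (2 * T₁ + 2 * T₂ + 13) := by
  have hp := Ev.pow hv hM hw ha hx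
  have h1 : 2 < 2 ^ w := by
    have := hw.set
    have h3 : 2 ^ 3 ≤ 2 ^ (3 * k + 3) := Nat.pow_le_pow_right (by norm_num) (by omega)
    omega
  have hd := Ev.div hb hp
  have h2 : 2 * (y / 2 ^ x / 2) ≤ y / 2 ^ x := by omega
  refine (Ev.sub hd (Ev.mul (Ev.lit h1) (Ev.div hd (Ev.lit h1)) (h2.trans_lt hd.1))).congr ?_
    (by omega)
  rw [Nat.testBit_eq_decide_div_mod_eq, tv_eq_ite]
  simp only [decide_eq_true_eq]
  split_ifs <;> omega

/-- The vertices of low degree that are adjacent to `x` are in the set with the bit mask `m`. -/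
def Conf (adj : ℕ → ℕ → Prop) (L : List ℕ) (k x m : ℕ) : Prop :=
  ∀ i < k, ¬ (adj (L.getD i 0) x ∧ ¬ m.testBit i = true)

/-- The test whether the value of `a` is confined to the set in variable `11`. -/
def eConf (a : ℕ → Prog) : ℕ → Prog :=
  eEq (eSum 10 (eVar 2) (eOp .mul (eAdj (eEntry (eVar 10)) a)
    (eOp .sub (eLit 1) (eBit (eVar 10) (eVar 11))))) (eLit 0)

theorem Ev.conf (hv : Vars n c k p v) (hM : Tables n k p adj L M) (hw : Room w n k p)
    (hL : ∀ x ∈ L, x < n) (hLn : L.length ≤ n) (hk : k ≤ L.length)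
    (ha : ∀ i < k, Ev w (Function.update v 10 i) M a x Tx) (hx : x < n) {m : ℕ} (hm : v 11 = m)
    (hmk : m < 2 ^ k) : Ev w v M (eConf a) (tv (Conf adj L k x m)) (k * (Tx + 33) + 10) := by
  have h1 := hw.addr
  have h2 := hw.set
  have h3 : 2 ^ k ≤ 2 ^ (3 * k + 3) := Nat.pow_le_pow_right (by norm_num) (by omega)
  have h4 : n ≤ n * n := Nat.le_mul_self n
  have h5 := hv.scratch 10 le_rfl
  refine (Ev.noneTv (p := fun i => adj (L.getD i 0) x ∧ ¬ m.testBit i = true) (Tb := Tx + 30)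
    hw.pos (Ev.var hv.hk (by omega)) (by omega) ?_).congr rfl
    (by ring_nf; omega)
  intro i hi
  have hv' := hv.update (r := 10) (x := i) le_rfl (by omega)
  have hi' : Ev w (Function.update v 10 i) M (eVar 10) i 1 := Ev.var (by simp) (by omega)
  have hgi : L.getD i 0 < n := hL _ (by
    rw [List.getD_eq_getElem _ _ (by omega)]; exact List.getElem_mem _)
  have hb : Ev w (Function.update v 10 i) M (eOp .sub (eLit 1) (eBit (eVar 10) (eVar 11)))
      (tv (¬ m.testBit i = true)) 19 := by
    refine (Ev.sub (Ev.lit (by omega)) (Ev.bit hv' hM hw hi' (Ev.var ?_ (x := m) (by omega))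
      (by omega))).congr (one_sub_tv _) (by omega)
    rw [Function.update_of_ne (by omega), hm]
  exact (Ev.mulTv hw.pos (Ev.edge hM.edge (by omega) hw.pos hv'.hn
    (Ev.entry hM.list hL hLn hw.addr hv'.hn hi' (by omega)) (ha i hi) hgi hx) hb).congr rfl
    (by omega)

/-- The number of elements of the set with the bit mask `m`. -/
noncomputable def bitCard (k m : ℕ) : ℕ := ∑ i ∈ Finset.range k, tv (m.testBit i = true)

/-- The number of entries of `L` after the first `k` that are confined to the set with the bit
mask `m`. -/
noncomputable def confCard (adj : ℕ → ℕ → Prop) (L : List ℕ) (k m : ℕ) : ℕ :=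
  ∑ j ∈ Finset.range (L.length - k), tv (Conf adj L k (L.getD (k + j) 0) m)

/-- The test whether the set in variable `11` is tight. -/
def eTight : ℕ → Prog :=
  eEq (eSum 12 (eOp .sub (eVar 1) (eVar 2)) (eConf (eEntry (eOp .add (eVar 2) (eVar 12)))))
    (eOp .mul (eLit 2) (eSum 10 (eVar 2) (eBit (eVar 10) (eVar 11))))

/-- At most `2k` entries follow the low vertices, by `hk3`, and each is tested for confinement in
`O(k + 1)` steps, which gives the quadratic bound. -/
theorem Ev.tight (hv : Vars n c k p v) (hc : c = L.length) (hM : Tables n k p adj L M)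
    (hw : Room w n k p)
    (hL : ∀ x ∈ L, x < n) (hLn : L.length ≤ n) (hk : k ≤ L.length) (hk3 : L.length ≤ 3 * k) {m : ℕ}
    (hm : v 11 = m) (hmk : m < 2 ^ k) :
    Ev w v M eTight (tv (confCard adj L k m = 2 * bitCard k m)) (150 * (k + 1) ^ 2) := by
  have h1 := hw.addr
  have h2 := hw.set
  have h3 : 2 ^ k ≤ 2 ^ (3 * k + 3) := Nat.pow_le_pow_right (by norm_num) (by omega)
  have h4 : n ≤ n * n := Nat.le_mul_self n
  have h5 := hv.scratch 10 le_rfl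
  have h6 := hv.scratch 12 (by omega)
  have h7 : bitCard k m ≤ k := sum_tv_le
  have hkv : Ev w v M (eVar 2) k 1 := Ev.var hv.hk (by omega)
  have hbit : Ev w v M (eSum 10 (eVar 2) (eBit (eVar 10) (eVar 11))) (bitCard k m)
      (k * 20 + 7) := by
    refine (Ev.sum (Tb := 17) hkv (by omega) ?_ (h7.trans_lt (by omega))).congr rfl (by omega)
    intro i hi
    refine (Ev.bit (hv.update le_rfl (by omega)) hM hw (Ev.var (by simp) (by omega))
      (Ev.var ?_ (by omega)) (by omega)).congr rfl (by omega)
    rw [Function.update_of_ne (by omega), hm]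
  have hcnt : Ev w v M
      (eSum 12 (eOp .sub (eVar 1) (eVar 2)) (eConf (eEntry (eOp .add (eVar 2) (eVar 12)))))
      (confCard adj L k m) (3 + (L.length - k) * ((k * 41 + 10) + 3) + 6) := by
    refine Ev.sum (Ev.sub (Ev.var (hv.hc.trans hc) (by omega)) hkv) (by omega) ?_
      (sum_tv_le.trans_lt (by omega))
    intro j hj
    have hv' := hv.update (r := 12) (x := j) (by omega) (by omega)
    refine (Ev.conf (Tx := 8) hv' hM hw hL hLn hk ?_ ?_
      (by rw [Function.update_of_ne (by omega), hm]) hmk).congr rfl (by ring_nf; omega)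
    · intro i hi
      have hv'' := hv'.update (r := 10) (x := i) (by omega) (by omega)
      refine (Ev.entry hM.list hL hLn hw.addr hv''.hn (Ev.add (Ev.var hv''.hk (by omega))
        (Ev.var (x := j) ?_ (by omega)) (by omega)) (by omega)).congr rfl (by omega)
      rw [Function.update_of_ne (by omega), Function.update_self]
    · exact hL _ (by rw [List.getD_eq_getElem _ _ (by omega)]; exact List.getElem_mem _)
  refine (Ev.eqTv hw.pos hcnt (Ev.mul (Ev.lit ?_) hbit ?_)).congr rfl ?_
  · have h8 : 2 ^ 3 ≤ 2 ^ (3 * k + 3) := Nat.pow_le_pow_right (by norm_num) (by omega)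
    omega
  · have : 3 * k + 3 < 2 ^ (3 * k + 3) := Nat.lt_two_pow_self
    omega
  · have h8 : (L.length - k) * (k * 41 + 10 + 3) ≤ (2 * k) * (k * 41 + 10 + 3) :=
      Nat.mul_le_mul_right _ (by omega)
    nlinarith

/-- The test whether the vertex in variable `4` can be added to the list: it is not in the list, and
it is not confined to a tight set. -/
def eFree : ℕ → Prog :=
  eOp .mul (eEq (eSum 12 (eVar 1) (eEq (eEntry (eVar 12)) (eVar 4))) (eLit 0))
    (eEq (eSum 11 (eVar 6) (eOp .mul (eConf (eVar 4)) eTight)) (eLit 0))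

/-- The vertex `x` is not in the list `L` and not confined to a tight set. -/
def Free (adj : ℕ → ℕ → Prop) (L : List ℕ) (k x : ℕ) : Prop :=
  x ∉ L ∧ ∀ m < 2 ^ k, ¬ (Conf adj L k x m ∧ confCard adj L k m = 2 * bitCard k m)

theorem Ev.notMem (hlist : ∀ i < L.length, M (n * n + i) = L.getD i 0) (hv0 : v 0 = n)
    (hv1 : v 1 = L.length) (h12 : v 12 < 2 ^ w) (hw : 0 < w) (hn : n * n + n + 1 < 2 ^ w)
    (hL : ∀ x ∈ L, x < n) (hLn : L.length ≤ n) (hx : v 4 = x) (hxn : x < n) :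
    Ev w v M (eEq (eSum 12 (eVar 1) (eEq (eEntry (eVar 12)) (eVar 4))) (eLit 0)) (tv (x ∉ L))
      (n * 12 + 10) := by
  refine (Ev.noneTv (p := fun i => L.getD i 0 = x) (Tb := 9) hw
    (Ev.var hv1 (by omega)) h12 ?_).congr (tv_congr ?_) ?_
  · intro i hi
    refine (Ev.eqTv hw (Ev.entry hlist hL hLn hn (by rw [Function.update_of_ne (by omega), hv0])
      (Ev.var (by simp) (by omega)) hi) (Ev.var ?_ (by omega))).congr rfl (by omega)
    rw [Function.update_of_ne (by omega), hx]
  · constructor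
    · intro h hxL
      obtain ⟨i, hi, rfl⟩ := List.getElem_of_mem hxL
      exact h i hi (List.getD_eq_getElem _ _ hi)
    · rintro h i hi rfl
      refine h ?_
      rw [List.getD_eq_getElem _ _ hi]
      exact List.getElem_mem _
  · have : L.length * (9 + 3) ≤ n * (9 + 3) := Nat.mul_le_mul_right _ hLn
    omega

theorem Ev.free (hv : Vars n c k p v) (hc : c = L.length) (hM : Tables n k p adj L M)
    (hw : Room w n k p)
    (hL : ∀ x ∈ L, x < n) (hLn : L.length ≤ n) (hk : k ≤ L.length) (hk3 : L.length ≤ 3 * k)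
    (hx : v 4 = x) (hxn : x < n) :
    Ev w v M eFree (tv (Free adj L k x)) (12 * n + 2 ^ k * (250 * (k + 1) ^ 2) + 30) := by
  have h1 := hw.addr
  have h2 := hw.set
  have h3 : 2 ^ k ≤ 2 ^ (3 * k + 3) := Nat.pow_le_pow_right (by norm_num) (by omega)
  have h4 : n ≤ n * n := Nat.le_mul_self n
  have h5 := hv.scratch 11 (by omega)
  have h6 := hv.scratch 12 (by omega)
  have hT : Ev w v M (eEq (eSum 11 (eVar 6) (eOp .mul (eConf (eVar 4)) eTight)) (eLit 0))
      (tv (∀ m < 2 ^ k, ¬ (Conf adj L k x m ∧ confCard adj L k m = 2 * bitCard k m)))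
      (1 + 2 ^ k * ((k * 34 + 10) + 150 * (k + 1) ^ 2 + 1 + 3) + 9) := by
    refine Ev.noneTv hw.pos (Ev.var hv.hq (by omega)) (by omega) ?_
    intro m hm
    have hv' := hv.update (r := 11) (x := m) (by omega) (by omega)
    refine Ev.mulTv hw.pos ((Ev.conf (Tx := 1) hv' hM hw hL hLn hk ?_ hxn (by simp) hm).congr rfl
      (by omega)) (Ev.tight hv' hc hM hw hL hLn hk hk3 (by simp) hm)
    intro i hi
    exact Ev.var (by simp [hx]) (by omega)
  refine (Ev.mulTv hw.pos (Ev.notMem hM.list hv.hn (hv.hc.trans hc) (by omega) hw.pos hw.addr hL hLn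
    hx hxn) hT).congr rfl ?_
  have : 2 ^ k * ((k * 34 + 10) + 150 * (k + 1) ^ 2 + 1 + 3) ≤ 2 ^ k * (250 * (k + 1) ^ 2) :=
    Nat.mul_le_mul_left _ (by nlinarith)
  omega

/-- The number of entries of row `x` of the matrix. -/
noncomputable def rowCard (adj : ℕ → ℕ → Prop) (n x : ℕ) : ℕ :=
  ∑ j ∈ Finset.range n, tv (adj x j)

/-- The test whether the vertex in variable `4` has low degree. -/
def eLow : ℕ → Prog :=
  eLt (eOp .mul (eLit 2) (eSum 10 (eVar 0) (eAdj (eVar 4) (eVar 10)))) (eVar 0)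

theorem Ev.low (hadj : ∀ i < n, ∀ j < n, M (i * n + j) = tv (adj i j)) (hv0 : v 0 = n)
    (h10 : v 10 < 2 ^ w) (hw : 0 < w) (hn : n * n + n + 1 < 2 ^ w) (hx : v 4 = x) (hxn : x < n) :
    Ev w v M eLow (tv (2 * rowCard adj n x < n)) (9 * n + 12) := by
  have h4 : n ≤ n * n := Nat.le_mul_self n
  have hr : rowCard adj n x ≤ n := sum_tv_le
  have hsum : Ev w v M (eSum 10 (eVar 0) (eAdj (eVar 4) (eVar 10))) (rowCard adj n x)
      (1 + n * (6 + 3) + 6) := by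
    refine Ev.sum (Ev.var hv0 (by omega)) h10 ?_ (hr.trans_lt (by omega))
    intro i hi
    exact (Ev.edge hadj (by omega) hw (by rw [Function.update_of_ne (by omega), hv0])
      (Ev.var (x := x) (by rw [Function.update_of_ne (by omega), hx]) (by omega))
      (Ev.var (by simp) (by omega)) hxn hi).congr rfl (by omega)
  refine (Ev.ltTv hw (Ev.mul (Ev.lit ?_) hsum ?_) (Ev.var hv0 (by omega))).congr rfl (by omega)
  · have : 1 ≤ n * n := Nat.mul_pos (by omega) (by omega)
    omega
  · omega

end WordRAM

/-! ### The list of vertices -/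

namespace WordRAM

variable {w : ℕ} {v M M' : ℕ → ℕ} {e a b N : ℕ → Prog} {x y n c k p T T' T₁ T₂ Tb TN Tx : ℕ}
  {adj : ℕ → ℕ → Prop} {L : List ℕ}

/-- The memory contains the list `L` from address `n * n` on. -/
def Listed (n : ℕ) (L : List ℕ) (M : ℕ → ℕ) : Prop :=
  ∀ i < L.length, M (n * n + i) = L.getD i 0

/-- The memories agree, except possibly in the space for a list. -/
def Agree (n : ℕ) (M M' : ℕ → ℕ) : Prop :=
  ∀ a, a < n * n ∨ n * n + n < a → M' a = M a

/-- Run through all vertices and append those to the list that satisfy the test `e`. -/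
def scan (e : ℕ → Prog) : Prog :=
  forLoop 4 0 (.seq (write (eOp .add (eOp .mul (eVar 0) (eVar 0)) (eVar 1)) (eVar 4))
    (assign 1 (eOp .add (eVar 1) e)))

/-- The candidate is always written into the cell behind the list, and the length is then increased
by the truth value of the test, so no branch is needed. A full list makes this the cell `n * n + n`,
which is why `Agree` exempts `n + 1` cells. -/
theorem Cm.scan {P φ : ℕ → List ℕ → Prop} {L₀ : List ℕ} (hn : n * n + n + 1 < 2 ^ w)
    (hv0 : v 0 = n) (hv1 : v 1 = L₀.length) (hL₀ : Listed n L₀ M) (hP₀ : P 0 L₀)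
    (hlen : ∀ i ≤ n, ∀ L, P i L → L.length ≤ n)
    (hstep : ∀ i < n, ∀ L, P i L → (φ i L → P (i + 1) (L ++ [i])) ∧ (¬ φ i L → P (i + 1) L))
    (he : ∀ i < n, ∀ L M', P i L → Agree n M M' → Listed n L M' →
      Ev w (Function.update (Function.update v 1 L.length) 4 i) M' e (tv (φ i L)) T) :
    Cm w (scan e) (n * (T + 12) + 2) v M fun v' M' => ∃ L, P n L ∧
      v' = Function.update (Function.update v 1 L.length) 4 n ∧ Agree n M M' ∧ Listed n L M' := by
  have hnn : n ≤ n * n := Nat.le_mul_self n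
  refine (Cm.of_forLoop (T := T + 10) (I := fun i v' M' => ∃ L, P i L ∧
    v' = Function.update (Function.update v 1 L.length) 4 i ∧ Agree n M M' ∧ Listed n L M')
    (n := n) (by omega) ?_ ?_ ?_)
  · rintro i v' M' ⟨L, -, rfl, -, -⟩
    simp [hv0]
  · refine ⟨L₀, hP₀, ?_, fun _ _ => rfl, hL₀⟩
    rw [← hv1, Function.update_eq_self]
  · rintro i hi _ M' ⟨L, hP, rfl, hA, hL⟩
    have hLn := hlen i hi.le L hP
    set v' := Function.update (Function.update v 1 L.length) 4 i with hv'
    have hv'0 : v' 0 = n := by simp [hv', hv0]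
    have hv'1 : v' 1 = L.length := by simp [hv']
    have hv'4 : v' 4 = i := by simp [hv']
    set M₁ := Function.update M' (n * n + L.length) i with hM₁
    have hA₁ : Agree n M M₁ := by
      intro a ha
      rw [hM₁, Function.update_of_ne (by omega), hA a ha]
    have hL₁ : Listed n L M₁ := by
      intro j hj
      rw [hM₁, Function.update_of_ne (by omega), hL j hj]
    have hL₂ : Listed n (L ++ [i]) M₁ := by
      intro j hj
      rw [List.length_append, List.length_singleton] at hj
      rcases Nat.lt_succ_iff_lt_or_eq.1 hj with hj | rfl
      · rw [hL₁ j hj, List.getD_append _ _ _ _ hj]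
      · rw [hM₁, Function.update_self, List.getD_append_right _ _ _ _ le_rfl]
        simp
    have h1 : Cm w (write (eOp .add (eOp .mul (eVar 0) (eVar 0)) (eVar 1)) (eVar 4)) 7 v' M'
        (fun v'' M'' => v'' = v' ∧ M'' = M₁) :=
      (Cm.of_write (x := n * n + L.length) (y := i)
        (Ev.add (Ev.mul (Ev.var hv'0 (by omega)) (Ev.var hv'0 (by omega)) (by omega))
          (Ev.var hv'1 (by omega)) (by omega)) (Ev.var hv'4 (by omega)) ⟨rfl, rfl⟩).mono (by omega)
        fun _ _ h => h
    refine (Cm.seq (T₁ := 7) (T₂ := T + 3) h1 ?_).mono (by omega) (fun _ _ h => h)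
    rintro _ _ ⟨rfl, rfl⟩
    have htv := tv_le (φ i L)
    refine (Cm.of_assign (x := L.length + tv (φ i L)) (Ev.add (Ev.var hv'1 (by omega))
      (he i hi L M₁ hP hA₁ hL₁) (by omega)) ?_).mono (by omega) (fun _ _ h => h)
    refine ⟨by rw [Function.update_of_ne (by omega), hv'4], ?_⟩
    have hup : ∀ x, Function.update (Function.update v' 1 x) 4 (i + 1) =
        Function.update (Function.update v 1 x) 4 (i + 1) := by
      intro x
      funext r
      simp only [hv', Function.update_apply]
      split_ifs <;> rfl
    by_cases hφ : φ i L
    · refine ⟨L ++ [i], (hstep i hi L hP).1 hφ, ?_, hA₁, hL₂⟩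
      rw [tv_true hφ, hup, List.length_append, List.length_singleton]
    · refine ⟨L, (hstep i hi L hP).2 hφ, ?_, hA₁, hL₁⟩
      rw [tv_false hφ, hup, add_zero]

/-! ### The table of powers of two -/

/-- Write the powers of two into the memory from the address in variable `5` on. -/
def powTable : Prog :=
  .seq (assign 16 (eOp .add (eOp .mul (eLit 3) (eVar 2)) (eLit 3)))
    (.seq (write (eVar 5) (eLit 1))
      (forLoop 9 16 (write (eOp .add (eOp .add (eVar 5) (eVar 9)) (eLit 1))
        (eOp .mul (eLit 2) (eLoad (eOp .add (eVar 5) (eVar 9)))))))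

theorem Cm.powTable (hv2 : v 2 = k) (hv5 : v 5 = p) (hp : p + (3 * k + 3) < 2 ^ w)
    (hk : 2 ^ (3 * k + 3) < 2 ^ w) :
    Cm w powTable (42 * k + 60) v M fun v' M' => (∀ r, r ≠ 9 → r ≠ 16 → v' r = v r) ∧
      v' 16 = 3 * k + 3 ∧
      (∀ i ≤ 3 * k + 3, M' (p + i) = 2 ^ i) ∧ ∀ a, a < p ∨ p + (3 * k + 3) < a → M' a = M a := by
  have h3 : 2 ^ 3 ≤ 2 ^ (3 * k + 3) := Nat.pow_le_pow_right (by norm_num) (by omega)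
  have h4 : 3 * k + 3 < 2 ^ (3 * k + 3) := Nat.lt_two_pow_self
  have c1 : Cm w (assign 16 (eOp .add (eOp .mul (eLit 3) (eVar 2)) (eLit 3))) 6 v M
      (fun v' M' => v' = Function.update v 16 (3 * k + 3) ∧ M = M') :=
    (Cm.of_assign (x := 3 * k + 3) (Ev.add (Ev.mul (Ev.lit (by omega)) (Ev.var hv2 (by omega))
      (by omega)) (Ev.lit (by omega)) (by omega)) ⟨rfl, rfl⟩).mono (by omega) fun _ _ h => h
  set v₁ := Function.update v 16 (3 * k + 3) with hv₁
  have hv₁5 : v₁ 5 = p := by simp [hv₁, hv5]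
  have c2 : Cm w (write (eVar 5) (eLit 1)) 3 v₁ M
      (fun v' M' => v' = v₁ ∧ M' = Function.update M p 1) :=
    (Cm.of_write (x := p) (y := 1) (Ev.var hv₁5 (by omega)) (Ev.lit (by omega)) ⟨rfl, rfl⟩).mono
      (by omega) fun _ _ h => h
  refine (c1.seq (T₂ := 3 + ((3 * k + 3) * (12 + 2) + 2)) (?_)).mono (by omega) (fun _ _ h => h)
  rintro _ _ ⟨rfl, rfl⟩
  refine c2.seq ?_
  rintro _ _ ⟨rfl, rfl⟩
  refine (Cm.of_forLoop (T := 12) (n := 3 * k + 3) (I := fun i v' M' =>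
    v' = Function.update v₁ 9 i ∧ (∀ j ≤ i, M' (p + j) = 2 ^ j) ∧
      ∀ a, a < p ∨ p + i < a → M' a = M a) (by omega) ?_ ?_ ?_).mono le_rfl ?_
  · rintro i v' M' ⟨rfl, -, -⟩
    simp [hv₁]
  · refine ⟨rfl, ?_, ?_⟩
    · intro j hj
      obtain rfl : j = 0 := by omega
      simp
    · intro a ha
      rw [Function.update_of_ne (by omega)]
  · rintro i hi _ M' ⟨rfl, hM, hM'⟩
    set v₂ := Function.update v₁ 9 i with hv₂
    have hv₂5 : v₂ 5 = p := by simp [hv₂, hv₁5]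
    have hv₂9 : v₂ 9 = i := by simp [hv₂]
    have h5 : 2 ^ (i + 1) ≤ 2 ^ (3 * k + 3) := Nat.pow_le_pow_right (by norm_num) (by omega)
    have h6 : 2 * 2 ^ i = 2 ^ (i + 1) := by ring
    have ha : Ev w v₂ M' (eOp .add (eVar 5) (eVar 9)) (p + i) 3 :=
      (Ev.add (Ev.var hv₂5 (by omega)) (Ev.var hv₂9 (by omega)) (by omega)).congr rfl (by omega)
    refine (Cm.of_write (x := p + i + 1) (y := 2 * 2 ^ i) (Ev.add ha (Ev.lit (by omega)) (by omega))
      (Ev.mul (Ev.lit (by omega)) (Ev.load ha (hM i le_rfl) (by omega)) (by omega)) ?_).mono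
      (T' := 12) (by omega) fun _ _ h => h
    refine ⟨hv₂9, by rw [hv₂, Function.update_idem], ?_, ?_⟩
    · intro j hj
      rcases Nat.le_succ_iff.1 hj with hj | rfl
      · rw [Function.update_of_ne (by omega), hM j hj]
      · rw [show p + (i + 1) = p + i + 1 from rfl, Function.update_self, h6]
    · intro a ha
      rw [Function.update_of_ne (by omega), hM' a (by omega)]
  · rintro v' M' ⟨rfl, h1, h2⟩
    refine ⟨?_, by simp [hv₁], h1, h2⟩
    intro r h9 h16
    rw [Function.update_of_ne h9, hv₁, Function.update_of_ne h16]

/-! ### Dynamic programming over sets of chosen vertices -/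

theorem Ev.orTv {P Q : Prop} (hw : 1 < w) (ha : Ev w v M a (tv P) T₁) (hb : Ev w v M b (tv Q) T₂) :
    Ev w v M (eLt (eLit 0) (eOp .add a b)) (tv (P ∨ Q)) (T₁ + T₂ + 4) := by
  have h1 : 2 ^ 2 ≤ 2 ^ w := Nat.pow_le_pow_right (by norm_num) hw
  have h2 := tv_le P
  have h3 := tv_le Q
  refine (Ev.ltTv (by omega) (Ev.lit (by omega)) (Ev.add ha hb (by omega))).congr (tv_congr ?_)
    (by omega)
  by_cases hP : P <;> by_cases hQ : Q <;> simp [tv_true, tv_false, hP, hQ]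

/-- The test that a sum of truth values is not zero. -/
theorem Ev.anyTv {r : ℕ} {P : ℕ → Prop} (hw : 0 < w) (hN : Ev w v M N n TN) (hr : v r < 2 ^ w)
    (hb : ∀ i < n, Ev w (Function.update v r i) M b (tv (P i)) Tb) :
    Ev w v M (eLt (eLit 0) (eSum r N b)) (tv (∃ i < n, P i)) (TN + n * (Tb + 3) + 9) := by
  refine (Ev.ltTv hw (Ev.lit (by positivity)) (Ev.sum hN hr hb
    (sum_tv_le.trans_lt hN.1))).congr (tv_congr ?_) (by omega)
  rw [Nat.pos_iff_ne_zero, ne_eq, sum_tv_eq_zero]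
  push Not
  rfl

/-- The relation on the indices of chosen vertices; vertices of high degree are joined. -/
def Link (adj : ℕ → ℕ → Prop) (L : List ℕ) (k i j : ℕ) : Prop :=
  adj (L.getD i 0) (L.getD j 0) ∨ (k ≤ i ∧ k ≤ j)

def eLink (a b : ℕ → Prog) : ℕ → Prog :=
  eLt (eLit 0) (eOp .add (eAdj (eEntry a) (eEntry b))
    (eOp .mul (eEq (eOp .sub (eVar 2) a) (eLit 0)) (eEq (eOp .sub (eVar 2) b) (eLit 0))))

theorem Ev.link (hv : Vars n c k p v) (hM : Tables n k p adj L M) (hw : Room w n k p)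
    (hL : ∀ x ∈ L, x < n) (hLn : L.length ≤ n) (hk : k ≤ L.length)
    (ha : Ev w v M a x T₁) (hb : Ev w v M b y T₂) (hx : x < L.length) (hy : y < L.length) :
    Ev w v M (eLink a b) (tv (Link adj L k x y)) (2 * T₁ + 2 * T₂ + 30) := by
  have h1 := hw.addr
  have h4 : n ≤ n * n := Nat.le_mul_self n
  have hw1 : 1 < w := by
    by_contra hcon
    have h2 := hw.set
    have h3 : 2 ^ 3 ≤ 2 ^ (3 * k + 3) := Nat.pow_le_pow_right (by norm_num) (by omega)
    have h5 : 2 ^ w ≤ 2 ^ 1 := Nat.pow_le_pow_right (by norm_num) (by omega)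
    omega
  have hmem : ∀ i < L.length, L.getD i 0 < n := fun i hi => hL _ (by
    rw [List.getD_eq_getElem _ _ hi]; exact List.getElem_mem _)
  have hkv : Ev w v M (eVar 2) k 1 := Ev.var hv.hk (by omega)
  have h0 : Ev w v M (eLit 0) 0 1 := Ev.lit (by positivity)
  refine (Ev.orTv hw1 (Ev.edge hM.edge (by omega) hw.pos hv.hn
    (Ev.entry hM.list hL hLn h1 hv.hn ha hx) (Ev.entry hM.list hL hLn h1 hv.hn hb hy)
    (hmem x hx) (hmem y hy))
    (Ev.mulTv hw.pos (Ev.eqTv hw.pos (Ev.sub hkv ha) h0) (Ev.eqTv hw.pos (Ev.sub hkv hb) h0))).congr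
    (tv_congr ?_) (by omega)
  rw [Link, Nat.sub_eq_zero_iff_le, Nat.sub_eq_zero_iff_le]

/-- The test whether the table entry for the set and the end vertex with the values of `a` and `b` is
set, where variable `7` contains the address of the table. -/
def eCell (a b : ℕ → Prog) : ℕ → Prog :=
  eLoad (eOp .add (eVar 7) (eOp .add (eOp .mul a (eVar 1)) b))

/-- The loaded value must be known to be 0 or 1 to serve as a truth value; the bound is asked of all
cells from `d` on, so that it also covers cells not yet filled. -/
theorem Ev.cell {d : ℕ} (hv7 : v 7 = d) (hv1 : v 1 = c) (hd : d + 2 ^ c * c < 2 ^ w)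
    (hM : ∀ a, d ≤ a → M a ≤ 1) (ha : Ev w v M a x T₁) (hb : Ev w v M b y T₂)
    (hx : x < 2 ^ c) (hy : y < c) :
    Ev w v M (eCell a b) (tv (M (d + (x * c + y)) = 1)) (T₁ + T₂ + 6) := by
  have h1 : (x + 1) * c ≤ 2 ^ c * c := Nat.mul_le_mul_right c hx
  rw [Nat.succ_mul] at h1
  have h2 := hM (d + (x * c + y)) (by omega)
  have h3 : c < 2 ^ c := Nat.lt_two_pow_self
  have h4 : 2 ^ c * 1 ≤ 2 ^ c * c := Nat.mul_le_mul_left _ (by omega)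
  refine (Ev.load (y := M (d + (x * c + y))) (Ev.add (Ev.var hv7 (by omega)) (Ev.add
    (Ev.mul ha (Ev.var hv1 (by omega)) (by omega)) hb (by omega)) (by omega)) rfl
    (by omega)).congr ?_ (by omega)
  rcases Nat.le_one_iff_eq_zero_or_eq_one.1 h2 with h | h <;> rw [h]
  · exact (tv_false (by omega)).symm
  · exact (tv_true rfl).symm

/-- The value of the table entry for the set in variable `14` and the end vertex in variable `15`. -/
def eStep : ℕ → Prog :=
  eLt (eLit 0) (eOp .add
    (eOp .mul (eEq (eVar 14) (eLit 1)) (eEq (eVar 15) (eLit 0)))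
    (eOp .mul (eLt (eLit 0) (eVar 15)) (eOp .mul (eBit (eVar 15) (eVar 14))
      (eLt (eLit 0) (eSum 10 (eVar 1) (eOp .mul
        (eCell (eOp .sub (eVar 14) (ePow (eVar 15))) (eVar 10)) (eLink (eVar 15) (eVar 10))))))))

/-- The recursion for the table: a path through the set `m` that ends in `j`. -/
def Step (adj : ℕ → ℕ → Prop) (L : List ℕ) (k : ℕ) (D : ℕ → ℕ) (m j : ℕ) : Prop :=
  (m = 1 ∧ j = 0) ∨ (0 < j ∧ m.testBit j = true ∧
    ∃ i < L.length, D ((m - 2 ^ j) * L.length + i) = 1 ∧ Link adj L k j i)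

/-- All parts of the expression are evaluated, even when bit `j` is not set. The load then takes
place at a truncated difference, which still lies below `2 ^ c`, and `hMd` keeps the loaded value
harmless. -/
theorem Ev.step {d m j : ℕ} (hv : Vars n c k p v) (hc : c = L.length) (hM : Tables n k p adj L M)
    (hw : Room w n k p) (hL : ∀ x ∈ L, x < n) (hLn : L.length ≤ n) (hk : k ≤ L.length)
    (hk3 : L.length ≤ 3 * k + 3) (hv7 : v 7 = d) (hd : d + 2 ^ c * c < 2 ^ w)
    (hMd : ∀ a, d ≤ a → M a ≤ 1) (h14 : v 14 = m) (h15 : v 15 = j) (hm : m < 2 ^ c) (hj : j < c) :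
    Ev w v M eStep (tv (Step adj L k (fun t => M (d + t)) m j)) (c * 60 + 60) := by
  have h1 := hw.addr
  have h2 := hw.set
  have h4 : n ≤ n * n := Nat.le_mul_self n
  have hcp : 2 ^ c ≤ 2 ^ (3 * k + 3) := Nat.pow_le_pow_right (by norm_num) (by omega)
  have h5 := hv.scratch 10 le_rfl
  have hw1 : 1 < w := by
    by_contra hcon
    have h3 : 2 ^ 3 ≤ 2 ^ (3 * k + 3) := Nat.pow_le_pow_right (by norm_num) (by omega)
    have h5 : 2 ^ w ≤ 2 ^ 1 := Nat.pow_le_pow_right (by norm_num) (by omega)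
    omega
  have hw0 := hw.pos
  have e14 : Ev w v M (eVar 14) m 1 := Ev.var h14 (by omega)
  have e15 : Ev w v M (eVar 15) j 1 := Ev.var h15 (by omega)
  have e0 : Ev w v M (eLit 0) 0 1 := Ev.lit (by positivity)
  have e1 : Ev w v M (eLit 1) 1 1 := Ev.lit (Nat.one_lt_two_pow (by omega))
  have hbit := Ev.bit hv hM hw e15 e14 (by omega : j ≤ 3 * k + 3)
  have hany : Ev w v M (eLt (eLit 0) (eSum 10 (eVar 1) (eOp .mul
      (eCell (eOp .sub (eVar 14) (ePow (eVar 15))) (eVar 10)) (eLink (eVar 15) (eVar 10)))))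
      (tv (∃ i < L.length, M (d + ((m - 2 ^ j) * L.length + i)) = 1 ∧ Link adj L k j i))
      (1 + L.length * (50 + 3) + 9) := by
    refine Ev.anyTv hw0 (Ev.var (hv.hc.trans hc) (by omega)) (by omega) ?_
    intro i hi
    have hv' := hv.update (r := 10) (x := i) le_rfl (by omega)
    have e10 : Ev w (Function.update v 10 i) M (eVar 10) i 1 := Ev.var (by simp) (by omega)
    have e14' : Ev w (Function.update v 10 i) M (eVar 14) m 1 := Ev.var (by simp [h14]) (by omega)
    have e15' : Ev w (Function.update v 10 i) M (eVar 15) j 1 := Ev.var (by simp [h15]) (by omega)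
    subst hc
    exact (Ev.mulTv hw0 (Ev.cell (by simp [hv7]) hv'.hc hd hMd
      (Ev.sub e14' (Ev.pow hv' hM hw e15' (by omega))) e10 ((Nat.sub_le _ _).trans_lt hm) hi)
      (Ev.link hv' hM hw hL hLn hk e15' e10 hj hi)).congr rfl (by omega)
  exact (Ev.orTv hw1 (Ev.mulTv hw0 (Ev.eqTv hw0 e14 e1) (Ev.eqTv hw0 e15 e0))
    (Ev.mulTv hw0 (Ev.ltTv hw0 e0 e15) (Ev.mulTv hw0 hbit hany))).congr rfl (by omega)

/-- Fill the table. Variable `7` contains its address, and variable `8` its length. -/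
def fillTable : Prog :=
  forLoop 9 8 (.seq (assign 14 (eOp .div (eVar 9) (eVar 1)))
    (.seq (assign 15 (eOp .sub (eVar 9) (eOp .mul (eVar 14) (eVar 1))))
      (write (eOp .add (eVar 7) (eVar 9)) eStep)))

theorem Tables.congr (h : Tables n k p adj L M) (hL : L.length ≤ n) (hp : n * n + n ≤ p)
    (hM : ∀ a, a ≤ p + (3 * k + 3) → M' a = M a) : Tables n k p adj L M' where
  edge i hi j hj := by
    have := mul_add_lt_mul_self hi hj
    rw [hM _ (by omega), h.edge i hi j hj]
  list i hi := by rw [hM _ (by omega), h.list i hi]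
  pow i hi := by rw [hM _ (by omega), h.pow i hi]

/-- The table is filled by increasing mask, and any `D` obeying the recursion is computed; `PathOn`
is substituted later. The position `t` encodes the mask `t / c` and the end vertex `t % c`. -/
theorem Cm.fillTable {d : ℕ} {D : ℕ → ℕ → Prop} (hv : Vars n c k p v) (hc : c = L.length)
    (hM : Tables n k p adj L M) (hw : Room w n k p) (hL : ∀ x ∈ L, x < n) (hLn : L.length ≤ n)
    (hk : k ≤ L.length) (hk3 : L.length ≤ 3 * k + 3) (hv7 : v 7 = d) (hv8 : v 8 = 2 ^ c * c)
    (hpd : p + (3 * k + 3) < d) (hpn : n * n + n ≤ p)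
    (hd : d + 2 ^ c * c < 2 ^ w) (hMd : ∀ a, d ≤ a → M a = 0)
    (hD : ∀ m < 2 ^ c, ∀ j < c, D m j ↔ (m = 1 ∧ j = 0) ∨ (0 < j ∧ m.testBit j = true ∧
      ∃ i < c, D (m - 2 ^ j) i ∧ Link adj L k j i)) :
    Cm w fillTable (2 ^ c * c * (c * 60 + 80) + 2) v M fun v' M' =>
      Vars n c k p v' ∧ v' 7 = d ∧ Tables n k p adj L M' ∧ (∀ a, d ≤ a → M' a ≤ 1) ∧
        ∀ m < 2 ^ c, ∀ j < c, M' (d + (m * c + j)) = tv (D m j) := by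
  have h1 := hw.addr
  have h2 := hw.set
  have h4 : n ≤ n * n := Nat.le_mul_self n
  have hcp : 2 ^ c ≤ 2 ^ (3 * k + 3) := Nat.pow_le_pow_right (by norm_num) (by omega)
  refine (Cm.of_forLoop (n := 2 ^ c * c) (T := c * 60 + 78) (I := fun t v' M' =>
    v' 9 = t ∧ v' 8 = 2 ^ c * c ∧ Vars n c k p v' ∧ v' 7 = d ∧ (∀ a < d, M' a = M a) ∧
      (∀ a, d + t ≤ a → M' a = 0) ∧
      ∀ m, ∀ j < c, m * c + j < t → M' (d + (m * c + j)) = tv (D m j)) (by omega) ?_ ?_ ?_).mono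
    (by ring_nf; omega) ?_
  · rintro t v' M' ⟨h, h', -⟩
    exact ⟨h, h'⟩
  · refine ⟨by simp, by simp [hv8], ?_, by simp [hv7], fun _ _ => rfl, fun a ha => hMd a (by omega),
      fun _ _ _ h => by omega⟩
    exact ⟨by simp [hv.hn], by simp [hv.hc], by simp [hv.hk], by simp [hv.hp], by simp [hv.hq],
      fun r hr => by rw [Function.update_of_ne (by omega)]; exact hv.scratch r hr⟩
  · rintro t ht v' M' ⟨h9, h8, hv', h7, hlow, hhigh, htab⟩
    have hc0 : 0 < c := by
      rcases Nat.eq_zero_or_pos c with rfl | h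
      · simp at ht
      · exact h
    have hdm := Nat.div_add_mod t c
    have hmod := Nat.mod_lt t hc0
    have hm : t / c < 2 ^ c := by
      rw [Nat.div_lt_iff_lt_mul hc0]; exact ht
    have hmc : t / c * c = c * (t / c) := mul_comm _ _
    have hpos : 0 < 2 ^ (3 * k + 3) := by positivity
    set m := t / c
    set j := t % c
    have e9 : Ev w v' M' (eVar 9) t 1 := Ev.var h9 (by omega)
    have e1 : Ev w v' M' (eVar 1) c 1 := Ev.var hv'.hc (by omega)
    have c1 : Cm w (assign 14 (eOp .div (eVar 9) (eVar 1))) 4 v' M'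
        (fun v'' M'' => v'' = Function.update v' 14 m ∧ M'' = M') :=
      (Cm.of_assign (x := m) (Ev.div e9 e1) ⟨rfl, rfl⟩).mono (by omega) fun _ _ h => h
    have hv'' := hv'.update (r := 14) (x := m) (by omega) (by omega)
    set v₁ := Function.update v' 14 m with hv₁
    have c2 : Cm w (assign 15 (eOp .sub (eVar 9) (eOp .mul (eVar 14) (eVar 1)))) 6 v₁ M'
        (fun v'' M'' => v'' = Function.update v₁ 15 j ∧ M'' = M') := by
      refine (Cm.of_assign (x := j) ((Ev.sub (Ev.var (x := t) (by simp [hv₁, h9]) (by omega))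
        (Ev.mul (Ev.var (x := m) (by simp [hv₁]) (by omega)) (Ev.var hv''.hc (by omega))
        (by omega))).congr (by omega) le_rfl) ⟨rfl, rfl⟩).mono (by omega) fun _ _ h => h
    have hv''' := hv''.update (r := 15) (x := j) (by omega) (by omega)
    set v₂ := Function.update v₁ 15 j with hv₂
    have hM' : Tables n k p adj L M' := hM.congr hLn hpn fun a ha => hlow a (by omega)
    have hle : ∀ a, d ≤ a → M' a ≤ 1 := by
      intro a ha
      by_cases hat : d + t ≤ a
      · rw [hhigh a hat]; omega
      · have hdm' := Nat.div_add_mod (a - d) c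
        have hmc' : (a - d) / c * c = c * ((a - d) / c) := mul_comm _ _
        have := htab ((a - d) / c) ((a - d) % c) (Nat.mod_lt _ hc0) (by omega)
        rw [show d + ((a - d) / c * c + (a - d) % c) = a by omega] at this
        rw [this]
        exact tv_le _
    have hstep := Ev.step hv''' hc hM' hw hL hLn hk hk3 (d := d) (m := m) (j := j)
      (by simp [hv₂, hv₁, h7]) hd hle (by simp [hv₂, hv₁]) (by simp [hv₂]) hm hmod
    have hval : tv (Step adj L k (fun t => M' (d + t)) m j) = tv (D m j) := by
      refine tv_congr ?_
      rw [hD m hm j hmod, Step, ← hc]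
      refine or_congr Iff.rfl (and_congr Iff.rfl ?_)
      refine and_congr_right fun hbit => exists_congr fun i => and_congr_right fun hi => ?_
      refine and_congr_left fun _ => ?_
      -- A set bit makes `m - 2 ^ j` a smaller mask, so its whole row precedes position `t` and is
      -- already correct.
      have hpow : 2 ^ j ≤ m := Nat.ge_two_pow_of_testBit hbit
      have hpos : 0 < 2 ^ j := by positivity
      have hlt : (m - 2 ^ j + 1) * c ≤ m * c := Nat.mul_le_mul_right c (by omega)
      rw [Nat.succ_mul] at hlt
      rw [htab (m - 2 ^ j) i hi (by omega)]
      unfold tv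
      split_ifs with h <;> simp [h]
    refine (c1.seq (T₂ := 6 + (c * 60 + 64)) ?_).mono (by omega) fun _ _ h => h
    rintro _ _ ⟨rfl, rfl⟩
    refine c2.seq ?_
    rintro _ _ ⟨rfl, rfl⟩
    refine (Cm.of_write (x := d + t) (y := tv (D m j)) (Ev.add (Ev.var (x := d) (by simp [hv₂, hv₁, h7])
      (by omega)) (Ev.var (x := t) (by simp [hv₂, hv₁, h9]) (by omega)) (by omega))
      (hstep.congr hval le_rfl) ?_).mono (by omega) fun _ _ h => h
    refine ⟨by simp [hv₂, hv₁, h9], by simp, by simp [hv₂, hv₁, h8], ?_, by simp [hv₂, hv₁, h7],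
      ?_, ?_, ?_⟩
    · exact ⟨by simp [hv'''.hn], by simp [hv'''.hc], by simp [hv'''.hk], by simp [hv'''.hp],
        by simp [hv'''.hq],
        fun r hr => by rw [Function.update_of_ne (by omega)]; exact hv'''.scratch r hr⟩
    · intro a ha
      rw [Function.update_of_ne (by omega), hlow a ha]
    · intro a ha
      rw [Function.update_of_ne (by omega), hhigh a (by omega)]
    · intro m' j' hj' hlt
      rcases Nat.lt_succ_iff_lt_or_eq.1 hlt with h | h
      · rw [Function.update_of_ne (by omega), htab m' j' hj' h]
      · rw [h, Function.update_self]
        have e1 : m' = m := by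
          have : (m' * c + j') / c = m' := by
            rw [add_comm, Nat.add_mul_div_right _ _ hc0, Nat.div_eq_of_lt hj', zero_add]
          rw [← this, h]
        have e2 : j' = j := by
          have : (m' * c + j') % c = j' := by
            rw [add_comm, Nat.add_mul_mod_self_right, Nat.mod_eq_of_lt hj']
          rw [← this, h]
        rw [e1, e2]
  · rintro v' M' ⟨-, -, hv', h7, hlow, hhigh, htab⟩
    have hin : ∀ m < 2 ^ c, ∀ j < c, m * c + j < 2 ^ c * c := by
      intro m hm j hj
      have := Nat.mul_le_mul_right c (show m + 1 ≤ 2 ^ c from hm)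
      rw [Nat.succ_mul] at this
      omega
    refine ⟨hv', h7, hM.congr hLn hpn fun a ha => hlow a (by omega), ?_,
      fun m hm j hj => htab m j hj (hin m hm j hj)⟩
    intro a ha
    by_cases hat : d + 2 ^ c * c ≤ a
    · rw [hhigh a hat]; omega
    · have hc0 : 0 < c := by
        rcases Nat.eq_zero_or_pos c with rfl | h
        · simp at hat; omega
        · exact h
      have hdm' := Nat.div_add_mod (a - d) c
      have hmc' : (a - d) / c * c = c * ((a - d) / c) := mul_comm _ _
      have := htab ((a - d) / c) ((a - d) % c) (Nat.mod_lt _ hc0) (by omega)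
      rw [show d + ((a - d) / c * c + (a - d) % c) = a by omega] at this
      rw [this]
      exact tv_le _

end WordRAM

/-! ### Paths through sets of numbers given by bit masks -/

/-- Subtracting a bit that is set causes no borrow: it clears that bit only. -/
theorem Nat.testBit_sub_two_pow {m j : ℕ} (h : m.testBit j = true) (i : ℕ) :
    (m - 2 ^ j).testBit i = true ↔ i ≠ j ∧ m.testBit i = true := by
  induction j generalizing m i with
  | zero =>
    have hm : m % 2 = 1 := by simpa [Nat.testBit_eq_decide_div_mod_eq] using h
    rcases i with _ | i
    · simp only [Nat.testBit_eq_decide_div_mod_eq, pow_zero, Nat.div_one]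
      simp
      omega
    · rw [Nat.testBit_add_one, Nat.testBit_add_one, show (m - 2 ^ 0) / 2 = m / 2 by omega]
      simp
  | succ j ih =>
    rw [Nat.testBit_add_one] at h
    have hp : 2 ^ (j + 1) = 2 * 2 ^ j := by ring
    rcases i with _ | i
    · simp only [Nat.testBit_eq_decide_div_mod_eq, pow_zero, Nat.div_one, hp]
      have := Nat.ge_two_pow_of_testBit h
      simp
      omega
    · rw [Nat.testBit_add_one, Nat.testBit_add_one, hp,
        show (m - 2 * 2 ^ j) / 2 = m / 2 - 2 ^ j by omega, ih h]
      simp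

/-- There is a path from `0` to `j` through exactly the elements of the set with the bit mask `m`. -/
def PathOn (h : ℕ → ℕ → Prop) (m j : ℕ) : Prop :=
  ∃ l : List ℕ, List.IsChain h (j :: l) ∧ (j :: l).Nodup ∧ (j :: l).getLast? = some 0 ∧
    ∀ i, i ∈ j :: l ↔ m.testBit i = true

/-- Remove the end vertex `j` from a path: what remains is a path through the other vertices that
ends in a neighbour of `j`. The bound on `m` only serves to place that neighbour below `c`. -/
theorem pathOn_iff {h : ℕ → ℕ → Prop} {c m j : ℕ} (hm : m < 2 ^ c) :
    PathOn h m j ↔ (m = 1 ∧ j = 0) ∨ (0 < j ∧ m.testBit j = true ∧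
      ∃ i < c, PathOn h (m - 2 ^ j) i ∧ h j i) := by
  constructor
  · rintro ⟨l, h1, h2, h3, h4⟩
    have hj : m.testBit j = true := (h4 j).1 (by simp)
    rcases l with _ | ⟨i, l⟩
    · left
      simp only [List.getLast?_singleton, Option.some.injEq] at h3
      refine ⟨Nat.eq_of_testBit_eq fun i => ?_, h3⟩
      have := h4 i
      simp only [List.mem_singleton] at this
      rw [Bool.eq_iff_iff, ← this, Nat.testBit_one_eq_true_iff_self_eq_zero, h3]
    · right
      have hj0 : j ≠ 0 := by
        rintro rfl
        rw [List.getLast?_cons_cons] at h3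
        exact (List.nodup_cons.1 h2).1 (List.mem_of_mem_getLast? h3)
      refine ⟨by omega, hj, i, ?_, ⟨l, h1.of_cons, h2.of_cons, ?_, ?_⟩, h1.rel⟩
      · have hi : m.testBit i = true := (h4 i).1 (by simp)
        by_contra hcon
        rw [Nat.testBit_lt_two_pow (hm.trans_le (Nat.pow_le_pow_right (by norm_num)
          (not_lt.1 hcon)))] at hi
        exact absurd hi (by simp)
      · rwa [List.getLast?_cons_cons] at h3
      · intro x
        rw [Nat.testBit_sub_two_pow hj, ← h4]
        have := (List.nodup_cons.1 h2).1
        constructor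
        · intro hx
          exact ⟨fun hxj => this (hxj ▸ hx), List.mem_cons_of_mem _ hx⟩
        · rintro ⟨hxj, hx⟩
          exact (List.mem_cons.1 hx).resolve_left hxj
  · rintro (⟨rfl, rfl⟩ | ⟨hj, hb, i, -, ⟨l, h1, h2, h3, h4⟩, h5⟩)
    · refine ⟨[], List.isChain_singleton _, by simp, rfl, fun i => ?_⟩
      rw [Nat.testBit_one_eq_true_iff_self_eq_zero, List.mem_singleton]
    · refine ⟨i :: l, List.IsChain.cons_cons h5 h1, ?_, ?_, ?_⟩
      · rw [List.nodup_cons, h4, Nat.testBit_sub_two_pow hb]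
        exact ⟨fun h => h.1 rfl, h2⟩
      · rw [List.getLast?_cons_cons, h3]
      · intro x
        rw [List.mem_cons, h4, Nat.testBit_sub_two_pow hb]
        by_cases hx : x = j
        · simp [hx, hb]
        · simp [hx]

/-- Cut the cycle at `0`. The part after `0`, closed by the return to `0`, is a path through all
vertices, and the step from `0` to its first vertex is the remaining edge. -/
theorem hamOn_range_iff {h : ℕ → ℕ → Prop} {c : ℕ} (hc : 0 < c) :
    HamOn h (Finset.range c) ↔ ∃ i < c, PathOn h (2 ^ c - 1) i ∧ h 0 i := by
  have hbit : ∀ i, (2 ^ c - 1).testBit i = true ↔ i < c := by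
    intro i
    rw [Nat.testBit_two_pow_sub_one, decide_eq_true_eq]
  constructor
  · intro hH
    obtain ⟨t, h1, h2, h3⟩ := hH.exists_cons (a := 0) (Finset.mem_range.2 hc)
    have hperm : (t ++ [0]).Perm (0 :: t) := List.perm_append_singleton _ _
    rcases ht : t ++ [0] with _ | ⟨j, l⟩
    · simp at ht
    rw [ht] at h3 hperm
    have hmem : ∀ i, i ∈ j :: l ↔ i < c := fun i => by
      rw [hperm.mem_iff, h2, Finset.mem_range]
    refine ⟨j, (hmem j).1 (by simp), ⟨l, h3.of_cons, hperm.nodup_iff.2 h1, ?_, fun i => ?_⟩, h3.rel⟩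
    · rw [← ht, List.getLast?_concat]
    · rw [hmem, hbit]
  · rintro ⟨j, -, ⟨l, h1, h2, h3, h4⟩, h5⟩
    obtain ⟨t, ht⟩ : ∃ t, j :: l = t ++ [0] := by
      have := List.dropLast_append_getLast? 0 h3
      exact ⟨_, this.symm⟩
    have hperm : (t ++ [0]).Perm (0 :: t) := List.perm_append_singleton _ _
    rw [ht] at h1 h2 h4
    refine HamOn.of_cons (a := 0) (t := t) (hperm.nodup_iff.1 h2) (fun x => ?_) ?_
    · rw [← hperm.mem_iff, h4, hbit, Finset.mem_range]
    · refine List.IsChain.cons h1 fun y hy => ?_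
      rw [← ht] at hy
      simp only [List.head?_cons, Option.mem_def, Option.some.injEq] at hy
      exact hy ▸ h5

theorem HamOn.image {α β : Type*} [DecidableEq β] {r : α → α → Prop} {r' : β → β → Prop}
    {A : Finset α} {f : α → β} (hf : ∀ x ∈ A, ∀ y ∈ A, f x = f y → x = y)
    (hr : ∀ x ∈ A, ∀ y ∈ A, r x y → r' (f x) (f y)) (h : HamOn r A) : HamOn r' (A.image f) := by
  obtain ⟨l, h1, h2, h3⟩ := h
  refine ⟨l.map f, h1.map_on fun x hx y hy => hf x ((h2 x).1 hx) y ((h2 y).1 hy), ?_, ?_⟩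
  · intro y
    simp [h2]
  · rw [← Cycle.map_coe, Cycle.chain_map]
    rcases l with _ | ⟨a, l⟩
    · exact Cycle.Chain.nil _
    · rw [Cycle.chain_coe_cons] at h3 ⊢
      have hmem : ∀ x ∈ a :: (l ++ [a]), x ∈ A := by
        intro x hx
        rw [← h2 x]
        simp only [List.mem_cons, List.mem_append, List.not_mem_nil, or_false] at hx ⊢
        tauto
      exact h3.imp_of_mem_imp fun x y hx hy hxy => hr x (hmem x hx) y (hmem y hy) hxy

namespace WordRAM

/-! ### Correctness of the choice of vertices -/

variable {adj : ℕ → ℕ → Prop} {n k x m : ℕ} {L S₀ Y : List ℕ} {T : Finset ℕ}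

/-! ### Sums of truth values as cardinalities, and bit masks as subsets of the low vertices. -/

theorem sum_tv_getD {P : ℕ → Prop} [DecidablePred P] (hL : L.Nodup) :
    ∑ i ∈ Finset.range L.length, tv (P (L.getD i 0)) = (L.toFinset.filter P).card := by
  induction L with
  | nil => simp
  | cons a L ih =>
    rw [List.length_cons, Finset.sum_range_succ']
    simp only [List.getD_cons_succ, List.getD_cons_zero]
    rw [ih hL.of_cons, List.toFinset_cons, Finset.filter_insert]
    have ha : a ∉ L.toFinset.filter P := by
      simp [(List.nodup_cons.1 hL).1]
    split_ifs with hP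
    · rw [Finset.card_insert_of_notMem ha, tv_true hP]
    · rw [tv_false hP, add_zero]

theorem sum_tv_eq_card (P : ℕ → Prop) [DecidablePred P] (n : ℕ) :
    ∑ i ∈ Finset.range n, tv (P i) = ((Finset.range n).filter P).card := by
  rw [Finset.card_filter]
  exact Finset.sum_congr rfl fun i _ => tv_eq_ite _

theorem forall_mem_iff_getD {P : ℕ → Prop} : (∀ s ∈ L, P s) ↔ ∀ i < L.length, P (L.getD i 0) := by
  constructor
  · intro h i hi
    refine h _ ?_
    rw [List.getD_eq_getElem _ _ hi]
    exact List.getElem_mem _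
  · intro h s hs
    obtain ⟨i, hi, rfl⟩ := List.getElem_of_mem hs
    have := h i hi
    rwa [List.getD_eq_getElem _ _ hi] at this

/-- The bit mask `m` describes the subset `T` of the list `S₀`. -/
def Mask (S₀ : List ℕ) (m : ℕ) (T : Finset ℕ) : Prop :=
  T ⊆ S₀.toFinset ∧ ∀ i < S₀.length, m.testBit i = true ↔ S₀.getD i 0 ∈ T

theorem exists_mask (hT : T ⊆ S₀.toFinset) : ∃ m < 2 ^ S₀.length, Mask S₀ m T := by
  refine ⟨Nat.ofBits fun i : Fin S₀.length => decide (S₀.getD i 0 ∈ T), Nat.ofBits_lt_two_pow _, hT,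
    fun i hi => ?_⟩
  rw [Nat.testBit_ofBits_lt _ _ hi, decide_eq_true_eq]

open Classical in
-- `Mask` reads only the first `S₀.length` bits, so every number describes a set; distinctness of
-- the entries makes the set well determined by positions.
theorem exists_set (hS : S₀.Nodup) (m : ℕ) : ∃ T, Mask S₀ m T := by
  refine ⟨S₀.toFinset.filter fun s => m.testBit (S₀.idxOf s) = true, Finset.filter_subset _ _,
    fun i hi => ?_⟩
  rw [Finset.mem_filter, List.getD_eq_getElem _ _ hi, hS.idxOf_getElem, List.mem_toFinset]
  exact ⟨fun h => ⟨List.getElem_mem _, h⟩, fun h => h.2⟩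

theorem Mask.conf (h : Mask S₀ m T) :
    Conf adj (S₀ ++ Y) S₀.length x m ↔ ∀ s ∈ S₀.toFinset, adj s x → s ∈ T := by
  simp only [List.mem_toFinset]
  rw [forall_mem_iff_getD (P := fun s => adj s x → s ∈ T), Conf]
  refine forall_congr' fun i => forall_congr' fun hi => ?_
  rw [List.getD_append _ _ _ _ hi, h.2 i hi]
  tauto

theorem Mask.bitCard (h : Mask S₀ m T) (hS : S₀.Nodup) : bitCard S₀.length m = T.card := by
  have h1 : WordRAM.bitCard S₀.length m = ∑ i ∈ Finset.range S₀.length, tv (S₀.getD i 0 ∈ T) :=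
    Finset.sum_congr rfl fun i hi => tv_congr (h.2 i (Finset.mem_range.1 hi))
  rw [h1, sum_tv_getD hS (P := fun s => s ∈ T)]
  congr 1
  ext s
  rw [Finset.mem_filter]
  exact ⟨fun h => h.2, fun hs => ⟨h.1 hs, hs⟩⟩

theorem Mask.confCard (h : Mask S₀ m T) (hY : Y.Nodup) :
    confCard adj (S₀ ++ Y) S₀.length m = (confined adj S₀.toFinset Y.toFinset T).card := by
  classical
  have h1 : WordRAM.confCard adj (S₀ ++ Y) S₀.length m = ∑ j ∈ Finset.range Y.length,
      tv (∀ s ∈ S₀.toFinset, adj s (Y.getD j 0) → s ∈ T) := by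
    rw [WordRAM.confCard, List.length_append, Nat.add_sub_cancel_left]
    refine Finset.sum_congr rfl fun j _ => tv_congr ?_
    rw [h.conf, List.getD_append_right _ _ _ _ (Nat.le_add_right _ _), Nat.add_sub_cancel_left]
  rw [h1, sum_tv_getD hY (P := fun y => ∀ s ∈ S₀.toFinset, adj s y → s ∈ T)]
  congr 1
  ext y
  simp [mem_confined]

/-- The vertex `x` is confined to a tight set. -/
def Blocked (adj : ℕ → ℕ → Prop) (S₀ Y : List ℕ) (x : ℕ) : Prop :=
  ∃ T ⊆ S₀.toFinset, (confined adj S₀.toFinset Y.toFinset T).card = 2 * T.card ∧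
    ∀ s ∈ S₀.toFinset, adj s x → s ∈ T

/-- The search over masks is a search over all subsets of the low vertices, since every subset has a
mask in range and every mask describes a subset. -/
theorem free_iff (h : (S₀ ++ Y).Nodup) :
    Free adj (S₀ ++ Y) S₀.length x ↔ x ∉ S₀ ++ Y ∧ ¬ Blocked adj S₀ Y x := by
  rw [List.nodup_append] at h
  refine and_congr_right fun _ => ?_
  constructor
  · rintro hfree ⟨T, hT, htight, hx⟩
    obtain ⟨m, hm, hmask⟩ := exists_mask hT
    refine hfree m hm ⟨hmask.conf.2 hx, ?_⟩
    rw [hmask.confCard h.2.1, hmask.bitCard h.1, htight]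
  · rintro hb m hm ⟨h1, h2⟩
    obtain ⟨T, hmask⟩ := exists_set h.1 m
    rw [hmask.confCard h.2.1, hmask.bitCard h.1] at h2
    exact hb ⟨T, hmask.1, h2, hmask.conf.1 h1⟩

/-- The vertex `x` has degree less than `n / 2`. -/
def Low (adj : ℕ → ℕ → Prop) (n x : ℕ) : Prop := 2 * rowCard adj n x < n

/-- The list contains the vertices of low degree up to `i`. -/
def LowList (adj : ℕ → ℕ → Prop) (n i : ℕ) (L : List ℕ) : Prop :=
  L.Nodup ∧ ∀ x, x ∈ L ↔ x < i ∧ Low adj n x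

theorem LowList.step {i : ℕ} (h : LowList adj n i L) :
    (Low adj n i → LowList adj n (i + 1) (L ++ [i])) ∧
      (¬ Low adj n i → LowList adj n (i + 1) L) := by
  constructor
  · intro hi
    refine ⟨?_, fun x => ?_⟩
    · rw [List.nodup_append_comm, List.singleton_append, List.nodup_cons, h.2]
      exact ⟨fun h => absurd h.1 (lt_irrefl i), h.1⟩
    · rw [List.mem_append, List.mem_singleton, h.2, Nat.lt_succ_iff_lt_or_eq]
      constructor
      · rintro (h | rfl)
        exacts [⟨Or.inl h.1, h.2⟩, ⟨Or.inr rfl, hi⟩]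
      · rintro ⟨h | h, h'⟩
        exacts [Or.inl ⟨h, h'⟩, Or.inr h]
  · intro hi
    refine ⟨h.1, fun x => ?_⟩
    rw [h.2, Nat.lt_succ_iff_lt_or_eq]
    constructor
    · rintro ⟨h, h'⟩
      exact ⟨Or.inl h, h'⟩
    · rintro ⟨h | rfl, h'⟩
      exacts [⟨h, h'⟩, absurd h' hi]

/-- The list of vertices chosen from those of high degree up to `i`. -/
structure Greedy (adj : ℕ → ℕ → Prop) (n : ℕ) (S₀ : List ℕ) (i : ℕ) (Y : List ℕ) : Prop where
  nodup : (S₀ ++ Y).Nodup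
  high : ∀ x ∈ Y, x < n ∧ ¬ Low adj n x
  ind : ∀ T ⊆ S₀.toFinset, (confined adj S₀.toFinset Y.toFinset T).card ≤ 2 * T.card
  blocked : ∀ x < i, x ∉ S₀ ++ Y → Blocked adj S₀ Y x

/-- Every vertex of `Y` is confined to the set of all low vertices, so this is the case `T = S₀` of
Hall's condition. -/
theorem Greedy.length_le {i : ℕ} (h : Greedy adj n S₀ i Y) : Y.length ≤ 2 * S₀.length := by
  have h1 := h.ind S₀.toFinset (Finset.Subset.refl _)
  have h2 := List.nodup_append.1 h.nodup
  have h3 : confined adj S₀.toFinset Y.toFinset S₀.toFinset = Y.toFinset := by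
    ext y
    rw [mem_confined]
    exact ⟨fun h => h.1, fun h => ⟨h, fun s hs _ => hs⟩⟩
  rwa [h3, List.toFinset_card_of_nodup h2.2.1, List.toFinset_card_of_nodup h2.1] at h1

/-- A new vertex adds at most one to the count for the sets to which it is confined. If it is not
blocked, none of these is tight, so Hall's condition survives. -/
theorem Greedy.step {i : ℕ} (hi : i < n) (hS : LowList adj n n S₀) (h : Greedy adj n S₀ i Y) :
    (i ∉ S₀ ++ Y ∧ ¬ Blocked adj S₀ Y i → Greedy adj n S₀ (i + 1) (Y ++ [i])) ∧
      (¬ (i ∉ S₀ ++ Y ∧ ¬ Blocked adj S₀ Y i) → Greedy adj n S₀ (i + 1) Y) := by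
  classical
  constructor
  · rintro ⟨hiL, hb⟩
    have hins : (Y ++ [i]).toFinset = insert i Y.toFinset := by
      ext x
      simp
    have hiY : i ∉ Y := fun h => hiL (List.mem_append_right _ h)
    have hind : ∀ T ⊆ S₀.toFinset,
        (confined adj S₀.toFinset (Y ++ [i]).toFinset T).card ≤ 2 * T.card := by
      intro T hT
      have h1 := h.ind T hT
      by_cases hc : ∀ s ∈ S₀.toFinset, adj s i → s ∈ T
      · have h2 : (confined adj S₀.toFinset Y.toFinset T).card ≠ 2 * T.card :=
          fun h2 => hb ⟨T, hT, h2, hc⟩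
        have h3 : confined adj S₀.toFinset (Y ++ [i]).toFinset T ⊆
            insert i (confined adj S₀.toFinset Y.toFinset T) := by
          intro y hy
          rw [mem_confined, hins, Finset.mem_insert] at hy
          rw [Finset.mem_insert, mem_confined]
          tauto
        have h4 := (Finset.card_le_card h3).trans (Finset.card_insert_le _ _)
        omega
      · refine le_trans (Finset.card_le_card ?_) h1
        intro y hy
        rw [mem_confined, hins, Finset.mem_insert] at hy
        rw [mem_confined]
        refine ⟨hy.1.resolve_left ?_, hy.2⟩
        rintro rfl
        exact hc hy.2
    refine ⟨?_, ?_, hind, ?_⟩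
    · rw [← List.append_assoc, List.nodup_append_comm, List.singleton_append, List.nodup_cons]
      exact ⟨hiL, h.nodup⟩
    · intro x hx
      rcases List.mem_append.1 hx with hx | hx
      · exact h.high x hx
      · rw [List.mem_singleton] at hx
        subst hx
        exact ⟨hi, fun hl => hiL (List.mem_append_left _ ((hS.2 x).2 ⟨hi, hl⟩))⟩
    · intro x hx hxL
      rw [← List.append_assoc, List.mem_append, List.mem_singleton, not_or] at hxL
      obtain ⟨T, hT, h1, h2⟩ := h.blocked x (by omega) hxL.1
      -- Once tight, a set stays tight: the count cannot shrink as `Y` grows, and Hall's condition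
      -- keeps it from exceeding `2|T|`. Rejected vertices therefore remain blocked.
      refine ⟨T, hT, le_antisymm (hind T hT) ?_, h2⟩
      rw [← h1]
      refine Finset.card_le_card fun y hy => ?_
      rw [mem_confined] at hy ⊢
      rw [hins]
      exact ⟨Finset.mem_insert_of_mem hy.1, hy.2⟩
  · intro hcon
    refine ⟨h.nodup, h.high, h.ind, fun x hx hxL => ?_⟩
    rcases Nat.lt_succ_iff_lt_or_eq.1 hx with hx | rfl
    · exact h.blocked x hx hxL
    · by_contra hb
      exact hcon ⟨hxL, hb⟩

/-- The list of chosen vertices after padding. -/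
structure Padded (adj : ℕ → ℕ → Prop) (n : ℕ) (S₀ Y : List ℕ) (i : ℕ) (Z : List ℕ) : Prop where
  nodup : (S₀ ++ Y ++ Z).Nodup
  high : ∀ x ∈ Z, x < n ∧ ¬ Low adj n x
  length_le : (S₀ ++ Y ++ Z).length ≤ 3 * S₀.length + 3
  full : (∀ x < i, x ∈ S₀ ++ Y ++ Z) ∨ 3 * S₀.length + 3 ≤ (S₀ ++ Y ++ Z).length

theorem Padded.step {i : ℕ} {Z : List ℕ} (hi : i < n) (hS : LowList adj n n S₀)
    (h : Padded adj n S₀ Y i Z) :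
    (i ∉ S₀ ++ Y ++ Z ∧ (S₀ ++ Y ++ Z).length < 3 * S₀.length + 3 →
        Padded adj n S₀ Y (i + 1) (Z ++ [i])) ∧
      (¬ (i ∉ S₀ ++ Y ++ Z ∧ (S₀ ++ Y ++ Z).length < 3 * S₀.length + 3) →
        Padded adj n S₀ Y (i + 1) Z) := by
  constructor
  · rintro ⟨hiL, hlen⟩
    refine ⟨?_, ?_, ?_, ?_⟩
    · rw [← List.append_assoc, List.nodup_append_comm, List.singleton_append, List.nodup_cons]
      exact ⟨hiL, h.nodup⟩
    · intro x hx
      rcases List.mem_append.1 hx with hx | hx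
      · exact h.high x hx
      · rw [List.mem_singleton] at hx
        subst hx
        refine ⟨hi, fun hl => hiL ?_⟩
        exact List.mem_append_left _ (List.mem_append_left _ ((hS.2 x).2 ⟨hi, hl⟩))
    · rw [← List.append_assoc, List.length_append, List.length_singleton]
      omega
    · left
      intro x hx
      rw [← List.append_assoc, List.mem_append, List.mem_singleton]
      rcases Nat.lt_succ_iff_lt_or_eq.1 hx with hx | rfl
      · exact Or.inl (h.full.resolve_right (by omega) x hx)
      · exact Or.inr rfl
  · intro hcon
    refine ⟨h.nodup, h.high, h.length_le, ?_⟩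
    rcases h.full with hf | hf
    · by_cases hlen : 3 * S₀.length + 3 ≤ (S₀ ++ Y ++ Z).length
      · exact Or.inr hlen
      · left
        intro x hx
        rcases Nat.lt_succ_iff_lt_or_eq.1 hx with hx | rfl
        · exact hf x hx
        · by_contra hxL
          exact hcon ⟨hxL, by omega⟩
    · exact Or.inr hf

open Classical in
theorem card_filter_not_lt {α : Type*} {p : α → Prop} {C : Finset α} {a : ℕ}
    (h1 : (C.filter fun x => ¬ p x).card ≤ a) (h2 : 2 * a < C.card) :
    (C.filter fun x => ¬ p x).card < (C.filter p).card := by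
  have := Finset.card_filter_add_card_filter_not (s := C) p
  omega

open Classical in
/-- The chosen vertices, with those of high degree joined, are Hamiltonian if and only if the graph
is. -/
theorem hamOn_chosen_iff {Z : List ℕ} (hs : ∀ x y, adj x y → adj y x) (hir : ∀ x, ¬ adj x x)
    (hn : 2 ≤ n) (hS : LowList adj n n S₀) (hY : Greedy adj n S₀ n Y)
    (hZ : Padded adj n S₀ Y n Z) :
    HamOn (fun x y => adj x y ∨ (¬ Low adj n x ∧ ¬ Low adj n y)) (S₀ ++ Y ++ Z).toFinset ↔
      HamOn adj (Finset.range n) := by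
  set hi : ℕ → Prop := fun x => ¬ Low adj n x with hhi
  set r : ℕ → ℕ → Prop := fun x y => adj x y ∨ (hi x ∧ hi y) with hr
  set B := (S₀ ++ Y ++ Z).toFinset with hB
  have hmemB : ∀ x, x ∈ B ↔ (x ∈ S₀ ∨ x ∈ Y) ∨ x ∈ Z := by
    intro x
    simp [hB, or_assoc]
  have hrs : ∀ x y, r x y → r y x := by
    rintro x y (h | h)
    exacts [Or.inl (hs _ _ h), Or.inr h.symm]
  have hBA : B ⊆ Finset.range n := by
    intro x hx
    rw [Finset.mem_range]
    rcases (hmemB x).1 hx with (hx | hx) | hx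
    exacts [((hS.2 x).1 hx).1, (hY.high x hx).1, (hZ.high x hx).1]
  have hAB : ∀ x ∈ Finset.range n, x ∉ B → hi x := by
    intro x hx hxB hl
    exact hxB ((hmemB x).2 (Or.inl (Or.inl ((hS.2 x).2 ⟨Finset.mem_range.1 hx, hl⟩))))
  have hclosure : HamOn r (Finset.range n) ↔ HamOn adj (Finset.range n) := by
    constructor
    · refine HamOn.of_closure hs hir hi ?_ (by simpa using hn)
      intro x _ hxi
      rw [Finset.card_range, ← sum_tv_eq_card]
      exact not_lt.1 hxi
    · rintro ⟨l, h1, h2, h3⟩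
      exact ⟨l, h1, h2, h3.imp fun x y h => Or.inl h⟩
  rw [← hclosure]
  have hSn := List.nodup_append.1 (List.nodup_append.1 hZ.nodup).1
  constructor
  · intro h
    -- Either every vertex was chosen and there is nothing to insert, or there are at least `3k + 3
    -- > 2k` chosen vertices, so those of the clique are in the majority.
    rcases hZ.full with hf | hf
    · have : B = Finset.range n := by
        refine Finset.Subset.antisymm hBA fun x hx => ?_
        rw [hB, List.mem_toFinset]
        exact hf x (Finset.mem_range.1 hx)
      rwa [this] at h
    · refine HamOn.extend hi (fun x y hx hy => Or.inr ⟨hx, hy⟩) hBA hAB ?_ h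
      refine card_filter_not_lt (a := S₀.length) ?_ ?_
      · rw [← List.toFinset_card_of_nodup hSn.1]
        refine Finset.card_le_card fun x hx => ?_
        simp only [Finset.mem_filter] at hx
        rw [List.mem_toFinset, hS.2]
        exact ⟨Finset.mem_range.1 (hBA hx.1), not_not.1 hx.2⟩
      · rw [hB, List.toFinset_card_of_nodup hZ.nodup]
        omega
  · intro h
    -- One tight set for all vertices outside `S₀ ++ Y`. The padding `Z` plays no part in this
    -- direction beyond enlarging `B`.
    obtain ⟨T, hT, htight, hTX⟩ := exists_tight hY.ind
      ((Finset.range n).filter fun x => x ∉ S₀ ++ Y) (fun x hx => by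
        rw [Finset.mem_filter, Finset.mem_range] at hx
        exact hY.blocked x hx.1 hx.2)
    obtain ⟨f, hf, hfi⟩ := exists_private hY.ind htight
    have hTlow : ∀ s ∈ T, s ∈ S₀ := fun s hs => List.mem_toFinset.1 (hT hs)
    have hmemS : ∀ s ∈ Finset.range n, ¬ hi s → s ∈ S₀.toFinset := fun s hs hsh =>
      List.mem_toFinset.2 ((hS.2 s).2 ⟨Finset.mem_range.1 hs, not_not.1 hsh⟩)
    refine HamOn.restrict hrs hi (fun x y hx hy => Or.inr ⟨hx, hy⟩) hBA hAB T
      (fun s hs hh => hh ((hS.2 s).1 (hTlow s hs)).2) f ?_ hfi ?_ h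
    · intro s hs b
      obtain ⟨h1, h2⟩ := hf s hs b
      rw [mem_confined, List.mem_toFinset] at h1
      refine ⟨(hmemB _).2 (Or.inl (Or.inr h1.1)), (hY.high _ h1.1).2, Or.inl h2, ?_⟩
      rintro s' hs' hs'T hs'h (h | h)
      · exact hs'T (h1.2 s' (hmemS s' hs' hs'h) h)
      · exact hs'h h.1
    · rintro x hx hxB s hsA hsh hsT (h | h)
      · refine hsT (hTX x ?_ s (hmemS s hsA hsh) h)
        rw [Finset.mem_filter, List.mem_append]
        exact ⟨hx, fun h => hxB ((hmemB x).2 (Or.inl h))⟩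
      · exact hsh h.1

/-- Passing from the chosen vertices to their indices. -/
theorem hamOn_link_iff {hi : ℕ → Prop} (hL : L.Nodup)
    (hhi : ∀ i < L.length, hi (L.getD i 0) ↔ k ≤ i) :
    HamOn (Link adj L k) (Finset.range L.length) ↔
      HamOn (fun x y => adj x y ∨ (hi x ∧ hi y)) L.toFinset := by
  have hget : ∀ i (h : i < L.length), L.getD i 0 = L[i] := fun i h => List.getD_eq_getElem _ _ h
  constructor
  · intro h
    have himg : (Finset.range L.length).image (fun i => L.getD i 0) = L.toFinset := by
      ext x
      rw [Finset.mem_image, List.mem_toFinset]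
      constructor
      · rintro ⟨i, hi, rfl⟩
        rw [hget i (Finset.mem_range.1 hi)]
        exact List.getElem_mem _
      · intro hx
        obtain ⟨i, hi, rfl⟩ := List.getElem_of_mem hx
        exact ⟨i, Finset.mem_range.2 hi, hget i hi⟩
    rw [← himg]
    refine h.image ?_ ?_
    · intro i hi j hj hij
      rw [Finset.mem_range] at hi hj
      rw [hget i hi, hget j hj] at hij
      exact (hL.getElem_inj_iff).1 hij
    · rintro i hi j hj (h | h)
      · exact Or.inl h
      · exact Or.inr ⟨(hhi i (Finset.mem_range.1 hi)).2 h.1, (hhi j (Finset.mem_range.1 hj)).2 h.2⟩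
  · intro h
    have hidx : ∀ x ∈ L.toFinset, L.idxOf x < L.length ∧ L.getD (L.idxOf x) 0 = x := by
      intro x hx
      have h1 := List.idxOf_lt_length_iff.2 (List.mem_toFinset.1 hx)
      exact ⟨h1, by rw [hget _ h1, List.getElem_idxOf]⟩
    have himg : L.toFinset.image (fun x => L.idxOf x) = Finset.range L.length := by
      ext i
      rw [Finset.mem_image, Finset.mem_range]
      constructor
      · rintro ⟨x, hx, rfl⟩
        exact (hidx x hx).1
      · intro hi
        exact ⟨L[i], List.mem_toFinset.2 (List.getElem_mem _), hL.idxOf_getElem i hi⟩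
    rw [← himg]
    refine h.image ?_ ?_
    · intro x hx y hy hxy
      rw [← (hidx x hx).2, ← (hidx y hy).2, hxy]
    · intro x hx y hy hxy
      obtain ⟨h1, h2⟩ := hidx x hx
      obtain ⟨h3, h4⟩ := hidx y hy
      rw [Link, h2, h4]
      rcases hxy with h | ⟨h, h'⟩
      · exact Or.inl h
      · exact Or.inr ⟨(hhi _ h1).1 (by rwa [h2]), (hhi _ h3).1 (by rwa [h4])⟩

end WordRAM

/-! ### The program -/

namespace WordRAM

variable {w : ℕ} {v M M' : ℕ → ℕ} {n c k p x : ℕ} {adj : ℕ → ℕ → Prop} {L S₀ Y : List ℕ}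

theorem Vars.update_low {r : ℕ} (h : Vars n c k p v) (hr : r = 3 ∨ r = 4 ∨ r = 7 ∨ r = 8 ∨ r = 9) :
    Vars n c k p (Function.update v r x) where
  hn := by rw [Function.update_of_ne (by omega), h.hn]
  hc := by rw [Function.update_of_ne (by omega), h.hc]
  hk := by rw [Function.update_of_ne (by omega), h.hk]
  hp := by rw [Function.update_of_ne (by omega), h.hp]
  hq := by rw [Function.update_of_ne (by omega), h.hq]
  scratch s hs := by rw [Function.update_of_ne (by omega)]; exact h.scratch s hs

theorem Vars.update_length {c' : ℕ} (h : Vars n c k p v) :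
    Vars n c' k p (Function.update v 1 c') where
  hn := by rw [Function.update_of_ne (by omega), h.hn]
  hc := by rw [Function.update_self]
  hk := by rw [Function.update_of_ne (by omega), h.hk]
  hp := by rw [Function.update_of_ne (by omega), h.hp]
  hq := by rw [Function.update_of_ne (by omega), h.hq]
  scratch s hs := by rw [Function.update_of_ne (by omega)]; exact h.scratch s hs

/-- The answer, read off from the table. -/
def eAnswer : ℕ → Prog :=
  eLt (eLit 0) (eOp .add (eEq (eVar 0) (eLit 1)) (eOp .mul (eLt (eLit 2) (eVar 0))
    (eLt (eLit 0) (eSum 10 (eVar 1) (eOp .mul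
      (eCell (eOp .sub (ePow (eVar 1)) (eLit 1)) (eVar 10)) (eLink (eLit 0) (eVar 10)))))))

/-- Decide whether the graph on the chosen vertices is Hamiltonian. -/
def finish : Prog :=
  .seq (assign 7 (eOp .add (eVar 5) (eOp .add (eOp .mul (eLit 3) (eVar 2)) (eLit 4))))
    (.seq (assign 8 (eOp .mul (ePow (eVar 1)) (eVar 1)))
      (.seq fillTable (assign 0 eAnswer)))

theorem Cm.finish (hv : Vars n c k p v) (hc : c = L.length) (hM : Tables n k p adj L M)
    (hw : Room w n k p) (hL : ∀ x ∈ L, x < n) (hLn : L.length ≤ n) (hk : k ≤ L.length)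
    (hk3 : L.length ≤ 3 * k + 3) (hpn : n * n + n ≤ p) (hd : p + (3 * k + 4) + 2 ^ c * c < 2 ^ w)
    (hM0 : ∀ a, p + (3 * k + 4) ≤ a → M a = 0) (hc0 : 0 < c) :
    Cm w finish (2 ^ c * c * (c * 60 + 80) + c * 60 + 100) v M fun v' _ =>
      v' 0 = tv (n = 1 ∨ (2 < n ∧ HamOn (Link adj L k) (Finset.range c))) := by
  have h1 := hw.addr
  have h2 := hw.set
  have h4 : n ≤ n * n := Nat.le_mul_self n
  have hpos : 2 ^ 3 ≤ 2 ^ (3 * k + 3) := Nat.pow_le_pow_right (by norm_num) (by omega)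
  have hcp : 2 ^ c ≤ 2 ^ (3 * k + 3) := Nat.pow_le_pow_right (by norm_num) (by omega)
  have hw1 : 1 < w := by
    by_contra hcon
    have h5 : 2 ^ w ≤ 2 ^ 1 := Nat.pow_le_pow_right (by norm_num) (by omega)
    omega
  have c1 : Cm w (assign 7 (eOp .add (eVar 5) (eOp .add (eOp .mul (eLit 3) (eVar 2)) (eLit 4)))) 8
      v M (fun v' M' => v' = Function.update v 7 (p + (3 * k + 4)) ∧ M = M') :=
    (Cm.of_assign (x := p + (3 * k + 4)) (Ev.add (Ev.var hv.hp (by omega)) (Ev.add (Ev.mul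
      (Ev.lit (by omega)) (Ev.var hv.hk (by omega)) (by omega)) (Ev.lit (by omega)) (by omega))
      (by omega)) ⟨rfl, rfl⟩).mono (by omega) fun _ _ h => h
  have hv₁ := hv.update_low (x := p + (3 * k + 4)) (r := 7) (by omega)
  have hv₁7 : Function.update v 7 (p + (3 * k + 4)) 7 = p + (3 * k + 4) := by simp
  refine (c1.seq (T₂ := 7 + (2 ^ c * c * (c * 60 + 80) + 2 + (c * 60 + 40))) ?_).mono
    (by omega) fun _ _ h => h
  rintro _ _ ⟨rfl, rfl⟩
  set v₁ := Function.update v 7 (p + (3 * k + 4)) with hv₁def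
  have c2 : Cm w (assign 8 (eOp .mul (ePow (eVar 1)) (eVar 1))) 7 v₁ M
      (fun v' M' => v' = Function.update v₁ 8 (2 ^ c * c) ∧ M = M') :=
    (Cm.of_assign (x := 2 ^ c * c) (Ev.mul (Ev.pow hv₁ hM hw (Ev.var hv₁.hc (by omega)) (by omega))
      (Ev.var hv₁.hc (by omega)) (by omega)) ⟨rfl, rfl⟩).mono (by omega) fun _ _ h => h
  refine c2.seq ?_
  rintro _ _ ⟨rfl, rfl⟩
  have hv₂ := hv₁.update_low (x := 2 ^ c * c) (r := 8) (by omega)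
  have c3 := Cm.fillTable (d := p + (3 * k + 4)) (D := PathOn (Link adj L k)) hv₂ hc hM hw hL hLn hk
    hk3 (by simp [hv₁7]) (by simp) (by omega) hpn hd hM0
    (fun m hm j _ => pathOn_iff hm)
  refine c3.seq ?_
  rintro v₃ M₃ ⟨hv₃, hv₃7, hM₃, hM₃1, htab⟩
  have hw0 := hw.pos
  have h5 := hv₃.scratch 10 le_rfl
  have e0 : Ev w v₃ M₃ (eVar 0) n 1 := Ev.var hv₃.hn (by omega)
  have hany : Ev w v₃ M₃ (eLt (eLit 0) (eSum 10 (eVar 1) (eOp .mul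
      (eCell (eOp .sub (ePow (eVar 1)) (eLit 1)) (eVar 10)) (eLink (eLit 0) (eVar 10)))))
      (tv (HamOn (Link adj L k) (Finset.range c))) (1 + c * (50 + 3) + 9) := by
    refine (Ev.anyTv (P := fun i => M₃ (p + (3 * k + 4) + ((2 ^ c - 1) * c + i)) = 1 ∧
      Link adj L k 0 i) hw0 (Ev.var hv₃.hc (by omega)) (by omega) ?_).congr (tv_congr ?_) le_rfl
    · intro i hi
      have hv' := hv₃.update (r := 10) (x := i) le_rfl (by omega)
      have e10 : Ev w (Function.update v₃ 10 i) M₃ (eVar 10) i 1 := Ev.var (by simp) (by omega)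
      have h7 : 0 < 2 ^ c := by positivity
      exact (Ev.mulTv hw0 (Ev.cell (by simp [hv₃7]) hv'.hc hd hM₃1
        (Ev.sub (Ev.pow hv' hM₃ hw (Ev.var hv'.hc (by omega)) (by omega)) (Ev.lit (by omega)))
        e10 (by omega) hi) (Ev.link hv' hM₃ hw hL hLn hk (Ev.lit (by omega)) e10 (by omega)
        (by omega))).congr rfl (by omega)
    · rw [hamOn_range_iff hc0]
      refine exists_congr fun i => and_congr_right fun hi => and_congr_left fun _ => ?_
      have h7 : 0 < 2 ^ c := by positivity
      rw [htab (2 ^ c - 1) (by omega) i hi]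
      unfold tv
      split_ifs with h <;> simp [h]
  refine (Cm.of_assign (Ev.orTv hw1 (Ev.eqTv hw0 e0 (Ev.lit (by omega))) (Ev.mulTv hw0
    (Ev.ltTv hw0 (Ev.lit (by omega)) e0) hany)) ?_).mono (by omega) fun _ _ h => h
  rw [Function.update_self]

theorem length_le_of_nodup (h : L.Nodup) (hL : ∀ x ∈ L, x < n) : L.length ≤ n := by
  rw [← List.toFinset_card_of_nodup h, ← Finset.card_range n]
  refine Finset.card_le_card fun x hx => ?_
  rw [Finset.mem_range]
  exact hL x (List.mem_toFinset.1 hx)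

theorem Tables.of_agree (hM : Tables n k p adj S₀ M) (hp : p = n * n + n + 1) (hA : Agree n M M')
    (hL : Listed n L M') : Tables n k p adj L M' where
  edge i hi j hj := by
    have := mul_add_lt_mul_self hi hj
    rw [hA _ (by omega), hM.edge i hi j hj]
  list := hL
  pow i hi := by rw [hA _ (by omega), hM.pow i hi]

/-- The test whether the vertex in variable `4` is used for padding. -/
def ePad : ℕ → Prog :=
  eOp .mul (eEq (eSum 12 (eVar 1) (eEq (eEntry (eVar 12)) (eVar 4))) (eLit 0))
    (eLt (eVar 1) (eOp .add (eOp .mul (eLit 3) (eVar 2)) (eLit 3)))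

/-- Choose vertices of high degree. -/
def choose : Prog :=
  .seq (scan eFree) (.seq (scan ePad) finish)

theorem Cm.choose (hs : ∀ x y, adj x y → adj y x) (hir : ∀ x, ¬ adj x x) (hn : 1 ≤ n)
    (hv : Vars n k k p v) (hk : k = S₀.length) (hM : Tables n k p adj S₀ M) (hw : Room w n k p)
    (hp : p = n * n + n + 1) (hd : p + (3 * k + 4) + 2 ^ (3 * k + 3) * (3 * k + 3) < 2 ^ w)
    (hM0 : ∀ a, p + (3 * k + 4) ≤ a → M a = 0) (hS : LowList adj n n S₀) :
    Cm w choose (n * (12 * n + 2 ^ k * (250 * (k + 1) ^ 2) + 42) + 2 + (n * (12 * n + 33) + 2 +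
      (2 ^ (3 * k + 3) * (3 * k + 3) * ((3 * k + 3) * 60 + 80) + (3 * k + 3) * 60 + 100))) v M
      fun v' _ => v' 0 = tv (n = 1 ∨ (2 < n ∧ HamOn adj (Finset.range n))) := by
  have h1 := hw.addr
  have h2 := hw.set
  have h3 := hw.pos
  have h4 : n ≤ n * n := Nat.le_mul_self n
  have hpos : 2 ^ 3 ≤ 2 ^ (3 * k + 3) := Nat.pow_le_pow_right (by norm_num) (by omega)
  have hScr := hv.scratch 12 (by omega)
  have hSlt : ∀ x ∈ S₀, x < n := fun x hx => ((hS.2 x).1 hx).1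
  have hlt : ∀ i Y, Greedy adj n S₀ i Y → ∀ x ∈ S₀ ++ Y, x < n := by
    intro i Y hY x hx
    rcases List.mem_append.1 hx with hx | hx
    exacts [hSlt x hx, (hY.high x hx).1]
  have c1 := Cm.scan (w := w) (e := eFree) (T := 12 * n + 2 ^ k * (250 * (k + 1) ^ 2) + 30)
    (P := fun i L => ∃ Y, L = S₀ ++ Y ∧ Greedy adj n S₀ i Y) (φ := fun i L => Free adj L k i)
    h1 hv.hn (hv.hc.trans hk) hM.list ⟨[], by simp, by simpa using hS.1, by simp, ?_, by simp⟩
    ?_ ?_ ?_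
  rotate_left
  · intro T _
    have : confined adj S₀.toFinset ([] : List ℕ).toFinset T = ∅ := by
      ext y
      simp [mem_confined]
    rw [this]
    simp
  · rintro i - _ ⟨Y, rfl, hY⟩
    exact length_le_of_nodup hY.nodup (hlt i Y hY)
  · rintro i hi _ ⟨Y, rfl, hY⟩
    have hstep := hY.step hi hS
    subst hk
    rw [free_iff hY.nodup]
    exact ⟨fun h => ⟨Y ++ [i], by simp, hstep.1 h⟩, fun h => ⟨Y, rfl, hstep.2 h⟩⟩
  · rintro i hi _ M₁ ⟨Y, rfl, hY⟩ hA hL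
    have hlen := hY.length_le
    refine Ev.free (c := (S₀ ++ Y).length) (p := p) (hv.update_length.update_low (by omega)) rfl
      (hM.of_agree hp hA hL) hw (hlt i Y hY) (length_le_of_nodup hY.nodup (hlt i Y hY)) ?_ ?_
      (by simp) hi
    all_goals
      rw [List.length_append]
      omega
  refine (c1.seq (T₂ := (n * (12 * n + 33) + 2 +
    (2 ^ (3 * k + 3) * (3 * k + 3) * ((3 * k + 3) * 60 + 80) + (3 * k + 3) * 60 + 100))) ?_).mono
    (by ring_nf; omega) fun _ _ h => h
  rintro _ M₁ ⟨_, ⟨Y, rfl, hY⟩, rfl, hA₁, hL₁⟩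
  have hlenY := hY.length_le
  have hv₁ : Vars n (S₀ ++ Y).length k p (Function.update (Function.update v 1 (S₀ ++ Y).length) 4 n) :=
    hv.update_length.update_low (by omega)
  set v₁ := Function.update (Function.update v 1 (S₀ ++ Y).length) 4 n with hv₁def
  have hM₁ := hM.of_agree hp hA₁ hL₁
  have hM₁0 : ∀ a, p + (3 * k + 4) ≤ a → M₁ a = 0 := fun a ha => by
    rw [hA₁ a (by omega), hM0 a ha]
  have hlt' : ∀ i Z, Padded adj n S₀ Y i Z → ∀ x ∈ S₀ ++ Y ++ Z, x < n := by
    intro i Z hZ x hx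
    rcases List.mem_append.1 hx with hx | hx
    exacts [hlt n Y hY x hx, (hZ.high x hx).1]
  have hScr₁ := hv₁.scratch 12 (by omega)
  have c2 := Cm.scan (v := v₁) (M := M₁) (e := ePad) (T := 12 * n + 21)
    (P := fun i L => ∃ Z, L = S₀ ++ Y ++ Z ∧ Padded adj n S₀ Y i Z)
    (φ := fun i L => i ∉ L ∧ L.length < 3 * k + 3)
    h1 hv₁.hn hv₁.hc hL₁ ⟨[], by simp, by simpa using hY.nodup, by simp, ?_, by simp⟩
    ?_ ?_ ?_
  rotate_left
  · rw [List.append_nil, List.length_append]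
    omega
  · rintro i - _ ⟨Z, rfl, hZ⟩
    exact length_le_of_nodup hZ.nodup (hlt' i Z hZ)
  · rintro i hi _ ⟨Z, rfl, hZ⟩
    have hstep := hZ.step hi hS
    rw [← hk] at hstep
    exact ⟨fun h => ⟨Z ++ [i], by simp, hstep.1 h⟩, fun h => ⟨Z, rfl, hstep.2 h⟩⟩
  · rintro i hi _ M₂ ⟨Z, rfl, hZ⟩ hA hL
    have hln := length_le_of_nodup hZ.nodup (hlt' i Z hZ)
    have hvi : Vars n (S₀ ++ Y ++ Z).length k p
        (Function.update (Function.update v₁ 1 (S₀ ++ Y ++ Z).length) 4 i) :=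
      hv₁.update_length.update_low (by omega)
    have hk3 : 3 * k + 3 < 2 ^ (3 * k + 3) := Nat.lt_two_pow_self
    have hScr₂ := hvi.scratch 12 (by omega)
    refine (Ev.mulTv h3 (Ev.notMem hL hvi.hn hvi.hc (by omega) h3 h1 (hlt' i Z hZ) hln (by simp) hi)
      (Ev.ltTv h3 (Ev.var hvi.hc (by omega)) (Ev.add (Ev.mul (Ev.lit (by omega))
      (Ev.var hvi.hk (by omega)) (by omega)) (Ev.lit (by omega)) (by omega)))).congr rfl (by omega)
  refine c2.seq ?_
  rintro _ M₂ ⟨_, ⟨Z, rfl, hZ⟩, rfl, hA₂, hL₂⟩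
  set L := S₀ ++ Y ++ Z with hLdef
  have hlenL := hZ.length_le
  have hln := length_le_of_nodup hZ.nodup (hlt' n Z hZ)
  rw [← hLdef, ← hk] at hlenL
  rw [← hLdef] at hln
  -- Padding leaves the list nonempty even when no vertex is low; the path recursion needs the
  -- starting index `0`.
  have hL0 : 0 < L.length := by
    rcases hZ.full with hf | hf
    · exact List.length_pos_of_mem (hf 0 (by omega))
    · rw [← hLdef] at hf
      omega
  have hkL : k ≤ L.length := by
    rw [hLdef, List.length_append, List.length_append]
    omega
  have hpow : 2 ^ L.length ≤ 2 ^ (3 * k + 3) := Nat.pow_le_pow_right (by norm_num) hlenL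
  have hmul : 2 ^ L.length * L.length ≤ 2 ^ (3 * k + 3) * (3 * k + 3) := Nat.mul_le_mul hpow hlenL
  -- The cost of the dynamic programme grows with the number of chosen vertices, so its value at the
  -- maximal length `3k + 3` bounds it.
  have hmul2 := Nat.mul_le_mul hmul (show L.length * 60 + 80 ≤ (3 * k + 3) * 60 + 80 by omega)
  refine (Cm.finish (c := L.length) (hv₁.update_length.update_low (by omega)) rfl
    (hM₁.of_agree hp hA₂ hL₂) hw (hlt' n Z hZ) hln hkL hlenL (by omega) (by omega) ?_ hL0).mono
    (by omega) ?_
  · intro a ha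
    rw [hA₂ a (by omega), hM₁0 a ha]
  · intro v' _ hv'
    rw [hv']
    refine tv_congr (or_congr Iff.rfl (and_congr_right fun hn2 => ?_))
    rw [← hamOn_chosen_iff hs hir (by omega) hS hY hZ, ← hLdef]
    refine hamOn_link_iff hZ.nodup fun i hi => ?_
    have hget : L.getD i 0 ∈ L := by
      rw [List.getD_eq_getElem _ _ hi]
      exact List.getElem_mem _
    constructor
    · intro hlow
      by_contra hik
      refine hlow ((hS.2 _).1 ?_).2
      rw [hLdef, List.append_assoc, List.getD_append _ _ _ _ (by omega),
        List.getD_eq_getElem _ _ (by omega)]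
      exact List.getElem_mem _
    · intro hik
      rw [hLdef, List.append_assoc, List.getD_append_right _ _ _ _ (by omega)]
      have hi' : i - S₀.length < (Y ++ Z).length := by
        rw [hLdef, List.append_assoc, List.length_append] at hi
        omega
      rw [List.getD_eq_getElem _ _ hi']
      rcases List.mem_append.1 (List.getElem_mem hi') with h | h
      exacts [(hY.high _ h).2, (hZ.high _ h).2]

/-- The whole program. -/
def program : Prog :=
  .seq (scan eLow) (.seq (assign 2 (eVar 1))
    (.seq (assign 5 (eOp .add (eOp .add (eOp .mul (eVar 0) (eVar 0)) (eVar 0)) (eLit 1)))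
      (.seq powTable (.seq (assign 6 (ePow (eVar 2))) choose))))

/-- The run never sees `K`: the first scan counts the low vertices, and everything after it depends
on that number `k`. Since all bounds are monotone and `k ≤ K`, they may be stated with `K`. -/
theorem Cm.program {K : ℕ} (hs : ∀ x y, adj x y → adj y x) (hir : ∀ x, ¬ adj x x) (hn : 1 ≤ n)
    (hv0 : v 0 = n) (hv : ∀ r, r ≠ 0 → v r = 0)
    (hM : ∀ i < n, ∀ j < n, M (i * n + j) = tv (adj i j)) (hM0 : ∀ a, n * n ≤ a → M a = 0)
    (hK : ∀ S, LowList adj n n S → S.length ≤ K)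
    (hw : n * n + n + 1 + (3 * K + 4) + 2 ^ (3 * K + 3) * (3 * K + 3) < 2 ^ w) :
    Cm w program (n * (9 * n + 12 + 12) + 2 + (75 + 42 * K +
      (n * (12 * n + 2 ^ K * (250 * (K + 1) ^ 2) + 42) + 2 + (n * (12 * n + 33) + 2 +
      (2 ^ (3 * K + 3) * (3 * K + 3) * ((3 * K + 3) * 60 + 80) + (3 * K + 3) * 60 + 100))))) v M
      fun v' _ => v' 0 = tv (n = 1 ∨ (2 < n ∧ HamOn adj (Finset.range n))) := by
  have h4 : n ≤ n * n := Nat.le_mul_self n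
  have h3 : 0 < w := by
    rcases Nat.eq_zero_or_pos w with rfl | h
    · simp at hw
    · exact h
  have c1 := Cm.scan (w := w) (v := v) (M := M) (e := eLow) (T := 9 * n + 12) (L₀ := [])
    (P := LowList adj n) (φ := fun i _ => Low adj n i) (by omega) hv0 (by simp [hv])
    (fun i hi => by simp at hi) ⟨by simp, by simp⟩
    (fun i hi L hL => length_le_of_nodup hL.1 fun x hx => by have := (hL.2 x).1 hx; omega)
    (fun i hi L hL => hL.step) ?_
  rotate_left
  · intro i hi L M' hL hA hL'
    refine Ev.low (fun i hi j hj => ?_) (by simp [hv0]) (by simp [hv]) h3 (by omega) (by simp) hi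
    have := mul_add_lt_mul_self hi hj
    rw [hA _ (by omega), hM i hi j hj]
  refine (c1.seq (T₂ := 75 + 42 * K +
      (n * (12 * n + 2 ^ K * (250 * (K + 1) ^ 2) + 42) + 2 + (n * (12 * n + 33) + 2 +
      (2 ^ (3 * K + 3) * (3 * K + 3) * ((3 * K + 3) * 60 + 80) + (3 * K + 3) * 60 + 100)))) ?_).mono
    (by omega) fun _ _ h => h
  rintro _ M₁ ⟨S₀, hS, rfl, hA, hL⟩
  have hkK := hK S₀ hS
  obtain ⟨k, hk⟩ : ∃ k, k = S₀.length := ⟨_, rfl⟩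
  rw [← hk] at hkK ⊢
  obtain ⟨p, hp⟩ : ∃ p, p = n * n + n + 1 := ⟨_, rfl⟩
  have hkn : k ≤ n := hk ▸ length_le_of_nodup hS.1 fun x hx => ((hS.2 x).1 hx).1
  have hpow : 2 ^ (3 * k + 3) ≤ 2 ^ (3 * K + 3) := Nat.pow_le_pow_right (by norm_num) (by omega)
  have hpos : 2 ^ 3 ≤ 2 ^ (3 * k + 3) := Nat.pow_le_pow_right (by norm_num) (by omega)
  have hmul : 2 ^ (3 * k + 3) * (3 * k + 3) ≤ 2 ^ (3 * K + 3) * (3 * K + 3) :=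
    Nat.mul_le_mul hpow (by omega)
  have hmul1 : 2 ^ (3 * k + 3) * 1 ≤ 2 ^ (3 * k + 3) * (3 * k + 3) :=
    Nat.mul_le_mul_left _ (by omega)
  have hroom : Room w n k p := ⟨by omega, by omega, by omega⟩
  set v₁ := Function.update (Function.update v 1 k) 4 n with hv₁
  have c2 : Cm w (assign 2 (eVar 1)) 2 v₁ M₁
      (fun v' M' => v' = Function.update v₁ 2 k ∧ M' = M₁) :=
    Cm.of_assign (x := k) (Ev.var (by simp [hv₁]) (by omega)) ⟨rfl, rfl⟩
  set v₂ := Function.update v₁ 2 k with hv₂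
  have hv₂0 : v₂ 0 = n := by simp [hv₂, hv₁, hv0]
  have c3 : Cm w (assign 5 (eOp .add (eOp .add (eOp .mul (eVar 0) (eVar 0)) (eVar 0)) (eLit 1)))
      8 v₂ M₁ (fun v' M' => v' = Function.update v₂ 5 p ∧ M' = M₁) :=
    (Cm.of_assign (x := n * n + n + 1) (Ev.add (Ev.add (Ev.mul (Ev.var hv₂0 (by omega))
      (Ev.var hv₂0 (by omega)) (by omega)) (Ev.var hv₂0 (by omega)) (by omega))
      (Ev.lit (by omega)) (by omega)) ⟨by rw [hp], rfl⟩).mono (by omega) fun _ _ h => h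
  have c4 := Cm.powTable (v := Function.update v₂ 5 p) (M := M₁) (w := w) (k := k) (p := p)
    (by simp [hv₂]) (by simp) (by omega) (by omega)
  have hkpow : 2 ^ k ≤ 2 ^ K := Nat.pow_le_pow_right (by norm_num) hkK
  have t1 : n * (12 * n + 2 ^ k * (250 * (k + 1) ^ 2) + 42) ≤
      n * (12 * n + 2 ^ K * (250 * (K + 1) ^ 2) + 42) := by gcongr
  have t2 := Nat.mul_le_mul hmul (show (3 * k + 3) * 60 + 80 ≤ (3 * K + 3) * 60 + 80 by omega)
  set Tc := n * (12 * n + 2 ^ k * (250 * (k + 1) ^ 2) + 42) + 2 + (n * (12 * n + 33) + 2 +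
      (2 ^ (3 * k + 3) * (3 * k + 3) * ((3 * k + 3) * 60 + 80) + (3 * k + 3) * 60 + 100)) with hTc
  refine (c2.seq (T₂ := 8 + ((42 * k + 60) + (5 + Tc))) ?_).mono (by omega) fun _ _ h => h
  rintro _ _ ⟨rfl, rfl⟩
  refine c3.seq ?_
  rintro _ _ ⟨rfl, rfl⟩
  refine c4.seq ?_
  rintro v₄ M₄ ⟨hv₄, hv₄16, hpow₄, hM₄⟩
  have hM₄edge : Tables n k p adj S₀ M₄ := by
    refine ⟨fun i hi j hj => ?_, fun i hi => ?_, hpow₄⟩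
    · have := mul_add_lt_mul_self hi hj
      rw [hM₄ _ (by omega), hA _ (by omega), hM i hi j hj]
    · rw [hM₄ _ (by omega), hL i hi]
  have hv₄' : ∀ r, r ≠ 9 → r ≠ 16 → v₄ r = if r = 0 then n else if r = 1 then k else
      if r = 2 then k else if r = 4 then n else if r = 5 then p else 0 := by
    intro r h9 h16
    rw [hv₄ r h9 h16, hv₂, hv₁]
    simp only [Function.update_apply]
    split_ifs <;> simp_all
  have hload : Ev w v₄ M₄ (ePow (eVar 2)) (2 ^ k) 4 := by
    have h5 : v₄ 5 = p := by rw [hv₄' _ (by omega) (by omega)]; simp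
    have h2 : v₄ 2 = k := by rw [hv₄' _ (by omega) (by omega)]; simp
    have hkk : 2 ^ k ≤ 2 ^ (3 * k + 3) := Nat.pow_le_pow_right (by norm_num) (by omega)
    exact (Ev.load (Ev.add (Ev.var h5 (by omega)) (Ev.var h2 (by omega)) (by omega))
      (hpow₄ k (by omega)) (by omega)).congr rfl (by omega)
  have c5 : Cm w (assign 6 (ePow (eVar 2))) 5 v₄ M₄
      (fun v' M' => v' = Function.update v₄ 6 (2 ^ k) ∧ M' = M₄) := Cm.of_assign hload ⟨rfl, rfl⟩
  refine c5.seq ?_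
  rintro _ _ ⟨rfl, rfl⟩
  refine Cm.choose hs hir hn ?_ hk hM₄edge hroom hp (by omega) ?_ hS
  · refine ⟨?_, ?_, ?_, ?_, ?_, fun r hr => ?_⟩
    · rw [Function.update_of_ne (by omega), hv₄' _ (by omega) (by omega)]; simp
    · rw [Function.update_of_ne (by omega), hv₄' _ (by omega) (by omega)]; simp
    · rw [Function.update_of_ne (by omega), hv₄' _ (by omega) (by omega)]; simp
    · rw [Function.update_of_ne (by omega), hv₄' _ (by omega) (by omega)]; simp
    · rw [Function.update_self]
    · rw [Function.update_of_ne (by omega)]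
      have h6 : 3 * k + 3 < 2 ^ (3 * k + 3) := Nat.lt_two_pow_self
      by_cases h16 : r = 16
      · rw [h16, hv₄16]
        omega
      · rw [hv₄' r (by omega) h16]
        simp only [show r ≠ 0 by omega, show r ≠ 1 by omega, show r ≠ 2 by omega,
          show r ≠ 4 by omega, show r ≠ 5 by omega, if_false]
        omega
  · intro a ha
    rw [hM₄ _ (by omega), hA _ (by omega), hM0 _ (by omega)]

end WordRAM

/-! ### Hamiltonian cycles as walks -/

theorem SimpleGraph.exists_walk_of_isChain {V : Type*} {G : SimpleGraph V} {a b : V} {t : List V}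
    (h : List.IsChain G.Adj (b :: (t ++ [a]))) : ∃ q : G.Walk b a, q.support = b :: (t ++ [a]) := by
  induction t generalizing b with
  | nil => exact ⟨.cons h.rel .nil, rfl⟩
  | cons c t ih =>
    obtain ⟨q, hq⟩ := ih h.of_cons
    exact ⟨.cons h.rel q, by rw [SimpleGraph.Walk.support_cons, hq, List.cons_append]⟩

/-- The cyclic list is the support of the closed walk without its first vertex. Three vertices are
needed because two adjacent ones already form a cyclic list, while the closed walk through them
repeats its edge. -/
theorem SimpleGraph.isHamiltonian_iff_hamOn {V : Type*} [Fintype V] [DecidableEq V]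
    {G : SimpleGraph V} (hV : 3 ≤ Fintype.card V) :
    G.IsHamiltonian ↔ HamOn G.Adj Finset.univ := by
  constructor
  · intro h
    obtain ⟨a, p, hp⟩ := h (by omega)
    rw [Walk.isHamiltonianCycle_iff_isCycle_and_support_count_tail_eq_one] at hp
    have hmem : ∀ x, x ∈ p.support.tail := fun x => List.count_pos_iff.1 (by rw [hp.2]; omega)
    have hne : p.support.tail ≠ [] := List.ne_nil_of_mem (hmem a)
    refine ⟨p.support.tail, List.nodup_iff_count_le_one.2 fun x => (hp.2 x).le, by simp [hmem], ?_⟩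
    rw [Cycle.chain_ne_nil _ hne, List.getLast_tail, Walk.getLast_support, Walk.cons_tail_support]
    exact p.isChain_adj_support
  · intro h _
    obtain ⟨a⟩ : Nonempty V := Fintype.card_pos_iff.1 (by omega)
    obtain ⟨t, hn, hm, hc⟩ := h.exists_cons (Finset.mem_univ a)
    have hlen : (a :: t).length = Fintype.card V := by
      rw [← List.toFinset_card_of_nodup hn, ← Finset.card_univ]
      congr 1
      ext x
      simpa using hm x
    rcases t with _ | ⟨b, _ | ⟨c, t⟩⟩
    · simp at hlen; omega
    · simp at hlen; omega
    obtain ⟨q, hq⟩ := SimpleGraph.exists_walk_of_isChain (a := a) (b := b) (t := c :: t) hc.of_cons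
    have hn' : q.support.Nodup := by
      rw [hq, ← List.cons_append, List.nodup_append_comm]
      exact hn
    have hab : G.Adj a b := hc.rel
    refine ⟨a, .cons hab q, ?_⟩
    rw [Walk.isHamiltonianCycle_iff_isCycle_and_support_count_tail_eq_one, Walk.cons_isCycle_iff]
    refine ⟨⟨Walk.IsPath.mk' hn', ?_⟩, ?_⟩
    · cases q with
      | nil => exact absurd rfl hab.ne
      | cons hbc q' =>
        rw [Walk.support_cons, List.cons.injEq] at hq
        rw [Walk.edges_cons, List.mem_cons, not_or]
        constructor
        · intro heq
          rw [Sym2.eq_iff] at heq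
          rename_i c'
          have hc' : c' = c := by
            have h1 := hq.2
            rw [← Walk.cons_tail_support, List.cons_append, List.cons.injEq] at h1
            exact h1.1
          subst hc'
          rcases heq with ⟨h1, -⟩ | ⟨h1, -⟩
          · exact hab.ne h1
          · subst h1
            simp at hn
        · intro hmem
          have := q'.snd_mem_support_of_mem_edges hmem
          rw [Walk.support_cons] at hn'
          exact (List.nodup_cons.1 hn').1 this
    · intro x
      rw [Walk.support_cons, List.tail_cons]
      refine List.count_eq_one_of_mem hn' ?_
      rw [hq]
      have := (hm x).2 (Finset.mem_univ x)
      simp only [List.mem_cons, List.mem_append, List.not_mem_nil, or_false] at this ⊢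
      tauto

namespace WordRAM

/-- The adjacency relation of a graph on `Fin n`, as a relation on numbers. -/
def natAdj {n : ℕ} (G : SimpleGraph (Fin n)) (i j : ℕ) : Prop :=
  ∃ (hi : i < n) (hj : j < n), G.Adj ⟨i, hi⟩ ⟨j, hj⟩

theorem hamOn_natAdj_iff {n : ℕ} (G : SimpleGraph (Fin n)) :
    HamOn (natAdj G) (Finset.range n) ↔ HamOn G.Adj Finset.univ := by
  constructor
  · intro h
    rcases Nat.eq_zero_or_pos n with rfl | hn
    · exact ⟨[], by simp, by simp, Cycle.Chain.nil _⟩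
    have himg : (Finset.range n).image (fun i => (⟨i % n, Nat.mod_lt _ hn⟩ : Fin n)) =
        Finset.univ := by
      ext ⟨i, hi⟩
      simp only [Finset.mem_image, Finset.mem_range, Finset.mem_univ, iff_true]
      exact ⟨i, hi, Fin.ext (Nat.mod_eq_of_lt hi)⟩
    rw [← himg]
    refine h.image ?_ ?_
    · intro x hx y hy hxy
      rw [Finset.mem_range] at hx hy
      simpa [Nat.mod_eq_of_lt hx, Nat.mod_eq_of_lt hy] using hxy
    · rintro x - y - ⟨hi, hj, hxy⟩
      simpa [Nat.mod_eq_of_lt hi, Nat.mod_eq_of_lt hj] using hxy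
  · intro h
    have himg : (Finset.univ : Finset (Fin n)).image Fin.val = Finset.range n := by
      ext i
      simp only [Finset.mem_image, Finset.mem_range, Finset.mem_univ, true_and]
      exact ⟨fun ⟨x, hx⟩ => hx ▸ x.2, fun hi => ⟨⟨i, hi⟩, rfl⟩⟩
    rw [← himg]
    exact h.image (fun x _ y _ hxy => Fin.ext hxy) fun x _ y _ hxy => ⟨x.2, y.2, hxy⟩

/-- The two small orders are split off because cyclic lists treat them differently: a one-vertex
list would need a loop, and a single edge would count as a cycle. -/
theorem isHamiltonian_iff {n : ℕ} (hn : 1 ≤ n) (G : SimpleGraph (Fin n)) :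
    G.IsHamiltonian ↔ n = 1 ∨ (2 < n ∧ HamOn (natAdj G) (Finset.range n)) := by
  rcases (by omega : n = 1 ∨ n = 2 ∨ 3 ≤ n) with rfl | rfl | h
  · simpa using SimpleGraph.IsHamiltonian.of_card_eq_one (by simp)
  · simpa using SimpleGraph.not_isHamiltonian_of_card_eq_two (by simp)
  · rw [SimpleGraph.isHamiltonian_iff_hamOn (by simpa using h), hamOn_natAdj_iff]
    constructor
    · exact fun h' => Or.inr ⟨by omega, h'⟩
    · rintro (h' | h')
      exacts [absurd h' (by omega), h'.2]

theorem rowCard_natAdj {n : ℕ} (G : SimpleGraph (Fin n)) [DecidableRel G.Adj] (v : Fin n) :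
    rowCard (natAdj G) n v = G.degree v := by
  classical
  rw [rowCard, Finset.sum_range, ← SimpleGraph.card_neighborFinset_eq_degree,
    SimpleGraph.neighborFinset_eq_filter, Finset.card_filter]
  refine Finset.sum_congr rfl fun j _ => ?_
  rw [tv_eq_ite]
  refine if_congr ?_ rfl rfl
  exact ⟨fun ⟨_, _, h⟩ => h, fun h => ⟨v.2, j.2, h⟩⟩

theorem LowList.length_le {n k : ℕ} (G : SimpleGraph (Fin n)) [DecidableRel G.Adj]
    (hk : n - k ≤ (Finset.univ.filter fun v : Fin n => (n : ℚ) / 2 ≤ G.degree v).card)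
    {S : List ℕ} (hS : LowList (natAdj G) n n S) : S.length ≤ k := by
  have h1 : S.length ≤ (Finset.univ.filter fun v : Fin n => ¬ (n : ℚ) / 2 ≤ G.degree v).card := by
    rw [← List.toFinset_card_of_nodup hS.1,
      ← Finset.card_image_of_injective (f := (Fin.val : Fin n → ℕ)) _ Fin.val_injective]
    refine Finset.card_le_card fun x hx => ?_
    obtain ⟨hxn, hlow⟩ := (hS.2 x).1 (List.mem_toFinset.1 hx)
    refine Finset.mem_image.2 ⟨⟨x, hxn⟩, ?_, rfl⟩
    rw [Finset.mem_filter]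
    refine ⟨Finset.mem_univ _, ?_⟩
    have h2 := rowCard_natAdj G ⟨x, hxn⟩
    rw [Low, h2] at hlow
    have h3 : (2 * G.degree ⟨x, hxn⟩ : ℚ) < n := by exact_mod_cast hlow
    intro h4
    linarith
  have h2 := Finset.card_filter_add_card_filter_not (s := (Finset.univ : Finset (Fin n)))
    (fun v : Fin n => (n : ℚ) / 2 ≤ G.degree v)
  rw [Finset.card_univ, Fintype.card_fin] at h2
  omega

theorem graphInput_mem {n : ℕ} (G : SimpleGraph (Fin n)) [DecidableRel G.Adj] {i j : ℕ} (hi : i < n)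
    (hj : j < n) : (graphInput G).mem (i * n + j) = tv (natAdj G i j) := by
  have h1 := mul_add_lt_mul_self hi hj
  have h2 : (i * n + j) / n = i := by
    rw [add_comm, Nat.add_mul_div_right _ _ (by omega), Nat.div_eq_of_lt hj, zero_add]
  have h3 : (i * n + j) % n = j := by
    rw [add_comm, Nat.add_mul_mod_self_right, Nat.mod_eq_of_lt hj]
  classical
  rw [tv_eq_ite]
  simp only [graphInput, dif_pos h1, h2, h3]
  refine if_congr ?_ rfl rfl
  exact ⟨fun h => ⟨hi, hj, h⟩, fun ⟨_, _, h⟩ => h⟩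

/-! ### Time and word length -/

/-- If `n ≤ 4 ^ K`, then `n * 2 ^ K ≤ 8 ^ K` and the first term pays. Otherwise both `2 ^ K` and `(K
+ 1) ^ 2` are less than `n`, and `n ^ 3` pays. For `K = 0` the first term vanishes. -/
theorem mul_two_pow_le (n K : ℕ) (hn : 1 ≤ n) :
    n * (2 ^ K * (K + 1) ^ 2) ≤ 4 * (8 ^ K * K ^ 2 + n ^ 3) := by
  rcases Nat.eq_zero_or_pos K with rfl | hK
  · have : n ≤ n ^ 3 := Nat.le_self_pow (by norm_num) n
    simp only [pow_zero]
    omega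
  have hK2 : (K + 1) ^ 2 ≤ 4 * K ^ 2 := by nlinarith
  by_cases hnK : n ≤ 4 ^ K
  · calc n * (2 ^ K * (K + 1) ^ 2) ≤ 4 ^ K * (2 ^ K * (4 * K ^ 2)) := by gcongr
      _ = 4 * (8 ^ K * K ^ 2) := by
        rw [show (8 : ℕ) = 4 * 2 from rfl, mul_pow]; ring
      _ ≤ _ := by omega
  · have hKp : K + 1 ≤ 2 ^ K := Nat.lt_two_pow_self
    have h4 : 2 ^ K * 2 ^ K = 4 ^ K := by rw [← mul_pow]; norm_num
    have h5 : (K + 1) ^ 2 ≤ 4 ^ K := by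
      rw [← h4, sq]; exact Nat.mul_le_mul hKp hKp
    have h6 : 2 ^ K ≤ 4 ^ K := Nat.pow_le_pow_left (by norm_num) K
    calc n * (2 ^ K * (K + 1) ^ 2) ≤ n * (n * n) := by
          refine Nat.mul_le_mul_left _ (Nat.mul_le_mul ?_ ?_) <;> omega
      _ = n ^ 3 := by ring
      _ ≤ _ := by omega

/-- The power is `8 * 8 ^ K`, and the other two factors are quadratic in `K`. At `K = 0` the
constant cost is paid by `n ^ 3 ≥ 1`. -/
theorem two_pow_mul_le (n K : ℕ) (hn : 1 ≤ n) :
    2 ^ (3 * K + 3) * (3 * K + 3) * ((3 * K + 3) * 60 + 80) ≤ 50000 * (8 ^ K * K ^ 2 + n ^ 3) := by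
  have h1 : 1 ≤ n ^ 3 := Nat.one_le_pow _ _ hn
  rcases Nat.eq_zero_or_pos K with rfl | hK
  · norm_num
    omega
  have h2 : 2 ^ (3 * K + 3) = 8 * 8 ^ K := by
    rw [pow_add, pow_mul]; norm_num; ring
  have h3 : (3 * K + 3) * ((3 * K + 3) * 60 + 80) ≤ 6000 * K ^ 2 := by nlinarith
  calc 2 ^ (3 * K + 3) * (3 * K + 3) * ((3 * K + 3) * 60 + 80)
      = 8 * 8 ^ K * ((3 * K + 3) * ((3 * K + 3) * 60 + 80)) := by rw [h2]; ring
    _ ≤ 8 * 8 ^ K * (6000 * K ^ 2) := Nat.mul_le_mul_left _ h3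
    _ = 48000 * (8 ^ K * K ^ 2) := by ring
    _ ≤ _ := by omega

theorem program_time_le (n K : ℕ) (hn : 1 ≤ n) :
    n * (9 * n + 12 + 12) + 2 + (75 + 42 * K +
      (n * (12 * n + 2 ^ K * (250 * (K + 1) ^ 2) + 42) + 2 + (n * (12 * n + 33) + 2 +
      (2 ^ (3 * K + 3) * (3 * K + 3) * ((3 * K + 3) * 60 + 80) + (3 * K + 3) * 60 + 100)))) ≤
      100000 * (8 ^ K * K ^ 2 + n ^ 3) := by
  have h1 := mul_two_pow_le n K hn
  have h2 := two_pow_mul_le n K hn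
  have h3 : n * n ≤ n ^ 3 := by nlinarith
  have h4 : n ≤ n * n := Nat.le_mul_self n
  have h5 : K ≤ 8 ^ K * K ^ 2 := by
    have : 1 ≤ 8 ^ K := Nat.one_le_pow _ _ (by norm_num)
    nlinarith [Nat.le_self_pow (two_ne_zero) K]
  have e1 : n * (9 * n + 12 + 12) = 9 * (n * n) + 24 * n := by ring
  have e2 : n * (12 * n + 2 ^ K * (250 * (K + 1) ^ 2) + 42) =
      12 * (n * n) + 250 * (n * (2 ^ K * (K + 1) ^ 2)) + 42 * n := by ring
  have e3 : n * (12 * n + 33) = 12 * (n * n) + 33 * n := by ring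
  rw [e1, e2, e3]
  omega

/-- All quantities are polynomial in `X = 2 ^ (K + log n + 1)`, which exceeds both `n` and `K`; the
total has degree 4, and `X ≥ 2` lets the remaining factor `X ^ 16` swallow the coefficients. -/
theorem program_space_lt (n K C : ℕ) (hC : 20 ≤ C) :
    n * n + n + 1 + (3 * K + 4) + 2 ^ (3 * K + 3) * (3 * K + 3) <
      2 ^ (C * (K + Nat.log 2 n + 1)) := by
  set l := Nat.log 2 n
  have hn : n < 2 ^ (l + 1) := Nat.lt_pow_succ_log_self (by norm_num) n
  set X := 2 ^ (K + l + 1) with hX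
  have hnX : n < X := hn.trans_le (Nat.pow_le_pow_right (by norm_num) (by omega))
  have hKX : K + l + 1 < X := Nat.lt_two_pow_self
  have hX2 : 2 ≤ X := by
    calc 2 = 2 ^ 1 := rfl
      _ ≤ X := Nat.pow_le_pow_right (by norm_num) (by omega)
  have h1 : 2 ^ (3 * K + 3) ≤ X ^ 3 := by
    rw [hX, ← pow_mul]
    exact Nat.pow_le_pow_right (by norm_num) (by omega)
  have h2 : n * n ≤ X * X := Nat.mul_le_mul hnX.le hnX.le
  have h3 : 2 ^ (3 * K + 3) * (3 * K + 3) ≤ X ^ 3 * (3 * X) := Nat.mul_le_mul h1 (by omega)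
  have h4 : n * n + n + 1 + (3 * K + 4) + 2 ^ (3 * K + 3) * (3 * K + 3) <
      X * X + 4 * X + 5 + X ^ 3 * (3 * X) := by omega
  have h5 : X * X + 4 * X + 5 + X ^ 3 * (3 * X) ≤ X ^ 20 := by
    have g1 : 1 ≤ X := by omega
    have g2 : X * X ≤ X ^ 4 := by
      calc X * X = X ^ 2 := (sq X).symm
        _ ≤ X ^ 4 := Nat.pow_le_pow_right g1 (by norm_num)
    have g3 : X ≤ X ^ 4 := Nat.le_self_pow (by norm_num) X
    have g4 : 1 ≤ X ^ 4 := Nat.one_le_pow _ _ g1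
    have g5 : 2 ^ 16 ≤ X ^ 16 := Nat.pow_le_pow_left hX2 16
    calc X * X + 4 * X + 5 + X ^ 3 * (3 * X) = X * X + 4 * X + 5 + 3 * X ^ 4 := by ring
      _ ≤ 2 ^ 16 * X ^ 4 := by omega
      _ ≤ X ^ 16 * X ^ 4 := Nat.mul_le_mul_right _ g5
      _ = X ^ 20 := by ring
  have h6 : X ^ 20 ≤ 2 ^ (C * (K + l + 1)) := by
    rw [hX, ← pow_mul]
    exact Nat.pow_le_pow_right (by norm_num) (by nlinarith)
  omega

end WordRAM

theorem mainTheorem3 :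
    ∃ (P : WordRAM.Prog) (C : ℕ), ∀ (n : ℕ), 1 ≤ n →
      ∀ (G : SimpleGraph (Fin n)) [DecidableRel G.Adj] (k : ℕ),
        n - k ≤ (Finset.univ.filter fun v : Fin n => (n : ℚ) / 2 ≤ G.degree v).card →
          ∃ (t : ℕ) (s : WordRAM.State),
            WordRAM.Exec (C * (k + Nat.log 2 n + 1)) P (WordRAM.graphInput G) t s ∧
            t ≤ C * (8 ^ k * k ^ 2 + n ^ 3) ∧
            (G.IsHamiltonian → s.reg 0 = 1) ∧
            (¬ G.IsHamiltonian → s.reg 0 = 0) := by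
  -- The constant is dictated by `program_time_le`; the word length alone would be content with 20.
  refine ⟨WordRAM.program, 100000, fun n hn G _ k hk => ?_⟩
  obtain ⟨t, s, h1, h2, h3⟩ := WordRAM.Cm.program (w := 100000 * (k + Nat.log 2 n + 1))
    (v := (WordRAM.graphInput G).vars) (M := (WordRAM.graphInput G).mem)
    (adj := WordRAM.natAdj G) (K := k)
    (fun x y ⟨hx, hy, h⟩ => ⟨hy, hx, h.symm⟩) (fun x ⟨_, _, h⟩ => G.loopless.irrefl _ h) hn
    (by simp [WordRAM.State.vars, WordRAM.graphInput])
    (fun r hr => by simp [WordRAM.State.vars, WordRAM.graphInput, hr])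
    (fun i hi j hj => WordRAM.graphInput_mem G hi hj)
    (fun a ha => by simp only [WordRAM.graphInput, dif_neg (not_lt.2 ha)])
    (fun S hS => hS.length_le G hk) (WordRAM.program_space_lt n k _ (by norm_num))
    (WordRAM.graphInput G) rfl rfl
  have hreg : s.reg 0 = WordRAM.tv G.IsHamiltonian := by
    rw [WordRAM.tv_congr (WordRAM.isHamiltonian_iff hn G)]
    exact h3
  refine ⟨t, s, h1, h2.trans (WordRAM.program_time_le n k hn), fun h => ?_, fun h => ?_⟩
  · rw [hreg, WordRAM.tv_true h]
  · rw [hreg, WordRAM.tv_false h]
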